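/- **Setting.** Let $I=\{i_1,\dots,i_{|I|}\}$ be a finite set of Boolean situation variables and $A$ a finite set of actions, both explicitly listed in the input. A *condition* is a variable of $I$ or its negation. A *procedure* is a block "if $c_1$ then $a_1$ elsif … elsif $c_j$ then $a_j$ else $a_{j+1}$" with conditions $c_r$ and actions $a_r\in A$ ($j\ge 0$; for $j=0$ it is the single action $a_1$). A *selector* is a block of the same form whose $j+1$ bodies are blank procedure calls ($j=0$ is the default selector "if * then"). A *(two-level) system* is a selector each of whose slots is filled with a procedure; in a situation $s\in\{\mathrm{True},\mathrm{False}\}^I$ it executes the action chosen, by the first condition that holds, in the procedure that is chosen likewise by the selector. *Requirements* are a finite list $R$ of situation-action pairs $(s,a)$; a system *satisfies* $R$ if it executes $a$ in $s$ for each $(s,a)\in R$. *Libraries* are $\mathcal L=\{L_{sel},L_{prc}\}$, finite lists of selectors and of procedures; a system is *drawn from* $\mathcal L$ if its selector is in $L_{sel}$ and the procedures in all its slots are in $L_{prc}$. The *number of component types* of a system is one (its selector) plus the number of distinct procedures in its slots. A *code change* replaces one condition (in the selector or in the procedure in one slot) or one executed action (in the procedure in one slot). A *component change* replaces the selector by one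 from $L_{sel}$ with the same number of conditions, the procedures keeping their positions, or the procedure in one slot by one from $L_{prc}$. **Problems.** In each, output a system as described if one exists, and $\bot$ otherwise; all numerical bounds are natural numbers written in binary. * SCre-Spec: given $R$, $|sel|$, $|prc|$; a system that satisfies $R$, with at most $|sel|$ conditions in the selector and at most $|prc|$ in each procedure. * SCre-Comp: given $R$, $\mathcal L$, $d$; a system drawn from $\mathcal L$ that has at most $d$ component types and satisfies $R$. * SCre-CompA: given $R$, $\mathcal L$, $d$, $c_c$; a system that satisfies $R$ and is obtained by at most $c_c$ code changes from a system drawn from $\mathcal L$ that has at most $d$ component types. * SRec-Spec: given $R$, $|sel|$, $|prc|$, a system $S$ that satisfies $R$ and these two bounds, new requirements $R_{new}$, and $c_c$; a system $S'$ obtained from $S$ by at most $c_c$ code changes that satisfies the two bounds and $R\cup R_{new}$. * SRec-Comp: given $R$, $\mathcal L$, a system $S$ drawn from $\mathcal L$ that satisfies $R$, $R_{new}$, $c_l$, $d$; a system $S'$ obtained from $S$ by at most $c_l$ component changes that has at most $d$ component types and satisfies $R\cup R_{new}$. * SRec-CompA: given $R$, $\mathcal L$, a system $S$ drawn from $\mathcal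 L$ that satisfies $R$ and whose selector has at most $|I|+1$ conditions, $R_{new}$, $c_l$, $c_c$, $d$; a system $S'$ obtained from $S$ by a sequence of at most $c_l$ component changes and at most $c_c$ code changes, in any order, that has at most $d$ component types and satisfies $R\cup R_{new}$. **Theorem.** Each of the six problems is fixed-parameter tractable with respect to the parameter $|I|$: there are an algorithm that solves it, a function $f$ and a constant $c$ such that the algorithm's running time is at most $f(|I|)\,n^c$ on every input of size $n$. -/

import Mathlib

/-! ### Machine model: structured programs over cons cells, with a step count -/

/-- Values: pointers to immutable binary cons cells, or the empty pointer `nil`. -/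
inductive Val : Type
  | nil : Val
  | cons : Val → Val → Val

namespace Val

/-- The number of nodes of a value, written out as a tree. -/
def size : Val → ℕ
  | nil => 1
  | cons a b => a.size + b.size + 1

def hd : Val → Val
  | nil => nil
  | cons a _ => a

def tl : Val → Val
  | nil => nil
  | cons _ b => b

/-- Lists are coded as right-nested cons cells ending in `nil`. -/
def ofList {α : Type} (g : α → Val) : List α → Val
  | [] => nil
  | a :: l => cons (g a) (ofList g l)

def ofBool : Bool → Val
  | false => nil
  | true => cons nil nil

/-- Unary code, used for the sizes of the explicitly listed sets `I` and `A` and for indices into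
them. -/
def ofIndex (n : ℕ) : Val := ofList (fun _ : Unit => nil) (List.replicate n ())

/-- Binary code (least significant bit first), used for numerical bounds in the input. -/
def ofNat (n : ℕ) : Val := ofList ofBool n.bits

def ofPair {α β : Type} (g : α → Val) (h : β → Val) (p : α × β) : Val := cons (g p.1) (h p.2)

end Val

/-- WHILE programs over finitely many registers, each holding a value. The primitive instructions
are the constant-time operations of a pointer machine (there is no equality test on trees). -/
inductive Prog : Type
  | setNil (x : ℕ) : Prog
  | copy (x y : ℕ) : Prog
  | setCons (x y z : ℕ) : Prog
  | setHd (x y : ℕ) : Prog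
  | setTl (x y : ℕ) : Prog
  | seq (p q : Prog) : Prog
  | ite (x : ℕ) (p q : Prog) : Prog
  | loop (x : ℕ) (p : Prog) : Prog

/-- The contents of the registers. -/
abbrev Store : Type := ℕ → Val

/-- The initial store: the input is in register `0`, all other registers are empty. -/
def Store.start (v : Val) : Store := Function.update (fun _ => Val.nil) 0 v

/-- `Exec p σ τ t`: started in the store `σ`, the program `p` halts in the store `τ` after exactly
`t` steps; every primitive instruction and every test of a register takes one step. -/
inductive Exec : Prog → Store → Store → ℕ → Prop
  | setNil (x : ℕ) (σ : Store) : Exec (.setNil x) σ (Function.update σ x Val.nil) 1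
  | copy (x y : ℕ) (σ : Store) : Exec (.copy x y) σ (Function.update σ x (σ y)) 1
  | setCons (x y z : ℕ) (σ : Store) :
      Exec (.setCons x y z) σ (Function.update σ x (Val.cons (σ y) (σ z))) 1
  | setHd (x y : ℕ) (σ : Store) : Exec (.setHd x y) σ (Function.update σ x (σ y).hd) 1
  | setTl (x y : ℕ) (σ : Store) : Exec (.setTl x y) σ (Function.update σ x (σ y).tl) 1
  | seq {p q : Prog} {σ τ υ : Store} {t u : ℕ} :
      Exec p σ τ t → Exec q τ υ u → Exec (.seq p q) σ υ (t + u)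
  | iteTrue {x : ℕ} {p q : Prog} {σ τ : Store} {t : ℕ} :
      σ x ≠ Val.nil → Exec p σ τ t → Exec (.ite x p q) σ τ (t + 1)
  | iteFalse {x : ℕ} {p q : Prog} {σ τ : Store} {t : ℕ} :
      σ x = Val.nil → Exec q σ τ t → Exec (.ite x p q) σ τ (t + 1)
  | loopStop {x : ℕ} {p : Prog} {σ : Store} :
      σ x = Val.nil → Exec (.loop x p) σ σ 1
  | loopStep {x : ℕ} {p : Prog} {σ τ υ : Store} {t u : ℕ} :
      σ x ≠ Val.nil → Exec p σ τ t → Exec (.loop x p) τ υ u →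
        Exec (.loop x p) σ υ (t + u + 1)

/-! ### Search problems and fixed-parameter tractability -/

/-- A search problem: given an input `x` satisfying the input conditions `Valid x`, output some
`y : Out x` with `IsSol x y` if there is one, and the symbol `⊥` otherwise. -/
structure SearchProblem where
  Inst : Type
  Valid : Inst → Prop
  Out : Inst → Type
  IsSol : (x : Inst) → Out x → Prop
  codeInst : Inst → Val
  codeOut : (x : Inst) → Out x → Val

/-- The value `v` is a correct answer to the input `x`; the symbol `⊥` is coded by `nil`. -/
def SearchProblem.Correct (P : SearchProblem) (x : P.Inst) (v : Val) : Prop :=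
  (∃ y : P.Out x, P.IsSol x y ∧ v = Val.cons Val.nil (P.codeOut x y)) ∨
    ((∀ y : P.Out x, ¬ P.IsSol x y) ∧ v = Val.nil)

/-- `P` is fixed-parameter tractable with respect to the parameter `κ`: a single program solves
`P` in at most `f (κ x) * n ^ e` steps, where `n` is the size of the input. -/
def SearchProblem.FPTractable (P : SearchProblem) (κ : P.Inst → ℕ) : Prop :=
  ∃ (p : Prog) (f : ℕ → ℕ) (e : ℕ), ∀ x : P.Inst, P.Valid x →
    ∃ (τ : Store) (t : ℕ), Exec p (Store.start (P.codeInst x)) τ t ∧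
      t ≤ f (κ x) * (P.codeInst x).size ^ e ∧ P.Correct x (τ 0)

/-! ### Two-level software systems -/

/-- Truth values of the situation variables `i_1, …, i_m`. -/
abbrev Situation (m : ℕ) : Type := Fin m → Bool

/-- A condition: a situation variable or its negation. -/
structure Literal (m : ℕ) where
  var : Fin m
  negated : Bool

def Literal.holds {m : ℕ} (l : Literal m) (s : Situation m) : Bool :=
  xor l.negated (s l.var)

def Val.ofLiteral {m : ℕ} (l : Literal m) : Val := cons (ofIndex l.var) (ofBool l.negated)

/-- An `IF … THEN … ELSIF … THEN … ELSE …` block with bodies in `α`. If there is no condition, it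
consists of the single body `otherwise`. -/
structure Block (m : ℕ) (α : Type) where
  branches : List (Literal m × α)
  otherwise : α

namespace Block

variable {m : ℕ} {α : Type}

def runAux (s : Situation m) (o : α) : List (Literal m × α) → α
  | [] => o
  | b :: bs => if b.1.holds s then b.2 else runAux s o bs

/-- The body selected in the situation `s`: that of the first condition that holds. -/
def run (b : Block m α) (s : Situation m) : α := runAux s b.otherwise b.branches

/-- The conditions, from top to bottom. -/
def conds (b : Block m α) : List (Literal m) := b.branches.map Prod.fst

/-- The bodies, from top to bottom. -/
def bodies (b : Block m α) : List α := b.branches.map Prod.snd ++ [b.otherwise]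

/-- One condition is replaced by an arbitrary condition, or one body is changed according to
`r`. -/
inductive Change (r : α → α → Prop) : Block m α → Block m α → Prop
  | cond (pre post : List (Literal m × α)) (l l' : Literal m) (a o : α) :
      Change r ⟨pre ++ (l, a) :: post, o⟩ ⟨pre ++ (l', a) :: post, o⟩
  | body (pre post : List (Literal m × α)) (l : Literal m) (a a' o : α) : r a a' →
      Change r ⟨pre ++ (l, a) :: post, o⟩ ⟨pre ++ (l, a') :: post, o⟩
  | otherwise (bs : List (Literal m × α)) (o o' : α) : r o o' → Change r ⟨bs, o⟩ ⟨bs, o'⟩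

def code (g : α → Val) (b : Block m α) : Val :=
  Val.cons (Val.ofList (Val.ofPair Val.ofLiteral g) b.branches) (g b.otherwise)

end Block

/-- A procedure: a block whose bodies are actions from `A = {a_1, …, a_k}`. -/
abbrev Procedure (m k : ℕ) : Type := Block m (Fin k)

/-- A selector with blank procedure calls, given by its conditions; a selector with `j` conditions
has `j + 1` procedure slots, and `[]` is the default selector. -/
abbrev Selector (m : ℕ) : Type := List (Literal m)

/-- A two-level system: a selector whose slots are filled with procedures. -/
abbrev SoftSystem (m k : ℕ) : Type := Block m (Procedure m k)

/-- Requirements: a finite list of situation-action pairs. -/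
abbrev Requirements (m k : ℕ) : Type := List (Situation m × Fin k)

/-- A selector library and a procedure library. -/
structure Libraries (m k : ℕ) where
  sel : List (Selector m)
  prc : List (Procedure m k)

namespace SoftSystem

variable {m k : ℕ}

/-- The action executed in the situation `s`. -/
def exec (S : SoftSystem m k) (s : Situation m) : Fin k := (S.run s).run s

def Satisfies (S : SoftSystem m k) (R : Requirements m k) : Prop := ∀ r ∈ R, exec S r.1 = r.2

/-- At most `maxSel` conditions in the selector and at most `maxPrc` in each procedure. -/
def Consistent (S : SoftSystem m k) (maxSel maxPrc : ℕ) : Prop :=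
  S.conds.length ≤ maxSel ∧ ∀ p ∈ S.bodies, p.conds.length ≤ maxPrc

/-- All components of `S` are from the libraries. -/
def DrawnFrom (S : SoftSystem m k) (L : Libraries m k) : Prop :=
  S.conds ∈ L.sel ∧ ∀ p ∈ S.bodies, p ∈ L.prc

/-- The number of types of components: the selector, and the different procedures. -/
noncomputable def numTypes (S : SoftSystem m k) : ℕ := 1 + {p | p ∈ S.bodies}.ncard

/-- One code change: the condition of one statement, or the action executed by one statement, in
the selector or in one of the procedures of the system is replaced by another one. -/
def CodeChange (S T : SoftSystem m k) : Prop :=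
  Block.Change (Block.Change (fun _ _ : Fin k => True)) S T

/-- One component change: the selector is replaced by one from the library with as many conditions,
the procedures keeping their positions, or the procedure in one slot is replaced by one from the
library. -/
inductive CompChange (L : Libraries m k) : SoftSystem m k → SoftSystem m k → Prop
  | selector (S T : SoftSystem m k) : T.conds ∈ L.sel → T.bodies = S.bodies → CompChange L S T
  | branch (pre post : List (Literal m × Procedure m k)) (l : Literal m) (p p' o : Procedure m k) :
      p' ∈ L.prc → CompChange L ⟨pre ++ (l, p) :: post, o⟩ ⟨pre ++ (l, p') :: post, o⟩
  | otherwise (bs : List (Literal m × Procedure m k)) (o o' : Procedure m k) :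
      o' ∈ L.prc → CompChange L ⟨bs, o⟩ ⟨bs, o'⟩

/-- `CodeDerives c S T`: a sequence of `c` code changes transforms `S` into `T`. -/
inductive CodeDerives : ℕ → SoftSystem m k → SoftSystem m k → Prop
  | refl (S : SoftSystem m k) : CodeDerives 0 S S
  | step {c : ℕ} {S T U : SoftSystem m k} :
      CodeDerives c S T → CodeChange T U → CodeDerives (c + 1) S U

/-- `Derives L a c S T`: a sequence of `a` component changes and `c` code changes, in any order,
transforms `S` into `T`. -/
inductive Derives (L : Libraries m k) : ℕ → ℕ → SoftSystem m k → SoftSystem m k → Prop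
  | refl (S : SoftSystem m k) : Derives L 0 0 S S
  | comp {a c : ℕ} {S T U : SoftSystem m k} :
      Derives L a c S T → CompChange L T U → Derives L (a + 1) c S U
  | code {a c : ℕ} {S T U : SoftSystem m k} :
      Derives L a c S T → CodeChange T U → Derives L a (c + 1) S U

end SoftSystem

/-! ### Codes of the problem entities -/

namespace Val

def ofSituation {m : ℕ} (s : Situation m) : Val := ofList ofBool (List.ofFn s)

def ofAction {k : ℕ} (a : Fin k) : Val := ofIndex a

def ofRequirements {m k : ℕ} (R : Requirements m k) : Val := ofList (ofPair ofSituation ofAction) R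

def ofSelector {m : ℕ} (s : Selector m) : Val := ofList ofLiteral s

def ofProcedure {m k : ℕ} (p : Procedure m k) : Val := Block.code ofAction p

def ofSystem {m k : ℕ} (S : SoftSystem m k) : Val := Block.code ofProcedure S

def ofLibraries {m k : ℕ} (L : Libraries m k) : Val :=
  cons (ofList ofSelector L.sel) (ofList ofProcedure L.prc)

/-- Tuples. -/
def ofTuple (l : List Val) : Val := ofList id l

end Val

/-! ### The six problems

In all inputs `nI` is the number of situation variables and `nA` the number of actions. -/

structure SCreSpecInput where
  nI : ℕ
  nA : ℕ
  R : Requirements nI nA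
  maxSel : ℕ
  maxPrc : ℕ

def SCreSpec : SearchProblem where
  Inst := SCreSpecInput
  Valid _ := True
  Out x := SoftSystem x.nI x.nA
  IsSol x S := S.Consistent x.maxSel x.maxPrc ∧ S.Satisfies x.R
  codeInst x := Val.ofTuple [Val.ofIndex x.nI, Val.ofIndex x.nA, Val.ofRequirements x.R,
    Val.ofNat x.maxSel, Val.ofNat x.maxPrc]
  codeOut _ S := Val.ofSystem S

structure SCreCompInput where
  nI : ℕ
  nA : ℕ
  R : Requirements nI nA
  L : Libraries nI nA
  d : ℕ

def SCreComp : SearchProblem where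
  Inst := SCreCompInput
  Valid _ := True
  Out x := SoftSystem x.nI x.nA
  IsSol x S := S.DrawnFrom x.L ∧ S.numTypes ≤ x.d ∧ S.Satisfies x.R
  codeInst x := Val.ofTuple [Val.ofIndex x.nI, Val.ofIndex x.nA, Val.ofRequirements x.R,
    Val.ofLibraries x.L, Val.ofNat x.d]
  codeOut _ S := Val.ofSystem S

structure SCreCompAInput where
  nI : ℕ
  nA : ℕ
  R : Requirements nI nA
  L : Libraries nI nA
  d : ℕ
  cc : ℕ

def SCreCompA : SearchProblem where
  Inst := SCreCompAInput
  Valid _ := True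
  Out x := SoftSystem x.nI x.nA
  IsSol x S := ∃ S₀ : SoftSystem x.nI x.nA, S₀.DrawnFrom x.L ∧ S₀.numTypes ≤ x.d ∧
    (∃ c ≤ x.cc, SoftSystem.CodeDerives c S₀ S) ∧ S.Satisfies x.R
  codeInst x := Val.ofTuple [Val.ofIndex x.nI, Val.ofIndex x.nA, Val.ofRequirements x.R,
    Val.ofLibraries x.L, Val.ofNat x.d, Val.ofNat x.cc]
  codeOut _ S := Val.ofSystem S

structure SRecSpecInput where
  nI : ℕ
  nA : ℕ
  R : Requirements nI nA
  S : SoftSystem nI nA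
  maxSel : ℕ
  maxPrc : ℕ
  Rnew : Requirements nI nA
  cc : ℕ

def SRecSpec : SearchProblem where
  Inst := SRecSpecInput
  Valid x := x.S.Satisfies x.R ∧ x.S.Consistent x.maxSel x.maxPrc
  Out x := SoftSystem x.nI x.nA
  IsSol x S' := (∃ c ≤ x.cc, SoftSystem.CodeDerives c x.S S') ∧
    S'.Consistent x.maxSel x.maxPrc ∧ S'.Satisfies (x.R ++ x.Rnew)
  codeInst x := Val.ofTuple [Val.ofIndex x.nI, Val.ofIndex x.nA, Val.ofRequirements x.R,
    Val.ofSystem x.S, Val.ofNat x.maxSel, Val.ofNat x.maxPrc, Val.ofRequirements x.Rnew,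
    Val.ofNat x.cc]
  codeOut _ S' := Val.ofSystem S'

structure SRecCompInput where
  nI : ℕ
  nA : ℕ
  R : Requirements nI nA
  S : SoftSystem nI nA
  L : Libraries nI nA
  Rnew : Requirements nI nA
  cl : ℕ
  d : ℕ

def SRecComp : SearchProblem where
  Inst := SRecCompInput
  Valid x := x.S.Satisfies x.R ∧ x.S.DrawnFrom x.L
  Out x := SoftSystem x.nI x.nA
  IsSol x S' := (∃ a ≤ x.cl, SoftSystem.Derives x.L a 0 x.S S') ∧
    S'.numTypes ≤ x.d ∧ S'.Satisfies (x.R ++ x.Rnew)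
  codeInst x := Val.ofTuple [Val.ofIndex x.nI, Val.ofIndex x.nA, Val.ofRequirements x.R,
    Val.ofSystem x.S, Val.ofLibraries x.L, Val.ofRequirements x.Rnew, Val.ofNat x.cl,
    Val.ofNat x.d]
  codeOut _ S' := Val.ofSystem S'

structure SRecCompAInput where
  nI : ℕ
  nA : ℕ
  R : Requirements nI nA
  S : SoftSystem nI nA
  L : Libraries nI nA
  Rnew : Requirements nI nA
  cl : ℕ
  cc : ℕ
  d : ℕ

/-- Here the selector of the given system has at most `nI + 1` conditions, which is the maximal
number of conditions of a selector that can be evaluated in any situation without repetition. -/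
def SRecCompA : SearchProblem where
  Inst := SRecCompAInput
  Valid x := x.S.Satisfies x.R ∧ x.S.DrawnFrom x.L ∧ x.S.conds.length ≤ x.nI + 1
  Out x := SoftSystem x.nI x.nA
  IsSol x S' := (∃ a ≤ x.cl, ∃ c ≤ x.cc, SoftSystem.Derives x.L a c x.S S') ∧
    S'.numTypes ≤ x.d ∧ S'.Satisfies (x.R ++ x.Rnew)
  codeInst x := Val.ofTuple [Val.ofIndex x.nI, Val.ofIndex x.nA, Val.ofRequirements x.R,
    Val.ofSystem x.S, Val.ofLibraries x.L, Val.ofRequirements x.Rnew, Val.ofNat x.cl,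
    Val.ofNat x.cc, Val.ofNat x.d]
  codeOut _ S' := Val.ofSystem S'

/-! With `m` situation variables there are `2 ^ m` situations, `2 ^ 2 ^ m` sets of situations and `2
* m` literals. Lengths of blocks, the number of actions and the libraries are not bounded in terms
of `m`; the algorithms may depend on these only polynomially.

The common tool is a dynamic program along a block (`blockDP`). When the branches are rewritten from
top to bottom, all that matters for the rest is the set of situations in which every condition so
far has failed, and the cost so far. Costs are small numbers, so one partial block for each such
pair is enough. Applied to a procedure, this gives the possible numbers of code changes that make it
right on a given set of situations (`fixes`). Applied once more, with these numbers as costs of the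
selector's branches, it treats systems whose slots have lists of candidate procedures (`sysDP`).

Sequences of changes are replaced by a normal form (`SoftSystem.Derives.edit`, `Edit.derives`): the
selector and each slot are replaced from the library at most once, and code changes afterwards are
counted by Hamming distances.

SRec-Spec is `sysDP` with the present procedures as the only candidates (`codeFixes`). For
SCre-Spec, repeated conditions can be deleted (`Block.exists_short`), so systems with at most `2 *
m` conditions per block suffice, and these arise by code changes from blank ones (`creations`). For
SCre-CompA, library procedures with the same repair costs on all sets of situations are
interchangeable. Costs from `4 * m + 5` on need not be distinguished (`exists_cheap_fix`), so the
number of classes is bounded in terms of `m`, and all sets of representatives can be tried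
(`adaptations`). SCre-Comp is the case without code changes.

For SRec-Comp, a search runs through the library, and gives each procedure a set of situations or
declares it unused (`compFixes`); replacements are charged to procedures so that the total is the
number of slots changed (`newProc_spec`, `exists_assignPath_le`). For SRec-CompA there are at most
`m + 2` slots, so the new selector, the partition of the slots by equal new procedures and the set
of replaced slots can be enumerated (`mixedFixes`). The groups are then independent, and each is
optimised by the dynamic program for several source procedures at once (`fixMulti`).

Running times are not computed algorithm by algorithm. The predicate `FP` (one program, time and
output size within the bound) is closed under the list operations from which all algorithms are
composed. Computed numbers are unary, and the binary bounds of the input are only compared with them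
(`FPD.leBin`). -/

/-! ### Bounds of the form `g (parameter) * size ^ e` -/

/-- A parameter and a size for the elements of an index type. -/
class Scale (X : Type) where
  par : X → ℕ
  size : X → ℕ
  size_pos : ∀ x, 1 ≤ size x

/-- Local variables of a program are added to the index without affecting the scale, so bounds are
automatically uniform in them. -/
instance Scale.sigma {X : Type} [Scale X] (Y : X → Type) : Scale (Σ x, Y x) where
  par z := par z.1
  size z := size z.1
  size_pos z := size_pos z.1

instance Scale.subtype {X : Type} [Scale X] (P : X → Prop) : Scale {x // P x} where
  par z := par z.1
  size z := size z.1
  size_pos z := size_pos z.1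

/-- The function `b` is bounded by `g (par x) * size x ^ e`. -/
def Bdd {X : Type} [Scale X] (b : X → ℕ) : Prop :=
  ∃ (g : ℕ → ℕ) (e : ℕ), ∀ x, b x ≤ g (Scale.par x) * Scale.size x ^ e

section Bdd

variable {X : Type} [Scale X]

theorem Bdd.mono {a b : X → ℕ} (hb : Bdd b) (h : ∀ x, a x ≤ b x) : Bdd a := by
  obtain ⟨g, e, hg⟩ := hb
  exact ⟨g, e, fun x => (h x).trans (hg x)⟩

theorem Bdd.par (G : ℕ → ℕ) : Bdd (fun x : X => G (Scale.par x)) :=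
  ⟨G, 0, fun x => by simp⟩

theorem Bdd.const (n : ℕ) : Bdd (fun _ : X => n) := Bdd.par fun _ => n

theorem Bdd.scale : Bdd (fun x : X => Scale.size x) := ⟨fun _ => 1, 1, fun x => by simp⟩

theorem Bdd.add {a b : X → ℕ} (ha : Bdd a) (hb : Bdd b) : Bdd (fun x => a x + b x) := by
  obtain ⟨g, e, hg⟩ := ha
  obtain ⟨h, d, hh⟩ := hb
  refine ⟨fun n => g n + h n, max e d, fun x => ?_⟩
  rw [add_mul]
  have hx := Scale.size_pos x
  exact Nat.add_le_add
    ((hg x).trans (Nat.mul_le_mul_left _ (Nat.pow_le_pow_right hx (le_max_left _ _))))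
    ((hh x).trans (Nat.mul_le_mul_left _ (Nat.pow_le_pow_right hx (le_max_right _ _))))

theorem Bdd.mul {a b : X → ℕ} (ha : Bdd a) (hb : Bdd b) : Bdd (fun x => a x * b x) := by
  obtain ⟨g, e, hg⟩ := ha
  obtain ⟨h, d, hh⟩ := hb
  refine ⟨fun n => g n * h n, e + d, fun x => (Nat.mul_le_mul (hg x) (hh x)).trans (le_of_eq ?_)⟩
  ring

theorem Bdd.sigma {a : X → ℕ} (ha : Bdd a) (Y : X → Type) : Bdd (fun z : Σ x, Y x => a z.1) := by
  obtain ⟨g, e, hg⟩ := ha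
  exact ⟨g, e, fun z => hg z.1⟩

/-- Turns a bound for a loop body, whose local variables belong to the index, into a bound for every
round that depends on the input alone. -/
theorem Bdd.descend {Y : X → Type} {a : (Σ x, Y x) → ℕ} (ha : Bdd a) :
    ∃ b : X → ℕ, Bdd b ∧ ∀ x y, a ⟨x, y⟩ ≤ b x := by
  obtain ⟨g, e, hg⟩ := ha
  exact ⟨fun x => g (Scale.par x) * Scale.size x ^ e, ⟨g, e, fun _ => le_rfl⟩, fun x y => hg ⟨x, y⟩⟩

theorem Bdd.descendSubtype {P : X → Prop} {a : {x // P x} → ℕ} (ha : Bdd a) :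
    ∃ b : X → ℕ, Bdd b ∧ ∀ x h, a ⟨x, h⟩ ≤ b x := by
  obtain ⟨g, e, hg⟩ := ha
  exact ⟨fun x => g (Scale.par x) * Scale.size x ^ e, ⟨g, e, fun _ => le_rfl⟩, fun x y => hg ⟨x, y⟩⟩

end Bdd

/-! ### Values computed by programs within such bounds -/

/-- From the value `c x` in register `0`, one program computes `v x` into register `0`, within
bounded time, touching only finitely many registers. -/
def Comp {X : Type} [Scale X] (c v : X → Val) : Prop :=
  ∃ (p : Prog) (w : ℕ) (b : X → ℕ), Bdd b ∧ ∀ x (σ : Store), σ 0 = c x →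
    ∃ τ t, Exec p σ τ t ∧ t ≤ b x ∧ τ 0 = v x ∧ ∀ i, w ≤ i → τ i = σ i

namespace Comp

variable {X : Type} [Scale X] {c d u v : X → Val}

theorem self (c : X → Val) : Comp c c :=
  ⟨.copy 0 0, 1, fun _ => 1, Bdd.const 1, fun x σ h =>
    ⟨_, 1, Exec.copy 0 0 σ, le_rfl, by simp [h], fun i hi => by
      rw [Function.update_of_ne]; omega⟩⟩

theorem nil : Comp c (fun _ => Val.nil) :=
  ⟨.setNil 0, 1, fun _ => 1, Bdd.const 1, fun x σ h =>
    ⟨_, 1, Exec.setNil 0 σ, le_rfl, by simp, fun i hi => by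
      rw [Function.update_of_ne]; omega⟩⟩

theorem trans (h₁ : Comp c d) (h₂ : Comp d v) : Comp c v := by
  obtain ⟨p, w, b, hb, hp⟩ := h₁
  obtain ⟨q, w', b', hb', hq⟩ := h₂
  refine ⟨.seq p q, max w w', fun x => b x + b' x, hb.add hb', fun x σ hσ => ?_⟩
  obtain ⟨τ, t, he, ht, h0, hf⟩ := hp x σ hσ
  obtain ⟨υ, s, he', hs, h0', hf'⟩ := hq x τ h0
  exact ⟨υ, t + s, he.seq he', Nat.add_le_add ht hs, h0', fun i hi => by
    rw [hf' i (by omega), hf i (by omega)]⟩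

theorem hd (h : Comp c v) : Comp c (fun x => (v x).hd) :=
  h.trans ⟨.setHd 0 0, 1, fun _ => 1, Bdd.const 1, fun x σ h =>
    ⟨_, 1, Exec.setHd 0 0 σ, le_rfl, by simp [h], fun i hi => by
      rw [Function.update_of_ne]; omega⟩⟩

theorem tl (h : Comp c v) : Comp c (fun x => (v x).tl) :=
  h.trans ⟨.setTl 0 0, 1, fun _ => 1, Bdd.const 1, fun x σ h =>
    ⟨_, 1, Exec.setTl 0 0 σ, le_rfl, by simp [h], fun i hi => by
      rw [Function.update_of_ne]; omega⟩⟩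

theorem cons (h₁ : Comp c u) (h₂ : Comp c v) : Comp c (fun x => Val.cons (u x) (v x)) := by
  obtain ⟨p, w₁, b, hb, hp⟩ := h₁
  obtain ⟨q, w₂, b', hb', hq⟩ := h₂
  -- Registers `w` and `w + 1` are out of reach of both programs and differ from register `0`; they
  -- save the context and the first result.
  set w := max w₁ w₂ + 1 with hw
  refine ⟨.seq (.copy w 0) (.seq p (.seq (.copy (w + 1) 0) (.seq (.copy 0 w)
    (.seq q (.setCons 0 (w + 1) 0))))), w + 2, fun x => b x + b' x + 4,
    (hb.add hb').add (Bdd.const 4), fun x σ hσ => ?_⟩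
  obtain ⟨τ, t, he, ht, h0, hf⟩ := hp x (Function.update σ w (σ 0)) (by
    rw [Function.update_of_ne (by omega), hσ])
  obtain ⟨υ, s, he', hs, h0', hf'⟩ := hq x
    (Function.update (Function.update τ (w + 1) (τ 0)) 0 (Function.update τ (w + 1) (τ 0) w)) (by
      rw [Function.update_self, Function.update_of_ne (by omega), hf w (by omega),
        Function.update_self, hσ])
  refine ⟨_, 1 + (t + (1 + (1 + (s + 1)))), (Exec.copy w 0 σ).seq (he.seq ((Exec.copy _ _ _).seq
    ((Exec.copy _ _ _).seq (he'.seq (Exec.setCons _ _ _ _))))),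
    by beta_reduce; omega, ?_, fun i hi => ?_⟩
  · rw [Function.update_self, h0', hf' (w + 1) (by omega), Function.update_of_ne (by omega),
      Function.update_self, h0]
  · rw [Function.update_of_ne (by omega), hf' i (by omega), Function.update_of_ne (by omega),
      Function.update_of_ne (by omega), hf i (by omega), Function.update_of_ne (by omega)]

/-- Case distinction on whether `u x` is empty. -/
theorem ite (h : Comp c u) (h₁ : Comp (fun z : {x // u x ≠ Val.nil} => c z.1) fun z => v z.1)
    (h₂ : Comp (fun z : {x // u x = Val.nil} => c z.1) fun z => v z.1) : Comp c v := by
  refine (h.cons (self c)).trans ?_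
  obtain ⟨p, w₁, b, hb, hp⟩ := h₁
  obtain ⟨q, w₂, b', hb', hq⟩ := h₂
  obtain ⟨B, hB, hB'⟩ := hb.descendSubtype
  obtain ⟨C, hC, hC'⟩ := hb'.descendSubtype
  set w := max w₁ w₂ + 1 with hw
  refine ⟨.seq (.setHd w 0) (.seq (.setTl 0 0) (.ite w p q)), w + 1, fun x => B x + C x + 3,
    (hB.add hC).add (Bdd.const 3), fun x σ hσ => ?_⟩
  set σ₁ := Function.update (Function.update σ w (σ 0).hd) 0
    (Function.update σ w (σ 0).hd 0).tl with hσ₁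
  have h0 : σ₁ 0 = c x := by
    rw [hσ₁, Function.update_self, Function.update_of_ne (by omega), hσ]; rfl
  have hw' : σ₁ w = u x := by
    rw [hσ₁, Function.update_of_ne (by omega), Function.update_self, hσ]; rfl
  have hf₁ : ∀ i, w + 1 ≤ i → σ₁ i = σ i := fun i hi => by
    rw [hσ₁, Function.update_of_ne (by omega), Function.update_of_ne (by omega)]
  by_cases hx : u x = Val.nil
  · obtain ⟨τ, t, he, ht, h0, hf⟩ := hq ⟨x, hx⟩ σ₁ h0
    exact ⟨τ, 1 + (1 + (t + 1)), (Exec.setHd _ _ _).seq ((Exec.setTl _ _ _).seq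
      (Exec.iteFalse (hw'.trans hx) he)), by have := hC' x hx; beta_reduce; omega, h0,
      fun i hi => by rw [hf i (by omega), hf₁ i hi]⟩
  · obtain ⟨τ, t, he, ht, h0, hf⟩ := hp ⟨x, hx⟩ σ₁ h0
    exact ⟨τ, 1 + (1 + (t + 1)), (Exec.setHd _ _ _).seq ((Exec.setTl _ _ _).seq
      (Exec.iteTrue (fun h => hx (hw'.symm.trans h)) he)), by
        have := hB' x hx; beta_reduce; omega, h0,
      fun i hi => by rw [hf i (by omega), hf₁ i hi]⟩

/-- A loop over a list, where `a x i` is the value of the accumulator before round `i`. -/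
theorem fold {l : X → List Val} {a : X → ℕ → Val} (hl : Comp c fun x => Val.ofList id (l x))
    (hlen : Bdd fun x => (l x).length) (h0 : Comp c fun x => a x 0)
    (hs : Comp (fun z : Σ x, Fin (l x).length =>
      Val.cons (c z.1) (Val.cons (a z.1 z.2) ((l z.1)[z.2]))) fun z => a z.1 (z.2 + 1)) :
    Comp c fun x => a x (l x).length := by
  refine ((self c).cons (h0.cons hl)).trans ?_
  obtain ⟨p, w₁, b, hb, hp⟩ := hs
  obtain ⟨B, hB, hB'⟩ := hb.descend
  -- Register `w` holds the context, `w + 1` the accumulator and `w + 2` the rest of the list. The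
  -- program for one round leaves all three alone.
  set w := w₁ + 1 with hw
  set body : Prog := .seq (.setHd 0 (w + 2)) (.seq (.setCons 0 (w + 1) 0) (.seq (.setCons 0 w 0)
    (.seq (.setTl (w + 2) (w + 2)) (.seq p (.copy (w + 1) 0))))) with hbody
  -- Here `i` rounds are done and `n` are left. The `6` consists of the five instructions around `p`
  -- and the loop test.
  have key : ∀ (x : X) (n i : ℕ), i + n = (l x).length → ∀ σ : Store, σ w = c x →
      σ (w + 1) = a x i → σ (w + 2) = Val.ofList id ((l x).drop i) →
      ∃ τ t, Exec (.loop (w + 2) body) σ τ t ∧ t ≤ n * (B x + 6) + 1 ∧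
        τ (w + 1) = a x (l x).length ∧ ∀ i, w + 3 ≤ i → τ i = σ i := by
    intro x n
    induction n with
    | zero =>
      intro i hi σ _ h2 h3
      have hil : i = (l x).length := by omega
      refine ⟨σ, 1, Exec.loopStop ?_, by omega, by rw [h2, hil], fun _ _ => rfl⟩
      rw [h3, hil, List.drop_length]; rfl
    | succ n ih =>
      intro i hi σ h1 h2 h3
      have hil : i < (l x).length := by omega
      rw [List.drop_eq_getElem_cons hil] at h3
      set σ₁ := Function.update σ 0 (σ (w + 2)).hd with e1
      set σ₂ := Function.update σ₁ 0 (Val.cons (σ₁ (w + 1)) (σ₁ 0)) with e2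
      set σ₃ := Function.update σ₂ 0 (Val.cons (σ₂ w) (σ₂ 0)) with e3
      set σ₄ := Function.update σ₃ (w + 2) (σ₃ (w + 2)).tl with e4
      have hne : ∀ j, j ≠ 0 → σ₃ j = σ j := fun j hj => by
        rw [e3, Function.update_of_ne hj, e2, Function.update_of_ne hj, e1,
          Function.update_of_ne hj]
      have h40 : σ₄ 0 = Val.cons (c x) (Val.cons (a x i) (l x)[i]) := by
        rw [e4, Function.update_of_ne (by omega), e3, Function.update_self, e2,
          Function.update_self, Function.update_of_ne (by omega), e1, Function.update_self,
          Function.update_of_ne (by omega), Function.update_of_ne (by omega), h1, h2, h3]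
        rfl
      obtain ⟨τ, t, he, ht, ht0, hf⟩ := hp ⟨x, ⟨i, hil⟩⟩ σ₄ h40
      have hτ : ∀ j, w ≤ j → j ≠ w + 2 → τ j = σ j := fun j hj hj' => by
        rw [hf j (by omega), e4, Function.update_of_ne hj', hne j (by omega)]
      obtain ⟨υ, s, he', hs', hυ, hf'⟩ := ih (i + 1) (by omega)
        (Function.update τ (w + 1) (τ 0))
        (by rw [Function.update_of_ne (by omega), hτ w (by omega) (by omega), h1])
        (by rw [Function.update_self, ht0])
        (by
          rw [Function.update_of_ne (by omega), hf _ (by omega), e4, Function.update_self,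
            hne _ (by omega), h3]
          rfl)
      have hrun : Exec body σ (Function.update τ (w + 1) (τ 0)) (1 + (1 + (1 + (1 + (t + 1))))) :=
        (Exec.setHd _ _ _).seq ((Exec.setCons _ _ _ _).seq ((Exec.setCons _ _ _ _).seq
          ((Exec.setTl _ _ _).seq (he.seq (Exec.copy _ _ _)))))
      refine ⟨υ, _, Exec.loopStep (by rw [h3]; exact Val.noConfusion) hrun he', ?_, hυ,
        fun j hj => ?_⟩
      · have := hB' x ⟨i, hil⟩
        rw [add_mul, one_mul]
        omega
      · rw [hf' j hj, Function.update_of_ne (by omega), hτ j (by omega) (by omega)]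
  refine ⟨.seq (.setHd w 0) (.seq (.setTl (w + 1) 0) (.seq (.setTl (w + 2) (w + 1))
    (.seq (.setHd (w + 1) (w + 1)) (.seq (.loop (w + 2) body) (.copy 0 (w + 1)))))), w + 3,
    fun x => (l x).length * (B x + 6) + 6,
    (hlen.mul (hB.add (Bdd.const 6))).add (Bdd.const 6), fun x σ hσ => ?_⟩
  set σ₁ := Function.update σ w (σ 0).hd with e1
  set σ₂ := Function.update σ₁ (w + 1) (σ₁ 0).tl with e2
  set σ₃ := Function.update σ₂ (w + 2) (σ₂ (w + 1)).tl with e3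
  set σ₄ := Function.update σ₃ (w + 1) (σ₃ (w + 1)).hd with e4
  have h21 : σ₂ (w + 1) = Val.cons (a x 0) (Val.ofList id (l x)) := by
    rw [e2, Function.update_self, e1, Function.update_of_ne (by omega), hσ]; rfl
  obtain ⟨τ, t, he, ht, hτ, hf⟩ := key x (l x).length 0 (by omega) σ₄
    (by rw [e4, Function.update_of_ne (by omega), e3, Function.update_of_ne (by omega), e2,
          Function.update_of_ne (by omega), e1, Function.update_self, hσ]; rfl)
    (by rw [e4, Function.update_self, e3, Function.update_of_ne (by omega), h21]; rfl)
    (by rw [e4, Function.update_of_ne (by omega), e3, Function.update_self, h21]; rfl)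
  refine ⟨_, 1 + (1 + (1 + (1 + (t + 1)))), (Exec.setHd _ _ _).seq ((Exec.setTl _ _ _).seq
    ((Exec.setTl _ _ _).seq ((Exec.setHd _ _ _).seq (he.seq (Exec.copy _ _ _))))),
    by beta_reduce; omega,
    by rw [Function.update_self, hτ], fun i hi => ?_⟩
  rw [Function.update_of_ne (by omega), hf i hi, e4, Function.update_of_ne (by omega), e3,
    Function.update_of_ne (by omega), e2, Function.update_of_ne (by omega), e1,
    Function.update_of_ne (by omega)]

end Comp

/-! ### Testing trees for equality. -/

theorem Val.size_pos (v : Val) : 1 ≤ v.size := by cases v <;> simp [Val.size]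

theorem Val.size_ofList {α : Type} (g : α → Val) (l : List α) :
    (Val.ofList g l).size = (l.map fun a => (g a).size + 1).sum + 1 := by
  induction l with
  | nil => rfl
  | cons a l ih => simp only [Val.ofList, Val.size, ih, List.map_cons, List.sum_cons]; omega

/-- Compares the trees in the pairs on the work list in register `1`. -/
def Prog.compareLoop : Prog :=
  .loop 1 (.seq (.setHd 3 1) (.seq (.setTl 1 1) (.seq (.setHd 4 3) (.seq (.setTl 5 3)
    (.ite 4
      (.ite 5
        (.seq (.setHd 6 4) (.seq (.setHd 7 5) (.seq (.setCons 6 6 7) (.seq (.setTl 4 4)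
          (.seq (.setTl 5 5) (.seq (.setCons 4 4 5) (.seq (.setCons 1 4 1) (.setCons 1 6 1))))))))
        (.seq (.setNil 0) (.setNil 1)))
      (.ite 5 (.seq (.setNil 0) (.setNil 1)) (.setNil 2)))))))

open Classical in
-- Each round either stops with a mismatch or removes exactly one node from the first components on
-- the work list: an empty tree is dropped, or a cell is replaced by its two children. The total
-- size of the first components therefore bounds the number of rounds, however large the second
-- components are.
theorem Exec.compareLoop (n : ℕ) : ∀ (ws : List (Val × Val)) (σ : Store),
    (ws.map fun q => q.1.size).sum ≤ n → σ 1 = Val.ofList (Val.ofPair id id) ws →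
    σ 0 = Val.ofBool true → ∃ τ t, Exec Prog.compareLoop σ τ t ∧ t ≤ 20 * n + 1 ∧
      τ 0 = Val.ofBool (decide (∀ q ∈ ws, q.1 = q.2)) ∧ ∀ i, 8 ≤ i → τ i = σ i := by
  induction n with
  | zero =>
    rintro (_ | ⟨⟨u, v⟩, ws⟩) σ hn h1 h0
    · exact ⟨σ, 1, Exec.loopStop h1, by omega, by simpa using h0, fun _ _ => rfl⟩
    · have := Val.size_pos u
      simp only [List.map_cons, List.sum_cons] at hn
      omega
  | succ n ih =>
    rintro (_ | ⟨⟨u, v⟩, ws⟩) σ hn h1 h0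
    · exact ⟨σ, 1, Exec.loopStop h1, by omega, by simpa using h0, fun _ _ => rfl⟩
    have hne : σ 1 ≠ Val.nil := by rw [h1]; exact Val.noConfusion
    simp only [List.map_cons, List.sum_cons] at hn
    have hpos := Val.size_pos u
    rcases u with _ | ⟨u₁, u₂⟩ <;> rcases v with _ | ⟨v₁, v₂⟩
    · let σ' : Store := Function.update (Function.update σ 3 (Val.cons Val.nil Val.nil)) 1
        (Val.ofList (Val.ofPair id id) ws)
      let σ'' : Store := Function.update (Function.update (Function.update σ' 4 Val.nil) 5 Val.nil)
        2 Val.nil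
      obtain ⟨τ, t, he, ht, hτ, hf⟩ := ih ws σ'' (by omega) (by simp [σ'', σ'])
        (by simp [σ'', σ', h0])
      refine ⟨τ, 7 + t + 1, Exec.loopStep hne (show Exec _ σ σ'' 7 from ?_) he, by omega,
        by simp [hτ], fun i hi => ?_⟩
      · have := (Exec.setHd 3 1 σ).seq ((Exec.setTl 1 1 _).seq ((Exec.setHd 4 3 _).seq
          ((Exec.setTl 5 3 _).seq (Exec.iteFalse (x := 4) (p := (.ite 5 (.seq (.setHd 6 4)
            (.seq (.setHd 7 5) (.seq (.setCons 6 6 7) (.seq (.setTl 4 4) (.seq (.setTl 5 5)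
            (.seq (.setCons 4 4 5) (.seq (.setCons 1 4 1) (.setCons 1 6 1)))))))) (.seq (.setNil 0)
            (.setNil 1)))) (by simp [h1, Val.ofList, Val.hd, Val.ofPair])
            (Exec.iteFalse (x := 5) (p := .seq (.setNil 0) (.setNil 1))
            (by simp [h1, Val.ofList, Val.hd, Val.tl, Val.ofPair]) (Exec.setNil 2 _))))))
        convert this using 1
        simp [σ'', σ', h1, Val.ofList, Val.hd, Val.tl, Val.ofPair]
      · rw [hf i hi]
        simp only [σ'', σ']
        repeat rw [Function.update_of_ne (by omega)]
    · refine ⟨_, _, Exec.loopStep hne ((Exec.setHd _ _ _).seq ((Exec.setTl _ _ _).seq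
        ((Exec.setHd _ _ _).seq ((Exec.setTl _ _ _).seq (Exec.iteFalse ?_ (Exec.iteTrue ?_
          ((Exec.setNil _ _).seq (Exec.setNil _ _)))))))) (Exec.loopStop (by simp)), by omega,
          by simp [Val.ofBool], fun i hi => ?_⟩
      · simp [h1, Val.ofList, Val.hd, Val.ofPair]
      · simp [h1, Val.ofList, Val.hd, Val.tl, Val.ofPair]
      · iterate 6 rw [Function.update_of_ne (by omega)]
    · refine ⟨_, _, Exec.loopStep hne ((Exec.setHd _ _ _).seq ((Exec.setTl _ _ _).seq
        ((Exec.setHd _ _ _).seq ((Exec.setTl _ _ _).seq (Exec.iteTrue ?_ (Exec.iteFalse ?_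
          ((Exec.setNil _ _).seq (Exec.setNil _ _)))))))) (Exec.loopStop (by simp)), by omega,
          by simp [Val.ofBool], fun i hi => ?_⟩
      · simp [h1, Val.ofList, Val.hd, Val.ofPair]
      · simp [h1, Val.ofList, Val.hd, Val.tl, Val.ofPair]
      · iterate 6 rw [Function.update_of_ne (by omega)]
    · simp only [Val.size] at hn
      let σ' : Store := Function.update (Function.update (Function.update (Function.update σ 3
        (Val.cons (Val.cons u₁ u₂) (Val.cons v₁ v₂))) 7 v₁) 5 v₂) 6 (Val.cons u₁ v₁)
      let σ'' : Store := Function.update (Function.update σ' 4 (Val.cons u₂ v₂)) 1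
        (Val.ofList (Val.ofPair id id) ((u₁, v₁) :: (u₂, v₂) :: ws))
      obtain ⟨τ, t, he, ht, hτ, hf⟩ := ih ((u₁, v₁) :: (u₂, v₂) :: ws) σ''
        (by simp only [List.map_cons, List.sum_cons]; omega) (by simp [σ''])
        (by simp [σ'', σ', h0])
      refine ⟨τ, 14 + t + 1, Exec.loopStep hne (show Exec _ σ σ'' 14 from ?_) he, by omega, ?_,
        fun i hi => ?_⟩
      · have := (Exec.setHd 3 1 σ).seq ((Exec.setTl 1 1 _).seq
          ((Exec.setHd 4 3 _).seq ((Exec.setTl 5 3 _).seq (Exec.iteTrue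
            (q := (.ite 5 (.seq (.setNil 0) (.setNil 1)) (.setNil 2))) (x := 4) (by
            simp [h1, Val.ofList, Val.hd, Val.ofPair]) (Exec.iteTrue
            (q := (.seq (.setNil 0) (.setNil 1))) (x := 5) (by
            simp [h1, Val.ofList, Val.hd, Val.tl, Val.ofPair])
            ((Exec.setHd 6 4 _).seq ((Exec.setHd 7 5 _).seq ((Exec.setCons 6 6 7 _).seq
            ((Exec.setTl 4 4 _).seq ((Exec.setTl 5 5 _).seq ((Exec.setCons 4 4 5 _).seq
            ((Exec.setCons 1 4 1 _).seq (Exec.setCons 1 6 1 _)))))))))))))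
        convert this using 1
        funext i
        by_cases hi : i < 8
        · interval_cases i <;> simp [σ'', σ', h1, Val.ofList, Val.hd, Val.tl, Val.ofPair]
        · simp only [σ'', σ']
          repeat rw [Function.update_of_ne (by omega)]
      · rw [hτ]
        congr 1
        simp [and_assoc]
      · rw [hf i hi]
        simp only [σ'', σ']
        repeat rw [Function.update_of_ne (by omega)]

open Classical in
-- A bound for one of the two trees suffices, since only nodes of the first one are counted.
theorem Comp.eq {X : Type} [Scale X] {c u v : X → Val} (hu : Comp c u) (hv : Comp c v)
    (hb : Bdd fun x => (u x).size) : Comp c fun x => Val.ofBool (decide (u x = v x)) := by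
  refine (hu.cons hv).trans ?_
  refine ⟨.seq (.setNil 2) (.seq (.setCons 1 0 2) (.seq (.setCons 0 2 2) Prog.compareLoop)), 8,
    fun x => 20 * (u x).size + 4, ((Bdd.const 20).mul hb).add (Bdd.const 4), fun x σ hσ => ?_⟩
  obtain ⟨τ, t, he, ht, hτ, hf⟩ := Exec.compareLoop (u x).size [(u x, v x)]
    (Function.update (Function.update (Function.update σ 2 Val.nil) 1 (Val.cons (σ 0) Val.nil)) 0
      (Val.cons Val.nil Val.nil)) (by simp) (by simp [hσ, Val.ofList, Val.ofPair]) (by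
      simp [Val.ofBool])
  refine ⟨τ, 1 + (1 + (1 + t)), (Exec.setNil _ _).seq ((Exec.setCons _ _ _ _).seq
    ((Exec.setCons _ _ _ _).seq (by simpa using he))), by beta_reduce; omega, by simpa using hτ,
    fun i hi => ?_⟩
  rw [hf i hi]
  iterate 3 rw [Function.update_of_ne (by omega)]

/-! ### Codes of typed data -/

class Enc (α : Type) where
  enc : α → Val

open Enc

/-- Injectivity is what allows a test on codes to decide equality of the coded objects. -/
class LawfulEnc (α : Type) [Enc α] : Prop where
  inj : Function.Injective (enc : α → Val)

/-- A natural number that is coded in binary. -/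
structure Bin where
  val : ℕ

theorem Val.ofList_injective {α : Type} {g : α → Val} (hg : Function.Injective g) :
    Function.Injective (Val.ofList g) := by
  intro l
  induction l with
  | nil => rintro (_ | ⟨b, l'⟩) h <;> simp_all [Val.ofList]
  | cons a l ih =>
    rintro (_ | ⟨b, l'⟩) h
    · simp [Val.ofList] at h
    · simp only [Val.ofList, Val.cons.injEq] at h
      rw [hg h.1, ih h.2]

theorem Val.ofList_length {α β : Type} {g : α → Val} {h : β → Val} :
    ∀ {l : List α} {l' : List β}, Val.ofList g l = Val.ofList h l' → l.length = l'.length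
  | [], [], _ => rfl
  | [], _ :: _, e => by simp [Val.ofList] at e
  | _ :: _, [], e => by simp [Val.ofList] at e
  | _ :: _, _ :: _, e => by
    simp only [Val.ofList, Val.cons.injEq] at e
    simp [Val.ofList_length e.2]

theorem Val.ofIndex_injective : Function.Injective Val.ofIndex := fun a b h => by
  simpa using Val.ofList_length h

theorem Val.ofBool_injective : Function.Injective Val.ofBool := by
  rintro (_ | _) (_ | _) h <;> simp_all [Val.ofBool]

theorem Val.ofPair_injective {α β : Type} {g : α → Val} {h : β → Val}
    (hg : Function.Injective g) (hh : Function.Injective h) :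
    Function.Injective (Val.ofPair g h) := by
  rintro ⟨a, b⟩ ⟨a', b'⟩ e
  simp only [Val.ofPair, Val.cons.injEq] at e
  rw [hg e.1, hh e.2]

section instances

variable {α β : Type} [Enc α] [Enc β] {m k : ℕ}

instance : Enc Unit := ⟨fun _ => Val.nil⟩
instance : Enc Bool := ⟨Val.ofBool⟩
-- Being unary, a number with a code of bounded size is itself bounded (`FP.nat_bdd`). Binary inputs
-- have the separate type `Bin`.
instance : Enc ℕ := ⟨Val.ofIndex⟩
instance : Enc Bin := ⟨fun n => Val.ofNat n.val⟩
instance : Enc (Fin k) := ⟨Val.ofAction⟩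
instance : Enc (List α) := ⟨Val.ofList enc⟩
instance : Enc (α × β) := ⟨Val.ofPair enc enc⟩
-- This agrees with the code of answers, where `none` stands for `⊥`.
instance : Enc (Option α) := ⟨fun o => o.elim Val.nil fun a => Val.cons Val.nil (enc a)⟩
instance (P : α → Prop) : Enc {a // P a} := ⟨fun a => enc a.1⟩
instance : Enc (Literal m) := ⟨Val.ofLiteral⟩
instance : Enc (Fin m → Bool) := ⟨Val.ofSituation⟩
instance : Enc (Block m α) := ⟨Block.code enc⟩
instance : Enc (Libraries m k) := ⟨Val.ofLibraries⟩

variable [LawfulEnc α] [LawfulEnc β]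

instance : LawfulEnc Bool := ⟨Val.ofBool_injective⟩
instance : LawfulEnc ℕ := ⟨Val.ofIndex_injective⟩
instance : LawfulEnc (Fin k) := ⟨fun _ _ h => Fin.ext (Val.ofIndex_injective h)⟩
instance : LawfulEnc (List α) := ⟨Val.ofList_injective LawfulEnc.inj⟩
instance : LawfulEnc (α × β) := ⟨Val.ofPair_injective LawfulEnc.inj LawfulEnc.inj⟩

instance : LawfulEnc (Literal m) := ⟨by
  rintro ⟨v, b⟩ ⟨v', b'⟩ h
  simp only [enc, Val.ofLiteral, Val.cons.injEq] at h
  rw [Fin.ext (Val.ofIndex_injective h.1), Val.ofBool_injective h.2]⟩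

instance : LawfulEnc (Fin m → Bool) :=
  ⟨fun _ _ h => List.ofFn_injective (Val.ofList_injective Val.ofBool_injective h)⟩

instance : LawfulEnc (Block m α) := ⟨by
  rintro ⟨bs, o⟩ ⟨bs', o'⟩ h
  simp only [enc, Block.code, Val.cons.injEq] at h
  rw [Val.ofList_injective (Val.ofPair_injective (g := Val.ofLiteral)
    (LawfulEnc.inj (α := Literal m)) LawfulEnc.inj) h.1, LawfulEnc.inj h.2]⟩

end instances

/-! ### Sizes of codes. -/

theorem size_enc_list {α : Type} [Enc α] (l : List α) :
    (enc l).size = (l.map fun a => (enc a).size + 1).sum + 1 := Val.size_ofList enc l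

theorem length_lt_size_enc {α : Type} [Enc α] (l : List α) : l.length < (enc l).size := by
  rw [size_enc_list]
  have : l.length * 1 ≤ (l.map fun a => (enc a).size + 1).sum := by
    simp
  omega

theorem size_enc_le_of_mem {α : Type} [Enc α] {l : List α} {a : α} (h : a ∈ l) :
    (enc a).size ≤ (enc l).size := by
  rw [size_enc_list]
  have := List.single_le_sum (l := l.map fun a => (enc a).size + 1) (by simp) _
    (List.mem_map_of_mem h)
  omega

theorem size_enc_list_le {α : Type} [Enc α] {l : List α} {n b : ℕ} (hn : l.length ≤ n)
    (hb : ∀ a ∈ l, (enc a).size ≤ b) : (enc l).size ≤ n * (b + 1) + 1 := by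
  rw [size_enc_list]
  have := List.sum_le_card_nsmul (l.map fun a => (enc a).size + 1) (b + 1) (by
    simpa using hb)
  simp only [List.length_map, smul_eq_mul] at this
  exact Nat.add_le_add_right (this.trans (Nat.mul_le_mul_right _ hn)) 1

theorem size_enc_nat (n : ℕ) : (enc n).size = 2 * n + 1 := by
  show (Val.ofList _ _).size = _
  rw [Val.size_ofList]
  simp [Val.size, mul_comm]

theorem size_enc_pair {α β : Type} [Enc α] [Enc β] (p : α × β) :
    (enc p).size = (enc p.1).size + (enc p.2).size + 1 := rfl

theorem enc_list_eq_nil {α : Type} [Enc α] {l : List α} : enc l = Val.nil ↔ l = [] := by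
  cases l <;> simp [enc, Val.ofList]

/-! ### Typed terms computed within such bounds -/

section

variable {X : Type} [Scale X] {β γ δ : X → Type} [∀ x, Enc (β x)] [∀ x, Enc (γ x)]
  [∀ x, Enc (δ x)] {c : X → Val}

/-- The term `t` can be computed from the context `c`, and its code has bounded size. -/
def FP (c : X → Val) (t : ∀ x, β x) : Prop :=
  Comp c (fun x => enc (t x)) ∧ Bdd fun x => (enc (t x)).size

/-- The context `c` extended by one more variable. -/
def ext (c : X → Val) : (Σ x, β x) → Val := fun z => Val.cons (c z.1) (enc z.2)

/-- Decidability by a program. -/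
def FPD (c : X → Val) (P : X → Prop) : Prop :=
  FP c fun x => @decide (P x) (Classical.propDecidable _)

theorem Comp.reindex {X' : Type} [Scale X'] {c v : X → Val} (h : Comp c v) (φ : X' → X)
    (hp : ∀ x, Scale.par (φ x) = Scale.par x) (hs : ∀ x, Scale.size (φ x) = Scale.size x) :
    Comp (fun x => c (φ x)) fun x => v (φ x) := by
  obtain ⟨p, w, b, ⟨g, e, hb⟩, h⟩ := h
  exact ⟨p, w, fun x => b (φ x), ⟨g, e, fun x => by rw [← hp, ← hs]; exact hb _⟩,
    fun x => h (φ x)⟩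

theorem Bdd.reindex {X' : Type} [Scale X'] {b : X → ℕ} (h : Bdd b) (φ : X' → X)
    (hp : ∀ x, Scale.par (φ x) = Scale.par x) (hs : ∀ x, Scale.size (φ x) = Scale.size x) :
    Bdd fun x => b (φ x) := by
  obtain ⟨g, e, hb⟩ := h
  exact ⟨g, e, fun x => by rw [← hp, ← hs]; exact hb _⟩

namespace FP

/-- A program sees codes only, so a term may change its type as long as its code stays the same. -/
theorem ofEnc {s : ∀ x, β x} {t : ∀ x, γ x} (h : FP c s) (e : ∀ x, enc (t x) = enc (s x)) :
    FP c t := by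
  simpa only [FP, e] using h

theorem congr {s t : ∀ x, β x} (h : FP c s) (e : ∀ x, t x = s x) : FP c t :=
  h.ofEnc fun x => by rw [e]

theorem wk {t : ∀ x, γ x} (h : FP c t) :
    FP (ext c) fun z : Σ x, β x => t z.1 :=
  ⟨(Comp.self (ext c)).hd.trans (h.1.reindex (X' := Σ x, β x) (fun z => z.1) (fun _ => rfl)
    fun _ => rfl), h.2.sigma β⟩

theorem const {α : Type} [Enc α] (a : α) : FP c fun _ => a := by
  refine ⟨?_, Bdd.const _⟩
  show Comp c fun _ => enc a
  generalize enc a = v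
  induction v with
  | nil => exact Comp.nil
  | cons u v hu hv => exact hu.cons hv

theorem pair {s : ∀ x, β x} {t : ∀ x, γ x} (hs : FP c s) (ht : FP c t) :
    FP c fun x => (s x, t x) :=
  ⟨hs.1.cons ht.1, (hs.2.add ht.2).add (Bdd.const 1)⟩

theorem fst {p : ∀ x, β x × γ x} (h : FP c p) : FP c fun x => (p x).1 :=
  ⟨h.1.hd, h.2.mono fun x => by beta_reduce; rw [size_enc_pair]; omega⟩

theorem snd {p : ∀ x, β x × γ x} (h : FP c p) : FP c fun x => (p x).2 :=
  ⟨h.1.tl, h.2.mono fun x => by beta_reduce; rw [size_enc_pair]; omega⟩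

theorem nil : FP c fun x => ([] : List (β x)) := ⟨Comp.nil, Bdd.const 1⟩

theorem cons {a : ∀ x, β x} {l : ∀ x, List (β x)} (ha : FP c a) (hl : FP c l) :
    FP c fun x => a x :: l x :=
  ⟨ha.1.cons hl.1, (ha.2.add hl.2).add (Bdd.const 1)⟩

theorem tail {l : ∀ x, List (β x)} (hl : FP c l) : FP c fun x => (l x).tail := by
  have e : ∀ x, enc (l x).tail = (enc (l x)).tl := fun x => by cases l x <;> rfl
  refine ⟨by simpa only [e] using hl.1.tl, hl.2.mono fun x => ?_⟩
  rw [e]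
  cases enc (l x) <;> simp [Val.tl, Val.size]
  omega

theorem length_bdd {l : ∀ x, List (β x)} (hl : FP c l) : Bdd fun x => (l x).length :=
  hl.2.mono fun x => (length_lt_size_enc (l x)).le

theorem some {a : ∀ x, β x} (ha : FP c a) : FP c fun x => Option.some (a x) :=
  ⟨Comp.nil.cons ha.1, (ha.2.add (Bdd.const 2)).mono fun x => by
    show Val.size (Val.cons _ _) ≤ _
    simp [Val.size]; omega⟩

theorem none : FP c fun x => (Option.none : Option (β x)) := ⟨Comp.nil, Bdd.const 1⟩

/-- The variable of the branch ranges over the actual value of `o x` only, and this bounds its size.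
The hypothesis `hf` has the form of a typing rule: the branch may use that its variable is
computable. -/
theorem elim {o : ∀ x, Option (β x)} {b : ∀ x, γ x} {f : ∀ x, β x → γ x} (ho : FP c o)
    (hb : FP c b)
    (hf : FP (ext c) (fun z : Σ x, {y // o x = Option.some y} => z.2.1) →
      FP (ext c) fun z : Σ x, {y // o x = Option.some y} => f z.1 z.2.1) :
    FP c fun x => (o x).elim (b x) (f x) := by
  have hv : FP (ext c) (fun z : Σ x, {y // o x = Option.some y} => z.2.1) :=
    ⟨(Comp.self (ext c)).tl, (ho.2.sigma _).mono fun z => by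
      obtain ⟨x, y, hy⟩ := z
      simp only [hy]
      show _ ≤ (Val.cons _ (enc y)).size
      simp only [Val.size]
      omega⟩
  have hf' := hf hv
  have hsome : ∀ x, enc (o x) ≠ Val.nil → (o x).isSome := fun x hx => by
    cases h : o x with
    | none => simp [h, enc] at hx
    | some y => rfl
  refine ⟨ho.1.ite ?_ ?_, ?_⟩
  · refine (((Comp.self c).cons ho.1.tl).reindex (X' := {x // enc (o x) ≠ Val.nil})
      (fun z => z.1) (fun _ => rfl) (fun _ => rfl)).trans ?_
    convert hf'.1.reindex (X' := {x // enc (o x) ≠ Val.nil})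
      (fun z => ⟨z.1, (o z.1).get (hsome z.1 z.2), by simp⟩) (fun _ => rfl) (fun _ => rfl)
      using 2 with z z
    · obtain ⟨x, hx⟩ := z
      obtain ⟨y, hy⟩ := Option.isSome_iff_exists.1 (hsome x hx)
      simp only [ext, hy]
      rfl
    · obtain ⟨x, hx⟩ := z
      obtain ⟨y, hy⟩ := Option.isSome_iff_exists.1 (hsome x hx)
      simp [hy]
  · convert hb.1.reindex (X' := {x // enc (o x) = Val.nil}) (fun z => z.1) (fun _ => rfl)
      (fun _ => rfl) using 2 with z
    obtain ⟨x, hx⟩ := z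
    cases h : o x with
    | none => simp [h]
    | some y => simp [h, enc] at hx
  · obtain ⟨B, hB, hB'⟩ := hf'.2.descend
    refine (hb.2.add hB).mono fun x => ?_
    cases h : o x with
    | none => simp [h]
    | some y =>
      have := hB' x ⟨y, h⟩
      simp only [h, Option.elim] at this ⊢
      omega

theorem ite {P : X → Prop} {s t : ∀ x, β x} {inst : ∀ x, Decidable (P x)} (hP : FPD c P)
    (hs : FP c s) (ht : FP c t) : FP c fun x => if P x then s x else t x := by
  refine ⟨hP.1.ite ?_ ?_, (hs.2.add ht.2).mono fun x => by beta_reduce; split_ifs <;> omega⟩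
  · convert hs.1.reindex (X' := {x // enc (@decide (P x) (Classical.propDecidable _)) ≠ Val.nil})
      (fun z => z.1) (fun _ => rfl) (fun _ => rfl) using 2 with z
    obtain ⟨x, hx⟩ := z
    simp only
    rw [if_pos]
    by_contra h
    simp [h, enc, Val.ofBool] at hx
  · convert ht.1.reindex (X' := {x // enc (@decide (P x) (Classical.propDecidable _)) = Val.nil})
      (fun z => z.1) (fun _ => rfl) (fun _ => rfl) using 2 with z
    obtain ⟨x, hx⟩ := z
    simp only
    rw [if_neg]
    intro h
    simp [h, enc, Val.ofBool] at hx

/-- The body has to be computable only for pairs of an accumulator and an entry that really occur.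
The bound `hb` for all intermediate accumulators is indispensable, because growth within the bound
in each round could add up to exponential growth. -/
theorem foldl {l : ∀ x, List (β x)} {i : ∀ x, γ x} {f : ∀ x, γ x → β x → γ x} (hl : FP c l)
    (hi : FP c i)
    (hb : ∃ b : X → ℕ, Bdd b ∧ ∀ x pre post, l x = pre ++ post →
      (enc (pre.foldl (f x) (i x))).size ≤ b x)
    (hf : FP (ext c) (fun z : Σ x, {y : γ x × β x // ∃ pre post,
        l x = pre ++ y.2 :: post ∧ y.1 = pre.foldl (f x) (i x)} => z.2.1.1) →
      FP (ext c) (fun z : Σ x, {y : γ x × β x // ∃ pre post,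
        l x = pre ++ y.2 :: post ∧ y.1 = pre.foldl (f x) (i x)} => z.2.1.2) →
      FP (ext c) fun z : Σ x, {y : γ x × β x // ∃ pre post,
        l x = pre ++ y.2 :: post ∧ y.1 = pre.foldl (f x) (i x)} => f z.1 z.2.1.1 z.2.1.2) :
    FP c fun x => (l x).foldl (f x) (i x) := by
  obtain ⟨b, hb, hb'⟩ := hb
  have hl2 := hl.2
  have hf' := hf ⟨(Comp.self (ext c)).tl.hd, (hb.sigma _).mono fun ⟨x, ⟨_, y⟩, pre, post, h, e⟩ => by
      simp only at h e
      subst e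
      exact hb' x _ _ h⟩
    ⟨(Comp.self (ext c)).tl.tl, (hl2.sigma _).mono fun ⟨x, ⟨_, y⟩, pre, post, h, e⟩ =>
      size_enc_le_of_mem (by simp [h])⟩
  have he : ∀ x, Val.ofList id ((l x).map enc) = enc (l x) := fun x => by
    show _ = Val.ofList enc (l x)
    induction l x with
    | nil => rfl
    | cons a l ih => simp only [List.map_cons, Val.ofList, ih, id]
  refine ⟨?_, hb.mono fun x => hb' x (l x) [] (by simp)⟩
  have := Comp.fold (c := c) (l := fun x => (l x).map enc)
    (a := fun x n => enc (((l x).take n).foldl (f x) (i x))) (by simpa only [he] using hl.1)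
    (by simpa using hl.length_bdd) (by simpa using hi.1) ?_
  · simpa using this
  -- The prefix and the suffix around position `n` witness that this pair occurs.
  · convert hf'.1.reindex (X' := Σ x, Fin ((l x).map enc).length) (fun z => ⟨z.1,
      (((l z.1).take z.2).foldl (f z.1) (i z.1), (l z.1)[z.2.1]'(by simpa using z.2.2)),
      (l z.1).take z.2, (l z.1).drop (z.2 + 1), by
        rw [List.getElem_cons_drop, List.take_append_drop], rfl⟩) (fun _ => rfl) (fun _ => rfl)
      using 2 with z z
    · simp [ext, enc, Val.ofPair]
    · obtain ⟨x, n⟩ := z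
      have hn : n.1 < (l x).length := by simpa using n.2
      simp only
      rw [List.take_add_one, List.foldl_append]
      simp [hn]

end FP

end

/-! ### List operations as left folds, and sizes of their results. -/

theorem List.foldl_cons_eq_reverse_append {α : Type} (l b : List α) :
    l.foldl (fun acc a => a :: acc) b = l.reverse ++ b := by
  induction l generalizing b with
  | nil => rfl
  | cons a l ih => simp [ih]

theorem List.foldl_reverse_append {α β : Type} (f : α → List β) (l : List α) (b : List β) :
    l.foldl (fun acc a => (f a).reverse ++ acc) b = (l.flatMap f).reverse ++ b := by
  induction l generalizing b with
  | nil => rfl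
  | cons a l ih => simp [ih]

theorem List.foldl_tail {α β : Type} (l : List β) (b : List α) :
    l.foldl (fun acc _ => acc.tail) b = b.drop l.length := by
  induction l generalizing b with
  | nil => rfl
  | cons a l ih => simp [ih]

theorem List.foldl_zip {α β : Type} (l : List α) (r : List β) (b : List (α × β)) :
    l.foldl (fun acc a => acc.1.head?.elim acc fun y => (acc.1.tail, (a, y) :: acc.2)) (r, b) =
      (r.drop l.length, (l.zip r).reverse ++ b) := by
  induction l generalizing r b with
  | nil => rfl
  | cons a l ih =>
    cases r with
    | nil => simpa using ih [] b
    | cons y r => simpa using ih r ((a, y) :: b)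

theorem size_enc_append {α : Type} [Enc α] (l l' : List α) :
    (enc (l ++ l')).size + 1 = (enc l).size + (enc l').size := by
  simp only [size_enc_list, List.map_append, List.sum_append]
  omega

theorem size_enc_reverse {α : Type} [Enc α] (l : List α) :
    (enc l.reverse).size = (enc l).size := by
  simp only [size_enc_list, List.map_reverse, List.sum_reverse]

theorem size_enc_le_of_sublist {α : Type} [Enc α] {l l' : List α} (h : l.Sublist l') :
    (enc l).size ≤ (enc l').size := by
  simp only [size_enc_list]
  exact Nat.add_le_add_right (List.Sublist.sum_le_sum (h.map _) (by simp)) 1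

theorem size_enc_flatMap_le {α β : Type} [Enc β] {f : α → List β} {l : List α} {n b : ℕ}
    (hn : l.length ≤ n) (hb : ∀ a ∈ l, (enc (f a)).size ≤ b) :
    (enc (l.flatMap f)).size ≤ n * b + 1 := by
  have : (enc (l.flatMap f)).size ≤ l.length * b + 1 := by
    clear hn
    induction l with
    | nil => simp [enc, Val.ofList, Val.size]
    | cons a l ih =>
      have h1 := ih fun a ha => hb a (List.mem_cons_of_mem _ ha)
      have h2 := hb a List.mem_cons_self
      have h3 := size_enc_append (f a) (l.flatMap f)
      simp only [List.flatMap_cons, List.length_cons, add_mul, one_mul]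
      omega
  exact this.trans (Nat.add_le_add_right (Nat.mul_le_mul_right _ hn) 1)

theorem size_ofBool_le (b : Bool) : (Val.ofBool b).size ≤ 3 := by
  cases b <;> simp [Val.ofBool, Val.size]

/-! ### Decidable properties, list operations and unary arithmetic. -/

section

variable {X : Type} [Scale X] {β γ δ : X → Type} [∀ x, Enc (β x)] [∀ x, Enc (γ x)]
  [∀ x, Enc (δ x)] {c : X → Val}

theorem FPD.congr {P Q : X → Prop} (h : FPD c P) (e : ∀ x, Q x ↔ P x) : FPD c Q := by
  have : Q = P := funext fun x => propext (e x)
  rwa [this]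

theorem FPD.decide {P : X → Prop} (h : FPD c P) (inst : ∀ x, Decidable (P x)) :
    FP c fun x => decide (P x) :=
  FP.congr h fun x => by congr

theorem FPD.of_decide {P : X → Prop} (inst : ∀ x, Decidable (P x))
    (h : FP c fun x => Decidable.decide (P x)) : FPD c P :=
  FP.congr h fun x => by congr

theorem FPD.const (P : Prop) : FPD c fun _ => P := FP.const _

theorem FPD.wk {P : X → Prop} (h : FPD c P) : FPD (ext c) fun z : Σ x, β x => P z.1 := FP.wk h

theorem FPD.ite {P Q R : X → Prop} (hP : FPD c P) (hQ : FPD c Q) (hR : FPD c R) :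
    FPD c fun x => (P x ∧ Q x) ∨ (¬ P x ∧ R x) := by
  classical
  exact FP.congr (FP.ite (inst := fun _ => Classical.propDecidable _) hP hQ hR) fun x => by
    by_cases h : P x <;> simp [h]

theorem FPD.not {P : X → Prop} (h : FPD c P) : FPD c fun x => ¬ P x :=
  (h.ite (FPD.const False) (FPD.const True)).congr fun x => by tauto

theorem FPD.and {P Q : X → Prop} (h : FPD c P) (h' : FPD c Q) : FPD c fun x => P x ∧ Q x :=
  (h.ite h' (FPD.const False)).congr fun x => by tauto

theorem FPD.imp {P Q : X → Prop} (h : FPD c P) (h' : FPD c Q) : FPD c fun x => P x → Q x :=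
  (h.ite h' (FPD.const True)).congr fun x => by tauto

theorem FPD.ofEncEq {s : ∀ x, β x} {t : ∀ x, γ x} (hs : FP c s) (ht : FP c t) :
    FPD c fun x => enc (s x) = enc (t x) := by
  classical
  refine FPD.of_decide (fun _ => Classical.propDecidable _) ⟨hs.1.eq ht.1 hs.2,
    (Bdd.const 3).mono fun x => size_ofBool_le _⟩

theorem FPD.eq [∀ x, LawfulEnc (β x)] {s t : ∀ x, β x} (hs : FP c s) (ht : FP c t) :
    FPD c fun x => s x = t x :=
  (FPD.ofEncEq hs ht).congr fun _ => LawfulEnc.inj.eq_iff.symm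

theorem FPD.isNil {l : ∀ x, List (β x)} (hl : FP c l) : FPD c fun x => l x = [] :=
  (FPD.ofEncEq hl (FP.nil (β := β))).congr fun x => by
    rw [← enc_list_eq_nil]; rfl

theorem FPD.ofBool {b : X → Bool} (hb : FP c b) : FPD c fun x => b x = true :=
  FPD.eq hb (FP.const true)

namespace FP

/-- Substitution into a term over another index type. -/
theorem bind {Z : Type} [Scale Z] {c' : Z → Val} (π : Z → X)
    (hp : ∀ z, Scale.par (π z) = Scale.par z) (hs : ∀ z, Scale.size (π z) = Scale.size z)
    (hc : Comp c' fun z => c (π z)) {s : ∀ z, β (π z)} {t : ∀ z : (Σ x, β x), γ z.1}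
    (h : FP c' s) (ht : FP (ext c) t) : FP c' fun z => t ⟨π z, s z⟩ :=
  ⟨(hc.cons h.1).trans (ht.1.reindex (fun z => ⟨π z, s z⟩) hp hs),
    ht.2.reindex (fun z => ⟨π z, s z⟩) hp hs⟩

theorem memVar {l : ∀ x, List (β x)} (hl : FP c l) :
    FP (ext c) fun z : Σ x, {y // y ∈ l x} => z.2.1 :=
  ⟨(Comp.self (ext c)).tl, (hl.2.sigma _).mono fun z => size_enc_le_of_mem z.2.2⟩

/-- Pushing entries onto the front is the elementary loop; reversal and concatenation both come from
it. -/
theorem reverseAppend {l l' : ∀ x, List (β x)} (hl : FP c l) (hl' : FP c l') :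
    FP c fun x => (l x).reverse ++ l' x := by
  refine (hl.foldl (γ := fun x => List (β x)) (f := fun x acc a => a :: acc) hl' ⟨_, hl.2.add hl'.2,
    fun x pre post h => ?_⟩ fun ha hy => hy.cons ha).congr fun x =>
      (List.foldl_cons_eq_reverse_append _ _).symm
  rw [List.foldl_cons_eq_reverse_append]
  have h1 := size_enc_append pre.reverse (l' x)
  have h2 := size_enc_reverse pre
  have h3 := size_enc_append pre post
  have h4 := Val.size_pos (enc post)
  rw [h]
  omega

theorem reverse {l : ∀ x, List (β x)} (hl : FP c l) : FP c fun x => (l x).reverse :=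
  (hl.reverseAppend nil).congr fun x => by simp

theorem append {l l' : ∀ x, List (β x)} (hl : FP c l) (hl' : FP c l') :
    FP c fun x => l x ++ l' x :=
  (hl.reverse.reverseAppend hl').congr fun x => by simp

/-- The fold collects the reversed pieces, and one reversal at the end restores the order. The bound
`B` is the same for all pieces, so every accumulator is bounded by the length of the list times `B`.
-/
theorem flatMap {l : ∀ x, List (β x)} {f : ∀ x, β x → List (γ x)} (hl : FP c l)
    (hf : FP (ext c) (fun z : Σ x, {y // y ∈ l x} => z.2.1) →
      FP (ext c) fun z : Σ x, {y // y ∈ l x} => f z.1 z.2.1) :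
    FP c fun x => (l x).flatMap (f x) := by
  have hf' := hf hl.memVar
  obtain ⟨B, hB, hB'⟩ := hf'.2.descend
  refine (reverse (hl.foldl (γ := fun x => List (γ x))
    (f := fun x acc a => (f x a).reverse ++ acc) nil
    ⟨fun x => (l x).length * B x + 1, (hl.length_bdd.mul hB).add (Bdd.const 1),
      fun x pre post h => ?_⟩ fun ha hy => ?_)).congr fun x => ?_
  · rw [List.foldl_reverse_append, List.append_nil, size_enc_reverse]
    exact size_enc_flatMap_le (by simp [h]) fun a ha => hB' x ⟨a, by simp [h, ha]⟩
  · refine reverseAppend ?_ ha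
    exact FP.bind (β := fun x => {y // y ∈ l x}) (γ := fun x => List (γ x))
      (t := fun z => f z.1 z.2.1) (s := fun z : Σ x, {y : List (γ x) × β x //
        ∃ pre post, l x = pre ++ y.2 :: post ∧
          y.1 = pre.foldl (fun acc a => (f x a).reverse ++ acc) []} => ⟨z.2.1.2, by
      obtain ⟨pre, post, h, -⟩ := z.2.2
      simp [h]⟩) (fun z => z.1) (fun _ => rfl) (fun _ => rfl) (Comp.self (ext c)).hd hy hf'
  · rw [List.foldl_reverse_append]
    simp

theorem map {l : ∀ x, List (β x)} {f : ∀ x, β x → γ x} (hl : FP c l)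
    (hf : FP (ext c) (fun z : Σ x, {y // y ∈ l x} => z.2.1) →
      FP (ext c) fun z : Σ x, {y // y ∈ l x} => f z.1 z.2.1) :
    FP c fun x => (l x).map (f x) :=
  (hl.flatMap (f := fun x y => [f x y]) fun hy => (hf hy).cons nil).congr fun x => by
    rw [List.map_eq_flatMap]

theorem filter {l : ∀ x, List (β x)} {P : ∀ x, β x → Prop}
    {inst : ∀ x, DecidablePred (P x)} (hl : FP c l)
    (hP : FP (ext c) (fun z : Σ x, {y // y ∈ l x} => z.2.1) →
      FPD (ext c) fun z : Σ x, {y // y ∈ l x} => P z.1 z.2.1) :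
    FP c fun x => (l x).filter fun y => decide (P x y) :=
  (hl.flatMap (f := fun x y => if P x y then [y] else []) fun hy =>
    (FP.ite (hP hy) (hy.cons nil) nil)).congr fun x => by
      induction l x with
      | nil => rfl
      | cons a l ih => by_cases h : P x a <;> simp [h, ih]

theorem head? {l : ∀ x, List (β x)} (hl : FP c l) : FP c fun x => (l x).head? := by
  refine ⟨hl.1.ite ?_ ?_, (hl.2.add (Bdd.const 2)).mono fun x => ?_⟩
  · convert (((Comp.nil (c := c)).cons hl.1.hd).reindex (X' := {x // enc (l x) ≠ Val.nil})
      (fun z => z.1) (fun _ => rfl) (fun _ => rfl)) using 2 with z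
    obtain ⟨x, hx⟩ := z
    cases h : l x with
    | nil => simp [h, enc, Val.ofList] at hx
    | cons a l => simp [h, enc, Val.ofList, Val.hd]
  · convert ((Comp.nil (c := c)).reindex (X' := {x // enc (l x) = Val.nil})
      (fun z => z.1) (fun _ => rfl) (fun _ => rfl)) using 2 with z
    obtain ⟨x, hx⟩ := z
    rw [enc_list_eq_nil] at hx
    simp [hx, enc]
  · cases h : l x with
    | nil => simp [h, enc, Val.size]
    | cons a l' =>
      have := size_enc_le_of_mem (l := a :: l') (a := a) (by simp)
      simp only [h, List.head?_cons]
      show (Val.cons Val.nil (enc a)).size ≤ _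
      simp only [Val.size]
      omega

theorem getD {o : ∀ x, Option (β x)} {b : ∀ x, β x} (ho : FP c o) (hb : FP c b) :
    FP c fun x => (o x).getD (b x) :=
  (ho.elim (f := fun _ y => y) hb fun hy => hy).congr fun x => by cases o x <;> rfl

/-! Natural numbers -/

theorem ofReplicate {n : X → ℕ} (h : FP c fun x => List.replicate (n x) ()) : FP c n :=
  h.ofEnc fun _ => rfl

theorem toReplicate {n : X → ℕ} (h : FP c n) : FP c fun x => List.replicate (n x) () :=
  h.ofEnc fun _ => rfl

theorem nat_bdd {n : X → ℕ} (h : FP c n) : Bdd n :=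
  h.2.mono fun x => by rw [size_enc_nat]; omega

theorem length {l : ∀ x, List (β x)} (hl : FP c l) : FP c fun x => (l x).length :=
  ofReplicate ((hl.map (f := fun _ _ => ()) fun _ => const ()).congr fun x => by simp)

theorem add {a b : X → ℕ} (ha : FP c a) (hb : FP c b) : FP c fun x => a x + b x :=
  ofReplicate ((ha.toReplicate.append hb.toReplicate).congr fun x => by
    rw [List.replicate_add])

theorem drop {n : X → ℕ} {l : ∀ x, List (β x)} (hn : FP c n) (hl : FP c l) :
    FP c fun x => (l x).drop (n x) := by
  refine (hn.toReplicate.foldl (γ := fun x => List (β x)) (f := fun _ acc _ => acc.tail) hl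
    ⟨_, hl.2, fun x pre post h => ?_⟩ fun ha _ => ha.tail).congr fun x => ?_
  · rw [List.foldl_tail]
    exact size_enc_le_of_sublist (List.drop_sublist _ _)
  · rw [List.foldl_tail, List.length_replicate]

theorem sub {a b : X → ℕ} (ha : FP c a) (hb : FP c b) : FP c fun x => a x - b x :=
  ofReplicate ((hb.drop ha.toReplicate).congr fun x => by simp)

theorem sum {l : X → List ℕ} (hl : FP c l) : FP c fun x => (l x).sum :=
  ofReplicate ((hl.flatMap (f := fun _ n => List.replicate n ()) fun hy =>
    hy.toReplicate).congr fun x => by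
      induction l x with
      | nil => rfl
      | cons a l ih => simp [List.replicate_add, ih])

theorem zip {l : ∀ x, List (β x)} {r : ∀ x, List (γ x)} (hl : FP c l) (hr : FP c r) :
    FP c fun x => (l x).zip (r x) := by
  refine (reverse (snd (hl.foldl (γ := fun x => List (γ x) × List (β x × γ x))
    (f := fun x acc a => acc.1.head?.elim acc fun y => (acc.1.tail, (a, y) :: acc.2))
    (hr.pair nil) ⟨fun x => (enc (r x)).size + ((l x).length *
      ((enc (l x)).size + (enc (r x)).size + 1 + 1) + 1) + 1,
      (hr.2.add ((hl.length_bdd.mul (((hl.2.add hr.2).add (Bdd.const 1)).add (Bdd.const 1))).add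
      (Bdd.const 1))).add (Bdd.const 1), fun x pre post h => ?_⟩ fun ha hy => ?_))).congr
      fun x => ?_
  · rw [List.foldl_zip, size_enc_pair, List.append_nil, size_enc_reverse]
    refine Nat.add_le_add_right (Nat.add_le_add
      (size_enc_le_of_sublist (List.drop_sublist _ _)) ?_) 1
    refine size_enc_list_le (by simp [h]) fun p hp => ?_
    obtain ⟨a, b⟩ := p
    have h1 := size_enc_le_of_mem (List.of_mem_zip hp).1
    have h2 := size_enc_le_of_mem (List.of_mem_zip hp).2
    have h3 := size_enc_append pre post
    have h4 := Val.size_pos (enc post)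
    rw [size_enc_pair, h]
    simp only
    omega
  · exact ha.fst.head?.elim ha fun hb => ha.wk.fst.tail.pair ((hy.wk.pair hb).cons ha.wk.snd)
  · rw [List.foldl_zip]
    simp

end FP

namespace FPD

theorem le {a b : X → ℕ} (ha : FP c a) (hb : FP c b) : FPD c fun x => a x ≤ b x :=
  (FPD.isNil (ha.sub hb).toReplicate).congr fun x => by simp; omega

theorem ball {l : ∀ x, List (β x)} {P : ∀ x, β x → Prop} (hl : FP c l)
    (hP : FP (ext c) (fun z : Σ x, {y // y ∈ l x} => z.2.1) →
      FPD (ext c) fun z : Σ x, {y // y ∈ l x} => P z.1 z.2.1) :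
    FPD c fun x => ∀ y ∈ l x, P x y := by
  classical
  exact (FPD.isNil (hl.filter (P := fun x y => ¬ P x y)
    (inst := fun _ _ => Classical.propDecidable _) fun hy => (hP hy).not)).congr fun x => by
    simp

theorem bex {l : ∀ x, List (β x)} {P : ∀ x, β x → Prop} (hl : FP c l)
    (hP : FP (ext c) (fun z : Σ x, {y // y ∈ l x} => z.2.1) →
      FPD (ext c) fun z : Σ x, {y // y ∈ l x} => P z.1 z.2.1) :
    FPD c fun x => ∃ y ∈ l x, P x y :=
  (FPD.not (FPD.ball hl (P := fun x y => ¬ P x y) fun hy => (hP hy).not)).congr fun x => by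
    simp

theorem mem [∀ x, LawfulEnc (β x)] {l : ∀ x, List (β x)} {a : ∀ x, β x} (ha : FP c a)
    (hl : FP c l) : FPD c fun x => a x ∈ l x :=
  (FPD.bex hl (P := fun x y => y = a x) fun hy => FPD.eq hy ha.wk).congr fun x => by simp

end FPD

end

/-! ### Enumerations -/

/-- All lists of length `n` with entries in `A`. -/
def words {α : Type} (A : List α) : ℕ → List (List α)
  | 0 => [[]]
  | n + 1 => (words A n).flatMap fun w => A.map fun a => a :: w

theorem mem_words {α : Type} {A : List α} {n : ℕ} {w : List α} :
    w ∈ words A n ↔ w.length = n ∧ ∀ a ∈ w, a ∈ A := by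
  induction n generalizing w with
  | zero => simp +contextual [words]
  | succ n ih =>
    simp only [words, List.mem_flatMap, List.mem_map, ih]
    constructor
    · rintro ⟨v, ⟨hv, hA⟩, a, ha, rfl⟩
      simpa [hv, ha] using hA
    · rcases w with _ | ⟨a, v⟩
      · simp
      · intro h
        simp only [List.length_cons, Nat.add_right_cancel_iff, List.mem_cons, forall_eq_or_imp] at h
        exact ⟨v, ⟨h.1, h.2.2⟩, a, h.2.1, rfl⟩

theorem length_words {α : Type} (A : List α) (n : ℕ) : (words A n).length = A.length ^ n := by
  induction n with
  | zero => rfl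
  | succ n ih => simp [words, ih, pow_succ]

theorem foldl_words {α β : Type} (A : List α) (l : List β) :
    l.foldl (fun acc _ => acc.flatMap fun w => A.map fun a => a :: w) [[]] =
      words A l.length := by
  induction l using List.reverseRecOn with
  | nil => rfl
  | append_singleton l a ih => simp [ih, words]

theorem foldl_range {β : Type} (l : List β) :
    l.foldl (fun acc _ => acc.length :: acc) [] = (List.range l.length).reverse := by
  induction l using List.reverseRecOn with
  | nil => rfl
  | append_singleton l a ih => simp [ih, List.range_succ]

theorem foldr_sublists {α : Type} (l : List α) :
    l.foldr (fun a acc => acc ++ acc.map fun w => a :: w) [[]] = l.sublists' := by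
  induction l with
  | nil => rfl
  | cons a l ih => simp [ih]

/-- Horner's scheme from the most significant bit, cut off at `n`. Cutting off early is harmless,
since doubling and adding a bit are monotone and never decrease a number: once the cap is reached,
it stays reached. -/
theorem foldr_bits (n d : ℕ) : d.bits.foldr (fun b a => min (a + a + if b = true then 1 else 0) n) 0
    = min d n := by
  induction d using Nat.binaryRec' with
  | zero => simp
  | bit b d hb ih =>
    rw [Nat.bits_append_bit _ _ hb, List.foldr_cons, ih, Nat.bit_val]
    cases b <;> simp <;> omega

/-- One element of `l` for each value of `key`. -/
noncomputable def dedupBy {α κ : Type} (key : α → κ) (l : List α) : List α :=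
  open Classical in
  l.foldl (fun acc a => if ∃ b ∈ acc, key b = key a then acc else a :: acc) []

section dedupBy

variable {α κ : Type} {key : α → κ} {l : List α} {a : α}

theorem dedupBy_append_singleton (key : α → κ) (l : List α) (a : α) :
    (∃ b ∈ dedupBy key l, key b = key a) ∧ dedupBy key (l ++ [a]) = dedupBy key l ∨
      (¬ ∃ b ∈ dedupBy key l, key b = key a) ∧
        dedupBy key (l ++ [a]) = a :: dedupBy key l := by
  by_cases h : ∃ b ∈ dedupBy key l, key b = key a
  · refine Or.inl ⟨h, ?_⟩
    rw [dedupBy, List.foldl_append]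
    exact if_pos h
  · refine Or.inr ⟨h, ?_⟩
    rw [dedupBy, List.foldl_append]
    exact if_neg h

theorem dedupBy_sublist (key : α → κ) (l : List α) : (dedupBy key l).Sublist l.reverse := by
  induction l using List.reverseRecOn with
  | nil => exact List.Sublist.refl _
  | append_singleton l a ih =>
    rw [List.reverse_append]
    rcases dedupBy_append_singleton key l a with ⟨-, h⟩ | ⟨-, h⟩ <;> rw [h]
    · exact ih.cons a
    · exact ih.cons_cons a

theorem mem_of_mem_dedupBy (h : a ∈ dedupBy key l) : a ∈ l :=
  List.mem_reverse.1 ((dedupBy_sublist key l).subset h)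

theorem exists_mem_dedupBy (key : α → κ) (h : a ∈ l) : ∃ b ∈ dedupBy key l, key b = key a := by
  induction l using List.reverseRecOn with
  | nil => simp at h
  | append_singleton l c ih =>
    rcases List.mem_append.1 h with h | h
    · obtain ⟨b, hb, e⟩ := ih h
      refine ⟨b, ?_, e⟩
      rcases dedupBy_append_singleton key l c with ⟨-, h⟩ | ⟨-, h⟩ <;> rw [h]
      · exact hb
      · exact List.mem_cons_of_mem _ hb
    · rw [List.mem_singleton] at h
      subst h
      rcases dedupBy_append_singleton key l a with ⟨hb, h⟩ | ⟨-, h⟩ <;> rw [h]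
      · exact hb
      · exact ⟨a, List.mem_cons_self, rfl⟩

theorem nodup_map_dedupBy (key : α → κ) (l : List α) : ((dedupBy key l).map key).Nodup := by
  induction l using List.reverseRecOn with
  | nil => exact List.nodup_nil
  | append_singleton l a ih =>
    rcases dedupBy_append_singleton key l a with ⟨-, h⟩ | ⟨h', h⟩ <;> rw [h]
    · exact ih
    · refine List.nodup_cons.2 ⟨?_, ih⟩
      rintro h
      obtain ⟨b, hb, e⟩ := List.mem_map.1 h
      exact h' ⟨b, hb, e⟩

/-- Few possible keys leave few entries, which is what keeps the search below bounded. -/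
theorem length_dedupBy_le (key : α → κ) (l : List α) (K : List κ) (h : ∀ a ∈ l, key a ∈ K) :
    (dedupBy key l).length ≤ K.length := by
  rw [← List.length_map (f := key)]
  refine ((nodup_map_dedupBy key l).subperm fun x hx => ?_).length_le
  obtain ⟨b, hb, rfl⟩ := List.mem_map.1 hx
  exact h b (mem_of_mem_dedupBy hb)

end dedupBy

/-! ### Computing the enumerations, and comparison with binary bounds. -/

section

variable {X : Type} [Scale X] {β γ δ : X → Type} [∀ x, Enc (β x)] [∀ x, Enc (γ x)]
  [∀ x, Enc (δ x)] {c : X → Val}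

namespace FP

theorem range {n : X → ℕ} (hn : FP c n) : FP c fun x => List.range (n x) := by
  refine (reverse (hn.toReplicate.foldl (γ := fun _ => List ℕ)
    (f := fun _ acc _ => acc.length :: acc) nil ⟨fun x => n x * ((2 * n x + 1) + 1) + 1,
    (hn.nat_bdd.mul ((((Bdd.const 2).mul hn.nat_bdd).add (Bdd.const 1)).add (Bdd.const 1))).add
      (Bdd.const 1), fun x pre post h => ?_⟩ fun ha _ => ha.length.cons ha)).congr fun x => ?_
  · have hl : pre.length ≤ n x := by simpa using (congrArg List.length h).symm.le.trans' (by simp)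
    rw [foldl_range, size_enc_reverse]
    refine size_enc_list_le (by simpa using hl) fun a ha => ?_
    rw [List.mem_range] at ha
    rw [size_enc_nat]
    omega
  · rw [foldl_range]
    simp

theorem words {A : ∀ x, List (β x)} {n : X → ℕ} (hA : FP c A) (hn : FP c n)
    (hb : Bdd fun x => ((A x).length + 1) ^ n x) : FP c fun x => words (A x) (n x) := by
  refine (hn.toReplicate.foldl (γ := fun x => List (List (β x)))
    (f := fun x acc _ => acc.flatMap fun w => (A x).map fun a => a :: w) (nil.cons nil)
    ⟨fun x => ((A x).length + 1) ^ n x * (n x * ((enc (A x)).size + 1) + 1 + 1) + 1,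
    (hb.mul (((hn.nat_bdd.mul (hA.2.add (Bdd.const 1))).add (Bdd.const 1)).add
      (Bdd.const 1))).add (Bdd.const 1), fun x pre post h => ?_⟩ fun ha _ =>
      ha.flatMap fun hw => hA.wk.wk.map fun hy => hy.cons hw.wk).congr fun x => ?_
  · have hl : pre.length ≤ n x := by simpa using (congrArg List.length h).symm.le.trans' (by simp)
    rw [foldl_words]
    refine size_enc_list_le ?_ fun w hw => ?_
    · rw [length_words]
      -- The summand `1` in the base makes the power increase with the exponent even if the alphabet
      -- is empty.
      exact (Nat.pow_le_pow_left (Nat.le_succ _) _).trans (Nat.pow_le_pow_right (Nat.succ_pos _) hl)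
    · rw [mem_words] at hw
      exact size_enc_list_le (by omega) fun a ha => size_enc_le_of_mem (hw.2 a ha)
  · rw [foldl_words, List.length_replicate]

theorem sublists {l : ∀ x, List (β x)} (hl : FP c l) (hb : Bdd fun x => 2 ^ (l x).length) :
    FP c fun x => (l x).sublists' := by
  refine (hl.reverse.foldl (γ := fun x => List (List (β x)))
    (f := fun x acc a => acc ++ acc.map fun w => a :: w) (nil.cons nil)
    ⟨fun x => 2 ^ (l x).length * ((enc (l x)).size + 1) + 1,
      (hb.mul (hl.2.add (Bdd.const 1))).add (Bdd.const 1), fun x pre post h => ?_⟩ fun ha hy =>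
      ha.append (ha.map fun hw => hy.wk.cons hw)).congr fun x => ?_
  · have hp : l x = post.reverse ++ pre.reverse := by
      rw [← List.reverse_append, ← h, List.reverse_reverse]
    rw [← List.foldr_reverse, foldr_sublists]
    refine size_enc_list_le ?_ fun w hw => ?_
    · rw [List.length_sublists', List.length_reverse]
      exact Nat.pow_le_pow_right (by norm_num) (by rw [hp]; simp)
    · rw [List.mem_sublists'] at hw
      refine size_enc_le_of_sublist (hw.trans ?_)
      rw [hp]
      exact List.sublist_append_right _ _
  · rw [List.foldl_reverse, foldr_sublists]

theorem min {a b : X → ℕ} (ha : FP c a) (hb : FP c b) : FP c fun x => min (a x) (b x) :=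
  (ha.sub (ha.sub hb)).congr fun x => by omega

/-- Substitution into a term whose computability is known only for arguments with the property `P`,
such as the members of a given list. -/
theorem bindSub {P : ∀ x, β x → Prop} {t : ∀ x, β x → γ x}
    (ht : FP (ext c) fun z : Σ x, {y // P x y} => t z.1 z.2.1) {Z : Type} [Scale Z]
    {c' : Z → Val} {π : Z → X} {s : ∀ z, β (π z)} (h : FP c' s)
    (hp : ∀ z, Scale.par (π z) = Scale.par z) (hs : ∀ z, Scale.size (π z) = Scale.size z)
    (hc : Comp c' fun z => c (π z)) (hm : ∀ z, P (π z) (s z)) :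
    FP c' fun z => t (π z) (s z) :=
  FP.bind (β := fun x => {y // P x y}) (γ := γ) (t := fun z => t z.1 z.2.1)
    (s := fun z => ⟨s z, hm z⟩) π hp hs hc h ht

theorem dedupBy [∀ x, LawfulEnc (γ x)] {l : ∀ x, List (β x)} {key : ∀ x, β x → γ x} (hl : FP c l)
    (hk : FP (ext c) (fun z : Σ x, {y // y ∈ l x} => z.2.1) →
      FP (ext c) fun z : Σ x, {y // y ∈ l x} => key z.1 z.2.1) :
    FP c fun x => dedupBy (key x) (l x) := by
  classical
  have hk' := hk hl.memVar
  refine (hl.foldl (γ := fun x => List (β x)) (f := fun x acc a =>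
    if ∃ b ∈ acc, key x b = key x a then acc else a :: acc) nil ⟨fun x => (enc (l x)).size, hl.2,
      fun x pre post h => ?_⟩ fun ha hy => FP.ite (FPD.bex ha fun hz => FPD.eq ?_ ?_) ha
        (hy.cons ha)).congr fun x => ?_
  · have := size_enc_le_of_sublist (dedupBy_sublist (key x) pre)
    rw [size_enc_reverse] at this
    refine le_trans (le_of_eq_of_le ?_ this) (size_enc_le_of_sublist ?_)
    · rw [_root_.dedupBy]
    · rw [h]
      exact List.sublist_append_left _ _
  -- The key is computable for members of `l x`; entries of the accumulator are such members because
  -- deduplication only selects.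
  · exact hk'.bindSub hz (fun _ => rfl) (fun _ => rfl)
      (Comp.self (ext (ext c))).hd.hd <| by
        rintro ⟨⟨x, ⟨acc, y⟩, pre, post, h, e⟩, b, hb⟩
        simp only at h e hb ⊢
        have hb' : b ∈ pre := mem_of_mem_dedupBy (key := key x) (by
          have := (congrArg (b ∈ ·) e).mp hb
          rw [_root_.dedupBy]
          convert this)
        exact (congrArg (b ∈ ·) h).mpr (List.mem_append_left _ hb')
  · exact hk'.bindSub hy.wk (fun _ => rfl) (fun _ => rfl)
      (Comp.self (ext (ext c))).hd.hd <| by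
        rintro ⟨⟨x, ⟨acc, y⟩, pre, post, h, e⟩, b, hb⟩
        simp only at h ⊢
        simp [h]
  · rw [_root_.dedupBy]

end FP

/-- The value of `d` may be exponential in the length of its code, so it is never written in unary.
It suffices to compute its minimum with `n`, which stays as small as `n`. -/
theorem FPD.leBin {n : X → ℕ} {d : X → Bin} (hn : FP c n) (hd : FP c d) :
    FPD c fun x => n x ≤ (d x).val := by
  have hbits : FP c fun x => (d x).val.bits := hd.ofEnc fun _ => rfl
  have : FP c fun x => (d x).val.bits.reverse.foldl
      (fun a b => Min.min (a + a + if b = true then 1 else 0) (n x)) 0 := by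
    refine hbits.reverse.foldl (γ := fun _ => ℕ) (f := fun x a b =>
      Min.min (a + a + if b = true then 1 else 0) (n x)) (FP.const 0)
      ⟨_, hn.2, fun x pre post h => ?_⟩ fun ha hy => ((ha.add ha).add
        (FP.ite (FPD.ofBool hy) (FP.const 1) (FP.const 0))).min hn.wk
    rw [size_enc_nat, size_enc_nat]
    induction pre using List.reverseRecOn with
    | nil => simp
    | append_singleton pre a _ =>
      simp only [List.foldl_append, List.foldl_cons, List.foldl_nil]
      omega
  refine (FPD.le hn this).congr fun x => ?_
  rw [List.foldl_reverse, foldr_bits]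
  omega

/-- Comparison with a bound that may be absent. -/
def LeOpt (n : ℕ) (d : Option Bin) : Prop := ∀ b ∈ d, n ≤ b.val

theorem FPD.leOpt {n : X → ℕ} {d : X → Option Bin} (hn : FP c n) (hd : FP c d) :
    FPD c fun x => LeOpt (n x) (d x) := by
  refine FPD.congr (FPD.ofBool (hd.elim (γ := fun _ => Bool)
    (f := fun x b => Decidable.decide (n x ≤ b.val))
    (FP.const true) fun hb => (FPD.leBin hn.wk hb).decide _)) fun x => ?_
  cases d x <;> simp [LeOpt]

end

/-! ### Situations, literals and blocks -/

/-- All situations. -/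
def allSits : ∀ m, List (Situation m)
  | 0 => [Fin.elim0]
  | m + 1 => (allSits m).flatMap fun s => [false, true].map fun b => Fin.cons b s

/-- Programs see situations as bit lists, so their enumeration is computed as an enumeration of
words. -/
theorem map_allSits (m : ℕ) : (allSits m).map List.ofFn = words [false, true] m := by
  induction m with
  | zero => rfl
  | succ m ih =>
    rw [words, ← ih, allSits, List.map_flatMap, List.flatMap_map]
    congr 1
    funext s
    simp [List.ofFn_succ]

theorem mem_allSits {m : ℕ} (s : Situation m) : s ∈ allSits m := by
  have : List.ofFn s ∈ (allSits m).map List.ofFn := by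
    rw [map_allSits, mem_words]
    exact ⟨List.length_ofFn, fun b _ => by cases b <;> simp⟩
  obtain ⟨t, ht, e⟩ := List.mem_map.1 this
  exact List.ofFn_injective e ▸ ht

theorem length_allSits (m : ℕ) : (allSits m).length = 2 ^ m := by
  rw [← List.length_map (f := List.ofFn), map_allSits, length_words]
  rfl

/-- All literals. -/
def allLits (m : ℕ) : List (Literal m) :=
  (List.finRange m).flatMap fun v => [⟨v, false⟩, ⟨v, true⟩]

theorem mem_allLits {m : ℕ} (l : Literal m) : l ∈ allLits m := by
  obtain ⟨v, b⟩ := l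
  cases b <;> simp [allLits]

theorem length_allLits (m : ℕ) : (allLits m).length = 2 * m := by
  simp [allLits, mul_comm]

theorem enc_map {α β : Type} [Enc α] [Enc β] (f : α → β) (h : ∀ a, enc (f a) = enc a)
    (l : List α) : enc (l.map f) = enc l := by
  show Val.ofList enc _ = Val.ofList enc _
  induction l with
  | nil => rfl
  | cons a l ih => simp only [List.map_cons, Val.ofList, h, ih]

/-! ### Computing with situations, literals and blocks. -/

section

variable {X : Type} [Scale X] {β γ : X → Type} [∀ x, Enc (β x)] [∀ x, Enc (γ x)] {c : X → Val}
  {m k : X → ℕ}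

namespace FP

theorem finRange {n : X → ℕ} (hn : FP c n) : FP c fun x => List.finRange (n x) :=
  hn.range.ofEnc fun x => by
    rw [← List.map_coe_finRange_eq_range]
    exact (enc_map Fin.val (fun _ => rfl) _).symm

theorem allSits (hm : FP c m) (hp : ∀ x, m x = Scale.par x) : FP c fun x => allSits (m x) := by
  refine (FP.words (FP.const [false, true]) hm ?_).ofEnc fun x => ?_
  · simp only [hp]
    exact Bdd.par fun n => 3 ^ n
  · rw [← map_allSits]
    exact (enc_map List.ofFn (fun _ => rfl) _).symm

theorem literal {v : ∀ x, Fin (m x)} {b : X → Bool} (hv : FP c v) (hb : FP c b) :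
    FP c fun x => (⟨v x, b x⟩ : Literal (m x)) :=
  (hv.pair hb).ofEnc fun _ => rfl

theorem allLits (hm : FP c m) : FP c fun x => allLits (m x) :=
  hm.finRange.flatMap fun hv =>
    (hv.literal (const false)).cons ((hv.literal (const true)).cons nil)

theorem block {bs : ∀ x, List (Literal (m x) × β x)} {o : ∀ x, β x} (hb : FP c bs)
    (ho : FP c o) : FP c fun x => (⟨bs x, o x⟩ : Block (m x) (β x)) :=
  (hb.pair ho).ofEnc fun _ => rfl

theorem branches {b : ∀ x, Block (m x) (β x)} (h : FP c b) : FP c fun x => (b x).branches :=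
  (h.ofEnc (t := fun x => ((b x).branches, (b x).otherwise)) fun _ => rfl).fst

theorem otherwise {b : ∀ x, Block (m x) (β x)} (h : FP c b) : FP c fun x => (b x).otherwise :=
  (h.ofEnc (t := fun x => ((b x).branches, (b x).otherwise)) fun _ => rfl).snd

theorem conds {b : ∀ x, Block (m x) (β x)} (h : FP c b) : FP c fun x => (b x).conds :=
  h.branches.map fun hy => hy.fst

theorem bodies {b : ∀ x, Block (m x) (β x)} (h : FP c b) : FP c fun x => (b x).bodies :=
  (h.branches.map fun hy => hy.snd).append (h.otherwise.cons nil)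

theorem librariesSel {L : ∀ x, Libraries (m x) (k x)} (h : FP c L) : FP c fun x => (L x).sel :=
  (h.ofEnc (t := fun x => ((L x).sel, (L x).prc)) fun _ => rfl).fst

theorem librariesPrc {L : ∀ x, Libraries (m x) (k x)} (h : FP c L) : FP c fun x => (L x).prc :=
  (h.ofEnc (t := fun x => ((L x).sel, (L x).prc)) fun _ => rfl).snd

end FP

/-- The truth value of the variable is found by dropping as many entries as its index says, and the
literal holds iff this value differs from its sign. -/
theorem FPD.holds {l : ∀ x, Literal (m x)} {s : ∀ x, Situation (m x)} (hl : FP c l)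
    (hs : FP c s) : FPD c fun x => (l x).holds (s x) = true := by
  have hl' : FP c (fun x => (((l x).var : ℕ), (l x).negated)) := hl.ofEnc fun _ => rfl
  have hs' : FP c (fun x => List.ofFn (s x)) := hs.ofEnc fun _ => rfl
  have h := ((hl'.fst.drop hs').head?.getD (FP.const false))
  refine (FPD.not (FPD.eq hl'.snd h)).congr fun x => ?_
  simp [Literal.holds, List.head?_drop]

/-- The branch that is executed is the head of the list of branches whose conditions hold. -/
theorem FP.run {b : ∀ x, Block (m x) (β x)} {s : ∀ x, Situation (m x)} (hb : FP c b)
    (hs : FP c s) : FP c fun x => (b x).run (s x) := by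
  refine (((hb.branches.filter (P := fun x e => e.1.holds (s x) = true)
    (inst := fun _ _ => inferInstance) fun hy => FPD.holds hy.fst hs.wk).map
      (f := fun _ e => e.2) fun hy => hy.snd).head?.getD hb.otherwise).congr fun x => ?_
  obtain ⟨bs, o⟩ := b x
  simp only [Block.run]
  induction bs with
  | nil => rfl
  | cons e bs ih => by_cases h : e.1.holds (s x) <;> simp [Block.runAux, h, ih]

end

/-! ### Forward search with one partial solution for each state -/

/-- The entries reached from `F` along `items`, with one trace for each key. -/
noncomputable def search {ι K T : Type} (step : ι → K × T → List (K × T)) (items : List ι)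
    (F : List (K × T)) : List (K × T) :=
  items.foldl (fun F i => dedupBy Prod.fst (F.flatMap (step i))) F

def SearchPath {ι E : Type} (step : ι → E → List E) : List ι → E → E → Prop
  | [], e, e' => e' = e
  | i :: is, e, e' => ∃ e₁ ∈ step i e, SearchPath step is e₁ e'

section search

variable {ι K T : Type} {step : ι → K × T → List (K × T)} {items : List ι}

theorem search_append_singleton (step : ι → K × T → List (K × T)) (items : List ι) (i : ι)
    (F : List (K × T)) :
    search step (items ++ [i]) F = dedupBy Prod.fst ((search step items F).flatMap (step i)) := by
  simp [search]

theorem exists_path_of_mem_search {F : List (K × T)} {e' : K × T} (h : e' ∈ search step items F) :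
    ∃ e ∈ F, SearchPath step items e e' := by
  induction items generalizing F with
  | nil => exact ⟨e', h, rfl⟩
  | cons i is ih =>
    obtain ⟨e₁, h₁, hp⟩ := ih h
    obtain ⟨e, he, h'⟩ := List.mem_flatMap.1 (mem_of_mem_dedupBy h₁)
    exact ⟨e, he, e₁, h', hp⟩

theorem SearchPath.of_key_eq (hs : ∀ i e₁ e₂, e₁.1 = e₂.1 → ∀ e' ∈ step i e₁, ∃ e'' ∈ step i e₂,
    e''.1 = e'.1) {e e₂ e' : K × T} (h : SearchPath step items e e') (he : e.1 = e₂.1) :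
    ∃ e'', SearchPath step items e₂ e'' ∧ e''.1 = e'.1 := by
  induction items generalizing e e₂ with
  | nil => exact ⟨e₂, rfl, by rw [h, he]⟩
  | cons i is ih =>
    obtain ⟨e₁, h₁, hp⟩ := h
    obtain ⟨e₃, h₃, h'⟩ := hs i e e₂ he e₁ h₁
    obtain ⟨e'', hp', e⟩ := ih hp h'.symm
    exact ⟨e'', ⟨e₃, h₃, hp'⟩, e⟩

/-- Keeping one trace for each key loses no key: by `hs` the keys of the successors depend on the
key alone, so any path can be continued from the entry that was kept. The trace found may differ
from that of the given path. -/
theorem exists_mem_search_of_path (hs : ∀ i e₁ e₂, e₁.1 = e₂.1 → ∀ e' ∈ step i e₁,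
    ∃ e'' ∈ step i e₂, e''.1 = e'.1) {F : List (K × T)} {e e' : K × T} (he : e ∈ F)
    (h : SearchPath step items e e') : ∃ e'' ∈ search step items F, e''.1 = e'.1 := by
  induction items generalizing F e e' with
  | nil => exact ⟨e, he, by rw [h]⟩
  | cons i is ih =>
    obtain ⟨e₁, h₁, hp⟩ := h
    obtain ⟨e₂, h₂, h'⟩ := exists_mem_dedupBy Prod.fst (List.mem_flatMap.2 ⟨e, he, h₁⟩)
    obtain ⟨e₃, hp₃, h''⟩ := hp.of_key_eq hs h'.symm
    obtain ⟨e₄, h₄, h₅⟩ := ih h₂ hp₃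
    exact ⟨e₄, h₄, h₅.trans h''⟩

theorem inv_of_mem_search {Inv : ℕ → K × T → Prop} {F : List (K × T)} (h0 : ∀ e ∈ F, Inv 0 e)
    (hs : ∀ n e, Inv n e → ∀ i ∈ items, ∀ e' ∈ step i e, Inv (n + 1) e') :
    ∀ e ∈ search step items F, Inv items.length e := by
  induction items using List.reverseRecOn with
  | nil => exact h0
  | append_singleton is i ih =>
    intro e he
    rw [search_append_singleton] at he
    obtain ⟨e₁, h₁, h'⟩ := List.mem_flatMap.1 (mem_of_mem_dedupBy he)
    rw [List.length_append]
    exact hs _ _ (ih (fun n e h j hj => hs n e h j (List.mem_append_left _ hj)) _ h₁) i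
      (by simp) e h'

end search

/-! ### Computing the search. -/

section

variable {X : Type} [Scale X] {ι K T β γ : X → Type} [∀ x, Enc (β x)] [∀ x, Enc (γ x)]
  [∀ x, Enc (ι x)] [∀ x, Enc (K x)] [∀ x, Enc (T x)] {c : X → Val}

/-- The invariant, indexed by the number of items processed, bounds the size of each entry and
confines its key to `keys x`. After every deduplication there are thus at most as many entries as
keys, although each step multiplies them. -/
theorem FP.search [∀ x, LawfulEnc (K x)] {items : ∀ x, List (ι x)} {F : ∀ x, List (K x × T x)}
    {step : ∀ x, ι x → K x × T x → List (K x × T x)} (hi : FP c items) (hF : FP c F)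
    (Inv : ∀ x, ℕ → K x × T x → Prop) (h0 : ∀ x, ∀ e ∈ F x, Inv x 0 e)
    (hs : ∀ x n e, Inv x n e → ∀ i ∈ items x, ∀ e' ∈ step x i e, Inv x (n + 1) e')
    (b : X → ℕ) (hb : Bdd b)
    (hsize : ∀ x n e, n ≤ (items x).length → Inv x n e → (enc e).size ≤ b x)
    (keys : ∀ x, List (K x)) (hk : Bdd fun x => (keys x).length)
    (hkey : ∀ x n e, n ≤ (items x).length → Inv x n e → e.1 ∈ keys x)
    (hstep : FP (ext c) (fun z : Σ x, {p : ι x × (K x × T x) // p.1 ∈ items x ∧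
        ∃ n < (items x).length, Inv x n p.2} => z.2.1.1) →
      FP (ext c) (fun z : Σ x, {p : ι x × (K x × T x) // p.1 ∈ items x ∧
        ∃ n < (items x).length, Inv x n p.2} => z.2.1.2) →
      FP (ext c) fun z : Σ x, {p : ι x × (K x × T x) // p.1 ∈ items x ∧
        ∃ n < (items x).length, Inv x n p.2} => step z.1 z.2.1.1 z.2.1.2) :
    FP c fun x => search (step x) (items x) (F x) := by
  have hvar : FP (ext c) fun z : Σ x, {p : ι x × (K x × T x) // p.1 ∈ items x ∧
      ∃ n < (items x).length, Inv x n p.2} => z.2.1 :=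
    ⟨(Comp.self (ext c)).tl, ((hi.2.add hb).add (Bdd.const 1)).sigma _ |>.mono
      fun ⟨x, ⟨i, e⟩, h, n, hn, he⟩ => by
        have h1 := hsize x n e hn.le he
        have h2 := size_enc_le_of_mem h
        rw [size_enc_pair]
        simp only at h1 h2 ⊢
        omega⟩
  have hstep' := hstep hvar.fst hvar.snd
  refine hi.foldl (γ := fun x => List (K x × T x))
    (f := fun x F i => _root_.dedupBy Prod.fst (F.flatMap (step x i))) hF
    ⟨fun x => (keys x).length * (b x + 1) + 1 + (enc (F x)).size,
      ((hk.mul (hb.add (Bdd.const 1))).add (Bdd.const 1)).add hF.2, fun x pre post h => ?_⟩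
    fun ha hy => ?_
  · have hs' : ∀ n e, Inv x n e → ∀ i ∈ pre, ∀ e' ∈ step x i e, Inv x (n + 1) e' :=
      fun n e he i hi => hs x n e he i (by simp [h, hi])
    have hpre : pre.length ≤ (items x).length := by simp [h]
    have hinv := inv_of_mem_search (h0 x) hs'
    show (enc (_root_.search (step x) pre (F x))).size ≤ _
    -- The start list has not been deduplicated, so its size is a separate summand of the bound.
    rcases List.eq_nil_or_concat pre with rfl | ⟨is, i, rfl⟩
    · exact Nat.le_add_left _ _
    · refine Nat.le_add_right_of_le (size_enc_list_le ?_ fun e he => hsize x _ e hpre (hinv e he))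
      rw [List.concat_eq_append, search_append_singleton] at hinv ⊢
      refine length_dedupBy_le _ _ _ fun e he => ?_
      obtain ⟨e₁, h₁, h'⟩ := List.mem_flatMap.1 he
      rw [List.concat_eq_append] at hs' hpre
      refine hkey x _ e hpre ?_
      rw [List.length_append]
      exact hs' _ _ (inv_of_mem_search (h0 x) (fun n e h j hj => hs' n e h j
        (List.mem_append_left _ hj)) _ h₁) i (by simp) e h'
  · refine FP.dedupBy (key := fun _ => Prod.fst) (ha.flatMap fun he => ?_) fun hy => hy.fst
    refine FP.bindSub (t := fun x (p : ι x × (K x × T x)) => step x p.1 p.2) hstep' (hy.wk.pair he)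
      (fun _ => rfl)
      (fun _ => rfl) (Comp.self (ext (ext c))).hd.hd ?_
    rintro ⟨⟨x, ⟨acc, i⟩, pre, post, h, e⟩, y, hy⟩
    have hy' : y ∈ _root_.search (step x) pre (F x) := (congrArg (y ∈ ·) e).mp hy
    simp only at h
    refine ⟨(congrArg (i ∈ ·) h).mpr (by simp), pre.length, ?_, ?_⟩
    · have := congrArg List.length h
      simp only [List.length_append, List.length_cons] at this
      simp only
      omega
    · exact inv_of_mem_search (h0 x) (fun n e h' j hj => hs x n e h' j
        ((congrArg (j ∈ ·) h).mpr (List.mem_append_left _ hj))) y hy'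

end

/-! ### Optimal rewriting of a block, one branch after the other -/

section blockDP

variable {m : ℕ} {ι β γ : Type}

/-- The key consists of the situations in which all conditions so far have failed and of the cost so
far; the trace is the list of new branches, in reverse order. -/
def dpStep (body : ι → Literal m → List (Situation m) → List (ℕ × β)) (i : ι)
    (e : (List (Situation m) × ℕ) × List (Literal m × β)) :
    List ((List (Situation m) × ℕ) × List (Literal m × β)) :=
  (allLits m).flatMap fun l => (body i l (e.1.1.filter fun s => l.holds s = true)).map fun b =>
    ((e.1.1.filter fun s => ¬ l.holds s = true, e.1.2 + b.1), (l, b.2) :: e.2)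

/-- Costs, with one block for each, of the blocks that treat the situations in `U`. The list
`body i l V` contains the possible costs and bodies of branch `i` with the new condition `l`, if
`V` is the set of situations that use this branch; `fin` does the same for the last body. -/
noncomputable def blockDP (body : ι → Literal m → List (Situation m) → List (ℕ × β))
    (fin : List (Situation m) → List (ℕ × γ)) (items : List ι) (U : List (Situation m)) :
    List (ℕ × (List (Literal m × β) × γ)) :=
  (search (dpStep body) items [((U, 0), [])]).flatMap fun e =>
    (fin e.1.1).map fun o => (e.1.2 + o.1, (e.2.reverse, o.2))

/-- The blocks among which `blockDP` chooses. -/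
def BlockRun (body : ι → Literal m → List (Situation m) → List (ℕ × β))
    (fin : List (Situation m) → List (ℕ × γ)) :
    List ι → List (Situation m) → ℕ → List (Literal m × β) → γ → Prop
  | [], U, n, bs, o => bs = [] ∧ (n, o) ∈ fin U
  | i :: is, U, n, bs, o => ∃ l b bs' n₁ n₂, bs = (l, b) :: bs' ∧ n = n₁ + n₂ ∧
      (n₁, b) ∈ body i l (U.filter fun s => l.holds s = true) ∧
      BlockRun body fin is (U.filter fun s => ¬ l.holds s = true) n₂ bs' o

variable {body : ι → Literal m → List (Situation m) → List (ℕ × β)}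
  {fin : List (Situation m) → List (ℕ × γ)} {items : List ι} {U : List (Situation m)} {n : ℕ}
  {bs : List (Literal m × β)} {o : γ}

theorem blockRun_of_path {e e' : (List (Situation m) × ℕ) × List (Literal m × β)}
    (h : SearchPath (dpStep body) items e e') {n : ℕ} (ho : (n, o) ∈ fin e'.1.1) :
    ∃ bs n', e'.2 = bs.reverse ++ e.2 ∧ e'.1.2 + n = e.1.2 + n' ∧
      BlockRun body fin items e.1.1 n' bs o := by
  induction items generalizing e with
  | nil =>
    cases h
    exact ⟨[], n, rfl, rfl, rfl, ho⟩
  | cons i is ih =>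
    obtain ⟨e₁, h₁, hp⟩ := h
    obtain ⟨bs, n', hb, hn, hr⟩ := ih hp
    simp only [dpStep, List.mem_flatMap, List.mem_map] at h₁
    obtain ⟨l, -, b, hb', rfl⟩ := h₁
    refine ⟨(l, b.2) :: bs, b.1 + n', by simp [hb], by simp only at hn ⊢; omega, l, b.2, bs, b.1,
      n',
      rfl, rfl, hb', hr⟩

theorem blockRun_of_mem_blockDP (h : (n, (bs, o)) ∈ blockDP body fin items U) :
    BlockRun body fin items U n bs o := by
  simp only [blockDP, List.mem_flatMap, List.mem_map] at h
  obtain ⟨e', he', ⟨n', o'⟩, ho, heq⟩ := h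
  obtain ⟨e, he, hp⟩ := exists_path_of_mem_search he'
  rw [List.mem_singleton] at he
  subst he
  obtain ⟨bs', n'', hb, hn, hr⟩ := blockRun_of_path hp ho
  simp only [Prod.mk.injEq] at heq
  obtain ⟨rfl, rfl, rfl⟩ := heq
  simp only [List.append_nil] at hb
  rw [hb, List.reverse_reverse]
  simp only [zero_add] at hn
  rw [hn]
  exact hr

theorem path_of_blockRun (h : BlockRun body fin items U n bs o) (n₀ : ℕ)
    (acc : List (Literal m × β)) : ∃ U' n₁ n₂ acc', n₁ + n₂ = n₀ + n ∧ (n₂, o) ∈ fin U' ∧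
      SearchPath (dpStep body) items ((U, n₀), acc) ((U', n₁), acc') := by
  induction items generalizing U n n₀ bs acc with
  | nil => exact ⟨U, n₀, n, acc, rfl, h.2, rfl⟩
  | cons i is ih =>
    obtain ⟨l, b, bs', n₁, n₂, rfl, rfl, hb, hr⟩ := h
    obtain ⟨U', k₁, k₂, acc', hk, ho, hp⟩ := ih hr (n₀ + n₁) ((l, b) :: acc)
    refine ⟨U', k₁, k₂, acc', by omega, ho, _, ?_, hp⟩
    simp only [dpStep, List.mem_flatMap, List.mem_map]
    exact ⟨l, mem_allLits l, (n₁, b), hb, rfl⟩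

/-- Only the cost is preserved: the block that was kept may be another one with this cost. -/
theorem exists_mem_blockDP (h : BlockRun body fin items U n bs o) :
    ∃ bs' o', (n, (bs', o')) ∈ blockDP body fin items U := by
  obtain ⟨U', n₁, n₂, acc, hn, ho, hp⟩ := path_of_blockRun h 0 []
  obtain ⟨⟨⟨U'', n₃⟩, acc'⟩, he, hk⟩ := exists_mem_search_of_path (fun i e₁ e₂ he e' he' => by
    simp only [dpStep, List.mem_flatMap, List.mem_map] at he' ⊢
    obtain ⟨l, hl, b, hb, rfl⟩ := he'
    exact ⟨_, ⟨l, hl, b, by rwa [← he], rfl⟩, by rw [he]⟩) (List.mem_singleton_self _) hp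
  simp only [Prod.mk.injEq] at hk
  obtain ⟨rfl, rfl⟩ := hk
  refine ⟨acc'.reverse, o, ?_⟩
  simp only [blockDP, List.mem_flatMap, List.mem_map]
  exact ⟨_, he, (n₂, o), ho, by simp only [Prod.mk.injEq, and_true]; omega⟩

end blockDP

/-! ### Computing the dynamic program. -/

section

variable {X : Type} [Scale X] {ι β γ : X → Type} [∀ x, Enc (β x)] [∀ x, Enc (γ x)]
  [∀ x, Enc (ι x)] {c : X → Val} {m : X → ℕ}

/-- There are at most `2 ^ 2 ^ m` sets of remaining situations, as these are sublists of the list of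
all situations, and the costs are bounded because they are computed in unary. The type `Y` of local
variables in `hbody` and `hfin` makes these hypotheses applicable inside the loops. -/
theorem FP.blockDP {items : ∀ x, List (ι x)} {U : ∀ x, List (Situation (m x))}
    {body : ∀ x, ι x → Literal (m x) → List (Situation (m x)) → List (ℕ × β x)}
    {fin : ∀ x, List (Situation (m x)) → List (ℕ × γ x)}
    (hm : FP c m) (hp : ∀ x, m x = Scale.par x) (hi : FP c items) (hU : FP c U)
    (hUs : ∀ x, (U x).Sublist (_root_.allSits (m x)))
    (hbody : ∀ {Y : X → Type} [∀ x, Enc (Y x)] (i : ∀ z : Σ x, Y x, ι z.1)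
      (l : ∀ z : Σ x, Y x, Literal (m z.1)) (V : ∀ z : Σ x, Y x, List (Situation (m z.1))),
      (∀ z, i z ∈ items z.1) → (∀ z, (V z).Sublist (_root_.allSits (m z.1))) →
      FP (ext c) i → FP (ext c) l → FP (ext c) V →
      FP (ext c) fun z => body z.1 (i z) (l z) (V z))
    (hfin : ∀ {Y : X → Type} [∀ x, Enc (Y x)] (V : ∀ z : Σ x, Y x, List (Situation (m z.1))),
      (∀ z, (V z).Sublist (_root_.allSits (m z.1))) → FP (ext c) V →
      FP (ext c) fun z => fin z.1 (V z)) :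
    FP c fun x => blockDP (body x) (fin x) (items x) (U x) := by
  have hS := FP.allSits hm hp
  have hL := FP.allLits hm
  have hv : FP (ext c) fun z : Σ x, {p : ι x × (Literal (m x) × List (Situation (m x))) //
      p.1 ∈ items x ∧ p.2.2.Sublist (_root_.allSits (m x))} => z.2.1 :=
    ⟨(Comp.self (ext c)).tl, (((hi.2.add hL.2).add hS.2).add (Bdd.const 2)).sigma _ |>.mono
      fun ⟨x, ⟨i, l, V⟩, h, h'⟩ => by
        have h1 := size_enc_le_of_mem h
        have h2 := size_enc_le_of_sublist h'
        have h3 := size_enc_le_of_mem (mem_allLits l)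
        rw [size_enc_pair, size_enc_pair]
        simp only at h1 h2 ⊢
        omega⟩
  have hb := hbody _ _ _ (fun z => z.2.2.1) (fun z => z.2.2.2) hv.fst hv.snd.fst hv.snd.snd
  have hvf : FP (ext c) fun z : Σ x, {V : List (Situation (m x)) //
      V.Sublist (_root_.allSits (m x))} => z.2.1 :=
    ⟨(Comp.self (ext c)).tl, (hS.2.sigma _).mono fun z => size_enc_le_of_sublist z.2.2⟩
  have hf := hfin _ (fun z => z.2.2) hvf
  -- `B x` bounds the code of each list `body x i l V`, and thus all costs and bodies in it,
  -- uniformly in `i`, `l` and `V`.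
  obtain ⟨B, hB, hB'⟩ := hb.2.descend
  have hcost : ∀ x i l V, i ∈ items x → V.Sublist (_root_.allSits (m x)) →
      ∀ b ∈ body x i l V, b.1 ≤ B x ∧ (enc b.2).size ≤ B x := fun x i l V hi hV b hb => by
    have h1 := hB' x ⟨(i, l, V), hi, hV⟩
    have h2 := size_enc_le_of_mem hb
    rw [size_enc_pair, size_enc_nat] at h2
    simp only at h1
    omega
  set Inv : ∀ x, ℕ → (List (Situation (m x)) × ℕ) × List (Literal (m x) × β x) → Prop :=
    fun x n e => e.1.1.Sublist (_root_.allSits (m x)) ∧ e.1.2 ≤ n * B x ∧ e.2.length = n ∧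
      ∀ p ∈ e.2, (enc p.2).size ≤ B x with hInv
  have h0 : ∀ x, ∀ e ∈ [((U x, 0), ([] : List (Literal (m x) × β x)))], Inv x 0 e := by
    intro x e he
    rw [List.mem_singleton] at he
    subst he
    exact ⟨hUs x, by simp, rfl, by simp⟩
  have hs : ∀ x n e, Inv x n e → ∀ i ∈ items x, ∀ e' ∈ dpStep (body x) i e, Inv x (n + 1) e' := by
    rintro x n e ⟨h1, h2, h3, h4⟩ i hi e' he'
    simp only [dpStep, List.mem_flatMap, List.mem_map] at he'
    obtain ⟨l, -, b, hb, rfl⟩ := he'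
    obtain ⟨hb1, hb2⟩ := hcost x i l _ hi ((List.filter_sublist).trans h1) b hb
    refine ⟨(List.filter_sublist).trans h1, ?_, by simp [h3], ?_⟩
    · simp only
      rw [add_mul, one_mul]
      omega
    · simpa [hb2] using h4
  have hsearch : FP c fun x => _root_.search (dpStep (body x)) (items x)
      [((U x, 0), ([] : List (Literal (m x) × β x)))] := by
    refine FP.search hi (((hU.pair (FP.const 0)).pair nil).cons nil) Inv h0 hs
      (fun x => (enc (_root_.allSits (m x))).size + (2 * ((items x).length * B x) + 1) +
        ((items x).length * ((enc (_root_.allLits (m x))).size + B x + 1 + 1) + 1) + 2) ?_ ?_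
      (fun x => (_root_.allSits (m x)).sublists' ×ˢ List.range ((items x).length * B x + 1)) ?_ ?_
      fun hi' he' => ?_
    · exact ((hS.2.add (((Bdd.const 2).mul (hi.length_bdd.mul hB)).add (Bdd.const 1))).add
        ((hi.length_bdd.mul (((hL.2.add hB).add (Bdd.const 1)).add (Bdd.const 1))).add
          (Bdd.const 1))).add (Bdd.const 2)
    · rintro x n e hn ⟨h1, h2, h3, h4⟩
      rw [size_enc_pair, size_enc_pair, size_enc_nat]
      have k1 := size_enc_le_of_sublist h1
      have k2 := h2.trans (Nat.mul_le_mul_right _ hn)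
      have k3 := size_enc_list_le (n := (items x).length)
        (b := (enc (_root_.allLits (m x))).size + B x + 1) (h3.le.trans hn) fun p hp => by
          have := size_enc_le_of_mem (mem_allLits p.1)
          have := h4 p hp
          rw [size_enc_pair]
          omega
      omega
    · refine Bdd.mono ((Bdd.par (X := X) fun n => 2 ^ 2 ^ n).mul ((hi.length_bdd.mul hB).add
        (Bdd.const 1))) fun x => ?_
      rw [List.length_product, List.length_sublists', length_allSits, List.length_range, hp]
    · rintro x n e hn ⟨h1, h2, -⟩
      rw [List.mem_product, List.mem_sublists', List.mem_range]
      exact ⟨h1, Nat.lt_succ_of_le (h2.trans (Nat.mul_le_mul_right _ hn))⟩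
    · refine FP.flatMap hL.wk fun hl => ?_
      have hV := he'.wk.fst.fst.filter (P := fun z s => z.2.1.holds s = true)
        (inst := fun _ _ => inferInstance) fun hs => FPD.holds hl.wk hs
      have hV' := he'.wk.fst.fst.filter (P := fun z s => ¬ z.2.1.holds s = true)
        (inst := fun _ _ => inferInstance) fun hs => (FPD.holds hl.wk hs).not
      refine FP.map ?_ fun hy => (hV'.wk.pair (he'.wk.wk.fst.snd.add hy.fst)).pair
        ((hl.wk.pair hy.snd).cons he'.wk.wk.snd)
      refine FP.bindSub (t := fun x (p : ι x × (Literal (m x) × List (Situation (m x)))) =>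
        body x p.1 p.2.1 p.2.2) hb (hi'.wk.pair (hl.pair hV))
        (fun _ => rfl) (fun _ => rfl) (Comp.self (ext (ext c))).hd.hd ?_
      rintro ⟨⟨x, ⟨i, e⟩, h, n, hn, h1, -⟩, l, hl⟩
      exact ⟨h, (List.filter_sublist).trans h1⟩
  refine hsearch.flatMap fun he => FP.map ?_ fun ho =>
    (he.wk.fst.snd.add ho.fst).pair (he.wk.snd.reverse.pair ho.snd)
  refine FP.bindSub (t := fun x V => fin x V) hf he.fst.fst
    (fun _ => rfl) (fun _ => rfl) (Comp.self (ext c)).hd ?_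
  rintro ⟨x, e, he⟩
  exact (inv_of_mem_search (h0 x) (hs x) e he).1

end

/-! ### From computed terms to tractability -/

/-- The algorithm has to run within the bound on valid inputs only, and the code of its optional
result is literally the answer expected from the program. -/
theorem SearchProblem.FPTractable.of_FP {P : SearchProblem} [Scale P.Inst] {κ : P.Inst → ℕ}
    (hκ : ∀ x : P.Inst, Scale.par x = κ x) (hs : ∀ x : P.Inst, Scale.size x = (P.codeInst x).size)
    [∀ x, Enc (P.Out x)] (he : ∀ x (y : P.Out x), P.codeOut x y = enc y)
    (alg : ∀ x : P.Inst, Option (P.Out x))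
    (hfp : FP (fun x : {x // P.Valid x} => P.codeInst x.1) fun x => alg x.1)
    (hsound : ∀ x, P.Valid x → ∀ y, alg x = some y → P.IsSol x y)
    (hcomplete : ∀ x, P.Valid x → alg x = none → ∀ y, ¬ P.IsSol x y) : P.FPTractable κ := by
  obtain ⟨⟨p, w, b, ⟨g, e, hb⟩, hp⟩, -⟩ := hfp
  refine ⟨p, g, e, fun x hx => ?_⟩
  obtain ⟨τ, t, hτ, ht, h0, -⟩ := hp ⟨x, hx⟩ (Store.start (P.codeInst x)) (by simp [Store.start])
  refine ⟨τ, t, hτ, ?_, ?_⟩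
  · rw [← hκ, ← hs]
    exact ht.trans (hb ⟨x, hx⟩)
  · rw [h0]
    cases h : alg x with
    | none => exact Or.inr ⟨hcomplete x hx h, by simp [h, enc]⟩
    | some y => exact Or.inl ⟨y, hsound x hx y h, by simp [h, enc, he]⟩

/-! ### Distances between blocks, and sequences of changes -/

/-- `0` if `a = b`, and `1` otherwise. -/
noncomputable def neq {α : Type} (a b : α) : ℕ :=
  open Classical in if a = b then 0 else 1

@[simp] theorem neq_self {α : Type} (a : α) : neq a a = 0 := if_pos rfl

theorem neq_le_one {α : Type} (a b : α) : neq a b ≤ 1 := by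
  rw [neq]; split_ifs <;> omega

theorem neq_of_ne {α : Type} {a b : α} (h : a ≠ b) : neq a b = 1 := if_neg h

theorem eq_of_neq_eq_zero {α : Type} {a b : α} (h : neq a b = 0) : a = b := by
  by_contra h'
  rw [neq_of_ne h'] at h
  omega

/-- The number of positions in which two lists differ. -/
noncomputable def ham {α : Type} (l l' : List α) : ℕ :=
  ((l.zip l').map fun p => neq p.1 p.2).sum

section ham

variable {α : Type}

@[simp] theorem ham_nil (l : List α) : ham [] l = 0 := rfl

@[simp] theorem ham_cons (a b : α) (l l' : List α) :
    ham (a :: l) (b :: l') = neq a b + ham l l' := rfl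

@[simp] theorem ham_self (l : List α) : ham l l = 0 := by
  induction l with
  | nil => rfl
  | cons a l ih => simp [ih]

theorem ham_le (l l' : List α) : ham l l' ≤ l.length := by
  induction l generalizing l' with
  | nil => simp
  | cons a l ih =>
    cases l' with
    | nil => simp [ham]
    | cons b l' =>
      have := ih l'
      have := neq_le_one a b
      simp only [ham_cons, List.length_cons]
      omega

theorem eq_of_ham_eq_zero {l l' : List α} (hl : l.length = l'.length) (h : ham l l' = 0) :
    l = l' := by
  induction l generalizing l' with
  | nil => exact (List.length_eq_zero_iff.1 hl.symm).symm
  | cons a l ih =>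
    cases l' with
    | nil => simp at hl
    | cons b l' =>
      simp only [ham_cons, List.length_cons, Nat.add_right_cancel_iff] at hl h
      rw [ih hl (by omega), eq_of_neq_eq_zero (a := a) (b := b) (by omega)]

theorem ham_append {l₁ l₂ l₁' l₂' : List α} (h : l₁.length = l₁'.length) :
    ham (l₁ ++ l₂) (l₁' ++ l₂') = ham l₁ l₁' + ham l₂ l₂' := by
  simp [ham, List.zip_append h]

theorem ham_change_le (x pre post : List α) (a b : α) :
    ham x (pre ++ b :: post) ≤ ham x (pre ++ a :: post) + 1 := by
  induction pre generalizing x with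
  | nil =>
    cases x with
    | nil => simp
    | cons c x =>
      have := neq_le_one c b
      simp only [List.nil_append, ham_cons]
      omega
  | cons d pre ih =>
    cases x with
    | nil => simp
    | cons c x =>
      have := ih x
      simp only [List.cons_append, ham_cons]
      omega

end ham

/-- A chain of `n` steps. -/
inductive Steps {α : Type} (r : α → α → Prop) : ℕ → α → α → Prop
  | refl (x : α) : Steps r 0 x x
  | step {n : ℕ} {x y z : α} : Steps r n x y → r y z → Steps r (n + 1) x z

theorem Steps.trans {α : Type} {r : α → α → Prop} {n n' : ℕ} {x y z : α} (h : Steps r n x y)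
    (h' : Steps r n' y z) : Steps r (n + n') x z := by
  induction h' with
  | refl => exact h
  | step _ hr ih => exact (ih h).step hr

theorem Steps.neq {α β : Type} {r : α → α → Prop} {f : β → α} {a b : β} (h : r (f a) (f b)) :
    Steps r (neq a b) (f a) (f b) := by
  by_cases e : a = b
  · subst e
    rw [neq_self]
    exact Steps.refl _
  · rw [neq_of_ne e]
    exact (Steps.refl _).step h

namespace Block

variable {m : ℕ} {α : Type} {r : α → α → Prop}

theorem ext_conds_bodies {b b' : Block m α} (hc : b.conds = b'.conds) (hb : b.bodies = b'.bodies) :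
    b = b' := by
  obtain ⟨bs, o⟩ := b
  obtain ⟨bs', o'⟩ := b'
  simp only [bodies] at hb
  obtain ⟨h1, h2⟩ := List.append_inj' hb rfl
  simp only [List.cons.injEq, and_true] at h2
  have : bs = bs' := by
    rw [← List.zip_unzip bs, ← List.zip_unzip bs', List.unzip_fst, List.unzip_snd, List.unzip_fst,
      List.unzip_snd, h1]
    simp only [conds] at hc
    rw [hc]
  rw [this, h2]

theorem length_conds (b : Block m α) : b.conds.length = b.branches.length := by simp [conds]

theorem length_bodies (b : Block m α) : b.bodies.length = b.conds.length + 1 := by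
  simp [conds, bodies]

/-- Positions are corrected from left to right, where `pre` is the part that is already correct. -/
theorem steps_conds (o : α) : ∀ (bs bs' pre : List (Literal m × α)),
    bs.map Prod.snd = bs'.map Prod.snd →
    Steps (Change r) (ham (bs.map Prod.fst) (bs'.map Prod.fst)) ⟨pre ++ bs, o⟩ ⟨pre ++ bs', o⟩
  | [], bs', pre, h => by
    rw [List.map_nil] at h
    rw [List.map_eq_nil_iff.1 h.symm]
    exact Steps.refl _
  | e :: bs, [], _, h => by simp at h
  | (l, a) :: bs, (l', a') :: bs', pre, h => by
    simp only [List.map_cons, List.cons.injEq] at h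
    obtain ⟨rfl, h⟩ := h
    refine (Steps.neq (f := fun l => (⟨pre ++ (l, a) :: bs, o⟩ : Block m α))
      (Change.cond pre bs l l' a o)).trans ?_
    have := steps_conds o bs bs' (pre ++ [(l', a)]) h
    rwa [List.append_assoc, List.append_assoc] at this

theorem steps_bodies : ∀ (bs bs' pre : List (Literal m × α)) (o o' : α),
    (∀ a a', r a a') → bs.map Prod.fst = bs'.map Prod.fst →
    Steps (Change r) (ham (bs.map Prod.snd ++ [o]) (bs'.map Prod.snd ++ [o']))
      ⟨pre ++ bs, o⟩ ⟨pre ++ bs', o'⟩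
  | [], bs', pre, o, o', hr, h => by
    rw [List.map_nil] at h
    rw [List.map_eq_nil_iff.1 h.symm]
    exact Steps.neq (f := fun o => (⟨pre ++ [], o⟩ : Block m α)) (Change.otherwise _ _ _ (hr _ _))
  | e :: bs, [], _, _, _, _, h => by simp at h
  | (l, a) :: bs, (l', a') :: bs', pre, o, o', hr, h => by
    simp only [List.map_cons, List.cons.injEq] at h
    obtain ⟨rfl, h⟩ := h
    refine (Steps.neq (f := fun a => (⟨pre ++ (l, a) :: bs, o⟩ : Block m α))
      (Change.body pre bs l a a' o (hr _ _))).trans ?_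
    have := steps_bodies bs bs' (pre ++ [(l, a')]) o o' hr h
    rwa [List.append_assoc, List.append_assoc] at this

/-- A change of one condition or of one body, in terms of the lists of conditions and bodies. -/
theorem Change.conds_bodies {b b' : Block m α} (h : Change r b b') :
    (b.bodies = b'.bodies ∧ ∃ pre post l l', b.conds = pre ++ l :: post ∧
      b'.conds = pre ++ l' :: post) ∨
    (b.conds = b'.conds ∧ ∃ pre post a a', b.bodies = pre ++ a :: post ∧
      b'.bodies = pre ++ a' :: post ∧ r a a') := by
  rcases h with ⟨pre, post, l, l', a, o⟩ | ⟨pre, post, l, a, a', o, h⟩ | ⟨bs, o, o', h⟩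
  · exact Or.inl ⟨by simp [bodies], pre.map Prod.fst, post.map Prod.fst, l, l', by simp [conds],
      by simp [conds]⟩
  · exact Or.inr ⟨by simp [conds], pre.map Prod.snd, post.map Prod.snd ++ [o], a, a',
      by simp [bodies], by simp [bodies], h⟩
  · exact Or.inr ⟨by simp [conds], bs.map Prod.snd, [], o, o', by simp [bodies], by simp [bodies],
      h⟩

end Block

/-- `c` code changes are needed to transform the procedure `p` into `p'`. -/
def Sim {m k : ℕ} (p p' : Procedure m k) (c : ℕ) : Prop :=
  p.conds.length = p'.conds.length ∧ c = ham p.conds p'.conds + ham p.bodies p'.bodies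

theorem Sim.refl {m k : ℕ} (p : Procedure m k) : Sim p p 0 := ⟨rfl, by simp⟩

theorem Sim.eq_of_zero {m k : ℕ} {p p' : Procedure m k} (h : Sim p p' 0) : p = p' :=
  Block.ext_conds_bodies (eq_of_ham_eq_zero h.1 (by have := h.2; omega))
    (eq_of_ham_eq_zero (by rw [Block.length_bodies, Block.length_bodies, h.1])
      (by have := h.2; omega))

theorem Sim.steps {m k : ℕ} {p p' : Procedure m k} {c : ℕ} (h : Sim p p' c) :
    Steps (Block.Change fun _ _ => True) c p p' := by
  obtain ⟨bs, o⟩ := p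
  obtain ⟨bs', o'⟩ := p'
  obtain ⟨hl, rfl⟩ := h
  have hl' : bs.length = bs'.length := by simpa [Block.conds] using hl
  -- The intermediate procedure has the new conditions and the old actions.
  set bs₁ := (bs'.map Prod.fst).zip (bs.map Prod.snd) with h1
  have hf : bs₁.map Prod.fst = bs'.map Prod.fst := List.map_fst_zip (by simp [hl'])
  have hs : bs₁.map Prod.snd = bs.map Prod.snd := List.map_snd_zip (by simp [hl'])
  have s1 := Block.steps_conds (r := fun _ _ : Fin k => True) o bs bs₁ [] hs.symm
  have s2 := Block.steps_bodies (r := fun _ _ : Fin k => True) bs₁ bs' [] o o'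
    (fun _ _ => trivial) hf
  rw [hf] at s1
  rw [hs] at s2
  exact s1.trans s2

/-- A single change affects one position, so the Hamming distance from a fixed source grows by at
most one, and the numbers of conditions stay equal. -/
theorem Sim.change {m k : ℕ} {q p p' : Procedure m k} {c : ℕ} (h : Sim q p c)
    (hc : Block.Change (fun _ _ => True) p p') : ∃ c' ≤ c + 1, Sim q p' c' := by
  obtain ⟨hl, rfl⟩ := h
  refine ⟨_, ?_, ?_, rfl⟩
  · rcases hc.conds_bodies with ⟨hb, pre, post, l, l', e, e'⟩ | ⟨hc, pre, post, a, a', e, e', -⟩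
    · have := ham_change_le q.conds pre post l l'
      rw [← hb, e, e']
      omega
    · have := ham_change_le q.bodies pre post a a'
      rw [← hc, e, e']
      omega
  · rcases hc.conds_bodies with ⟨hb, pre, post, l, l', e, e'⟩ | ⟨hc, -⟩
    · rw [hl, e, e']
      simp
    · rw [hl, hc]

/-- Two lists are related entry by entry, with the sums of two counters. -/
inductive SumRel {α β : Type} (e : α → β → ℕ → ℕ → Prop) : List α → List β → ℕ → ℕ → Prop
  | nil : SumRel e [] [] 0 0
  | cons {x : α} {y : β} {xs : List α} {ys : List β} {a c a' c' : ℕ} :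
      e x y a c → SumRel e xs ys a' c' → SumRel e (x :: xs) (y :: ys) (a + a') (c + c')

section SumRel

variable {α β : Type} {e : α → β → ℕ → ℕ → Prop} {xs : List α} {ys : List β} {a c : ℕ}

theorem SumRel.self {e : α → α → ℕ → ℕ → Prop} (he : ∀ x, e x x 0 0) :
    ∀ xs : List α, SumRel e xs xs 0 0
  | [] => .nil
  | x :: xs => .cons (he x) (SumRel.self he xs)

theorem SumRel.change {pre post : List β} {y y' : β} {da dc : ℕ}
    (h : SumRel e xs (pre ++ y :: post) a c) (he : ∀ x a₁ c₁, e x y a₁ c₁ →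
      ∃ a₂ ≤ a₁ + da, ∃ c₂ ≤ c₁ + dc, e x y' a₂ c₂) :
    ∃ a' ≤ a + da, ∃ c' ≤ c + dc, SumRel e xs (pre ++ y' :: post) a' c' := by
  induction pre generalizing xs a c with
  | nil =>
    rcases h with _ | ⟨h1, h2⟩
    obtain ⟨a₂, ha, c₂, hc, h3⟩ := he _ _ _ h1
    exact ⟨_, by omega, _, by omega, .cons h3 h2⟩
  | cons z pre ih =>
    rcases h with _ | ⟨h1, h2⟩
    obtain ⟨a', ha, c', hc, h3⟩ := ih h2
    exact ⟨_, by omega, _, by omega, .cons h1 h3⟩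

end SumRel

section Edit

variable {m k : ℕ}

/-- `p'` arises from `p` by `c` code changes, or from a procedure of the library, which replaces
`p`. -/
def ProcEdit (L : Libraries m k) (p p' : Procedure m k) (a c : ℕ) : Prop :=
  (a = 0 ∧ Sim p p' c) ∨ (a = 1 ∧ ∃ q ∈ L.prc, Sim q p' c)

/-- A replacement from the library makes all earlier changes of the selector irrelevant, so at most
one replacement, followed by code changes, has to be considered. -/
def SelEdit (L : Libraries m k) (s s' : Selector m) (a c : ℕ) : Prop :=
  s.length = s'.length ∧
    ((a = 0 ∧ c = ham s s') ∨ (a = 1 ∧ ∃ q ∈ L.sel, q.length = s'.length ∧ c = ham q s'))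

/-- A normal form for sequences of `a` component changes and `c` code changes. -/
def Edit (L : Libraries m k) (S T : SoftSystem m k) (a c : ℕ) : Prop :=
  ∃ a₁ c₁ a₂ c₂, SelEdit L S.conds T.conds a₁ c₁ ∧
    SumRel (ProcEdit L) S.bodies T.bodies a₂ c₂ ∧ a = a₁ + a₂ ∧ c = c₁ + c₂

variable {L : Libraries m k} {S T U : SoftSystem m k} {a c : ℕ}

/-- Induction on the derivation. A library replacement resets the code changes of its selector or
slot to zero and leaves the replacement counter there at one; a code change raises one Hamming
distance by at most one. -/
theorem SoftSystem.Derives.edit (h : Derives L a c S T) :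
    ∃ a' ≤ a, ∃ c' ≤ c, Edit L S T a' c' := by
  induction h with
  | refl S =>
    exact ⟨0, le_rfl, 0, le_rfl, 0, 0, 0, 0, ⟨rfl, Or.inl ⟨rfl, by simp⟩⟩,
      SumRel.self (fun p => Or.inl ⟨rfl, Sim.refl p⟩) _, rfl, rfl⟩
  | @comp a c S T U _ h ih =>
    obtain ⟨a', ha, c', hc, a₁, c₁, a₂, c₂, hs, hb, rfl, rfl⟩ := ih
    have hprc : ∀ p p' : Procedure m k, p' ∈ L.prc → ∀ x a₁ c₁, ProcEdit L x p a₁ c₁ →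
        ∃ a₂ ≤ a₁ + 1, ∃ c₂ ≤ c₁ + 0, ProcEdit L x p' a₂ c₂ := fun p p' hp x a₁ c₁ _ =>
      ⟨1, by omega, 0, by omega, Or.inr ⟨rfl, p', hp, Sim.refl p'⟩⟩
    rcases h with ⟨T, U, hU, e⟩ | ⟨pre, post, l, p, p', o, hp⟩ | ⟨bs, o, o', hp⟩
    · refine ⟨1 + a₂, by omega, 0 + c₂, by omega, 1, 0, a₂, c₂, ⟨?_, Or.inr ⟨rfl, U.conds, hU, rfl,
        by simp⟩⟩, e ▸ hb, rfl, rfl⟩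
      have h1 := T.length_bodies
      have h2 := U.length_bodies
      rw [e] at h2
      rw [hs.1]
      omega
    · have e1 : ∀ p, (⟨pre ++ (l, p) :: post, o⟩ : SoftSystem m k).bodies =
          pre.map Prod.snd ++ p :: (post.map Prod.snd ++ [o]) := fun p => by simp [Block.bodies]
      rw [e1] at hb
      obtain ⟨a', ha', c', hc', hb'⟩ := hb.change (hprc p p' hp)
      refine ⟨a₁ + a', by omega, c₁ + c', by omega, a₁, c₁, a', c', ?_, by rw [e1]; exact hb', rfl,
        rfl⟩
      simpa [Block.conds] using hs
    · obtain ⟨a', ha', c', hc', hb'⟩ := hb.change (hprc o o' hp)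
      exact ⟨a₁ + a', by omega, c₁ + c', by omega, a₁, c₁, a', c', hs, hb', rfl, rfl⟩
  | @code a c S T U _ h ih =>
    obtain ⟨a', ha, c', hc, a₁, c₁, a₂, c₂, hs, hb, rfl, rfl⟩ := ih
    rcases h.conds_bodies with ⟨e, pre, post, l, l', e₁, e₂⟩ | ⟨e, pre, post, p, p', e₁, e₂, hr⟩
    · have hl : T.conds.length = U.conds.length := by rw [e₁, e₂]; simp
      obtain ⟨hl', ⟨rfl, rfl⟩ | ⟨rfl, q, hq, hl₂, rfl⟩⟩ := hs
      · have := ham_change_le S.conds pre post l l'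
        rw [e₁] at hc
        exact ⟨0 + a₂, by omega, ham S.conds U.conds + c₂, by rw [e₂]; omega, 0, _, a₂, c₂,
          ⟨hl'.trans hl, Or.inl ⟨rfl, rfl⟩⟩, e ▸ hb, rfl, rfl⟩
      · have := ham_change_le q pre post l l'
        rw [e₁] at hc
        exact ⟨1 + a₂, by omega, ham q U.conds + c₂, by rw [e₂]; omega, 1, _, a₂, c₂,
          ⟨hl'.trans hl, Or.inr ⟨rfl, q, hq, hl₂.trans hl, rfl⟩⟩, e ▸ hb, rfl, rfl⟩
    · rw [e₁] at hb
      obtain ⟨a', ha', c', hc', hb'⟩ := hb.change (y' := p') (da := 0) (dc := 1) (by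
        rintro x a₁ c₁ (⟨rfl, hx⟩ | ⟨rfl, q, hq, hx⟩)
        · obtain ⟨c', hc', h'⟩ := hx.change hr
          exact ⟨0, le_rfl, c', hc', Or.inl ⟨rfl, h'⟩⟩
        · obtain ⟨c', hc', h'⟩ := hx.change hr
          exact ⟨1, le_rfl, c', hc', Or.inr ⟨rfl, q, hq, h'⟩⟩)
      exact ⟨a₁ + a', by omega, c₁ + c', by omega, a₁, c₁, a', c', e ▸ hs, by rw [e₂]; exact hb',
        rfl, rfl⟩

theorem SoftSystem.Derives.trans {a' c' : ℕ} (h : Derives L a c S T) (h' : Derives L a' c' T U) :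
    Derives L (a + a') (c + c') S U := by
  induction h' with
  | refl => exact h
  | comp _ hr ih => exact (ih h).comp hr
  | code _ hr ih => exact (ih h).code hr

theorem SoftSystem.Derives.of_steps {α : Type} {r : α → α → Prop} {n : ℕ} {x y : α}
    (h : Steps r n x y) (C : α → SoftSystem m k) (hC : ∀ x y, r x y → CodeChange (C x) (C y)) :
    Derives L 0 n (C x) (C y) := by
  induction h with
  | refl => exact .refl _
  | step _ hr ih => exact ih.code (hC _ _ hr)

theorem ProcEdit.derives {p p' : Procedure m k} (h : ProcEdit L p p' a c)
    (C : Procedure m k → SoftSystem m k)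
    (hC : ∀ p p', Block.Change (fun _ _ => True) p p' → SoftSystem.CodeChange (C p) (C p'))
    (hC' : ∀ p, ∀ p' ∈ L.prc, SoftSystem.CompChange L (C p) (C p')) :
    SoftSystem.Derives L a c (C p) (C p') := by
  rcases h with ⟨rfl, h⟩ | ⟨rfl, q, hq, h⟩
  · exact .of_steps h.steps C hC
  · have := ((SoftSystem.Derives.refl (L := L) (C p)).comp (hC' p q hq)).trans
      (.of_steps h.steps C hC)
    simpa using this

theorem SoftSystem.Derives.of_sumRel : ∀ (bs bs' pre : List (Literal m × Procedure m k))
    (o o' : Procedure m k) (a c : ℕ), bs.map Prod.fst = bs'.map Prod.fst →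
    SumRel (ProcEdit L) (bs.map Prod.snd ++ [o]) (bs'.map Prod.snd ++ [o']) a c →
    Derives L a c ⟨pre ++ bs, o⟩ ⟨pre ++ bs', o'⟩
  | [], bs', pre, o, o', a, c, h, hr => by
    rw [List.map_nil] at h
    rw [List.map_eq_nil_iff.1 h.symm] at hr ⊢
    rcases hr with _ | ⟨h1, h2⟩
    rcases h2
    exact h1.derives (fun o => ⟨pre ++ [], o⟩) (fun p p' h => Block.Change.otherwise _ _ _ h)
      fun p p' h => CompChange.otherwise _ _ _ h
  | e :: bs, [], _, _, _, _, _, h, _ => by simp at h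
  | (l, p) :: bs, (l', p') :: bs', pre, o, o', a, c, h, hr => by
    simp only [List.map_cons, List.cons.injEq] at h
    obtain ⟨rfl, h⟩ := h
    rcases hr with _ | ⟨h1, h2⟩
    have s1 := h1.derives (fun p => ⟨pre ++ (l, p) :: bs, o⟩)
      (fun p p' h => Block.Change.body _ _ _ _ _ _ h) fun p p' h => CompChange.branch _ _ _ _ _ _ h
    have s2 := of_sumRel bs bs' (pre ++ [(l, p')]) o o' _ _ h h2
    exact s1.trans (by simpa using s2)

/-- The selector is brought into its final form first, by replacement and then by code changes,
while the procedures keep their positions. The slots follow from left to right, and none of these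
steps disturbs another. -/
theorem Edit.derives (h : Edit L S T a c) : SoftSystem.Derives L a c S T := by
  obtain ⟨a₁, c₁, a₂, c₂, ⟨hl, hs⟩, hb, rfl, rfl⟩ := h
  obtain ⟨bs, o⟩ := S
  obtain ⟨bs', o'⟩ := T
  have hl' : bs.length = bs'.length := by simpa [Block.conds] using hl
  have key : ∀ s : Selector m, s.length = bs.length →
      (⟨s.zip (bs.map Prod.snd), o⟩ : SoftSystem m k).conds = s ∧
      (⟨s.zip (bs.map Prod.snd), o⟩ : SoftSystem m k).bodies = bs.map Prod.snd ++ [o] :=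
    fun s h => ⟨List.map_fst_zip (by rw [List.length_map, h]), by
      simp only [Block.bodies]
      rw [List.map_snd_zip (by rw [List.length_map, h])]⟩
  have hcode : ∀ s : Selector m, s.length = bs.length →
      SoftSystem.Derives L 0 (ham s (bs'.map Prod.fst)) ⟨s.zip (bs.map Prod.snd), o⟩
        ⟨(bs'.map Prod.fst).zip (bs.map Prod.snd), o⟩ := fun s h => by
    have := Block.steps_conds (r := Block.Change fun _ _ : Fin k => True) o
      (s.zip (bs.map Prod.snd)) ((bs'.map Prod.fst).zip (bs.map Prod.snd)) []
      (by rw [List.map_snd_zip (by rw [List.length_map, h]),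
        List.map_snd_zip (by rw [List.length_map, List.length_map, hl'])])
    rw [List.map_fst_zip (by rw [List.length_map, h]),
      List.map_fst_zip (by rw [List.length_map, List.length_map, hl'])] at this
    exact .of_steps this id fun _ _ h => h
  have hS : (⟨bs, o⟩ : SoftSystem m k) = ⟨(bs.map Prod.fst).zip (bs.map Prod.snd), o⟩ :=
    Block.ext_conds_bodies (key _ (List.length_map _)).1.symm (key _ (List.length_map _)).2.symm
  have s1 : SoftSystem.Derives L a₁ c₁ ⟨bs, o⟩ ⟨(bs'.map Prod.fst).zip (bs.map Prod.snd), o⟩ := by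
    rcases hs with ⟨rfl, rfl⟩ | ⟨rfl, q, hq, hlq, rfl⟩
    · have := hcode (bs.map Prod.fst) (by simp)
      rwa [← hS] at this
    · have hlq' : q.length = bs.length := by
        rw [hlq, hl']
        simp [Block.conds]
      have h1 : SoftSystem.CompChange L ⟨bs, o⟩ ⟨q.zip (bs.map Prod.snd), o⟩ :=
        .selector _ _ (by rw [(key q hlq').1]; exact hq) (key q hlq').2
      have := ((SoftSystem.Derives.refl _).comp h1).trans (hcode q hlq')
      rwa [zero_add, zero_add, add_zero] at this
  refine s1.trans (SoftSystem.Derives.of_sumRel ((bs'.map Prod.fst).zip (bs.map Prod.snd)) bs' []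
    o o' _ _ ?_ ?_)
  · rw [List.map_fst_zip (by rw [List.length_map, List.length_map, hl'])]
  · rw [List.map_snd_zip (by rw [List.length_map, List.length_map, hl'])]
    exact hb

/-- `T` arises from `S` by `c` code changes. -/
def CodeEdit (S T : SoftSystem m k) (c : ℕ) : Prop :=
  ∃ c₂, S.conds.length = T.conds.length ∧
    SumRel (fun p p' a c => a = 0 ∧ Sim p p' c) S.bodies T.bodies 0 c₂ ∧
    c = ham S.conds T.conds + c₂

theorem SumRel.sim_of_procEdit {xs ys : List (Procedure m k)} (h : SumRel (ProcEdit L) xs ys a c)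
    (ha : a = 0) : SumRel (fun p p' a c => a = 0 ∧ Sim p p' c) xs ys 0 c := by
  induction h with
  | nil => exact .nil
  | @cons x y xs ys a c a' c' h1 _ ih =>
    rcases h1 with ⟨rfl, h1⟩ | ⟨rfl, -⟩
    · exact .cons (a := 0) (a' := 0) ⟨rfl, h1⟩ (ih (by omega))
    · omega

theorem SumRel.procEdit_of_sim {xs ys : List (Procedure m k)}
    (h : SumRel (fun p p' a c => a = 0 ∧ Sim p p' c) xs ys a c) :
    SumRel (ProcEdit L) xs ys a c := by
  induction h with
  | nil => exact .nil
  | cons h1 _ ih => exact .cons (Or.inl h1) ih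

/-- Code changes alone are a derivation without component changes, over the empty library, so the
general normal form applies. -/
theorem SoftSystem.CodeDerives.codeEdit (h : CodeDerives c S T) : ∃ c' ≤ c, CodeEdit S T c' := by
  have h' : Derives ⟨[], []⟩ 0 c S T := by
    induction h with
    | refl => exact .refl _
    | step _ hr ih => exact ih.code hr
  obtain ⟨a', ha, c', hc, a₁, c₁, a₂, c₂, ⟨hl, hs⟩, hb, e₁, e₂⟩ := h'.edit
  refine ⟨c', hc, c₂, hl, hb.sim_of_procEdit (by omega), ?_⟩
  rcases hs with ⟨-, rfl⟩ | ⟨rfl, -⟩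
  · exact e₂
  · omega

theorem CodeEdit.codeDerives (h : CodeEdit S T c) : SoftSystem.CodeDerives c S T := by
  obtain ⟨c₂, hl, hb, rfl⟩ := h
  have h' : Edit ⟨[], []⟩ S T 0 (ham S.conds T.conds + c₂) :=
    ⟨0, _, 0, c₂, ⟨hl, Or.inl ⟨rfl, rfl⟩⟩, hb.procEdit_of_sim, rfl, rfl⟩
  have h'' := h'.derives
  generalize ha : (0 : ℕ) = a at h''
  generalize ham S.conds T.conds + c₂ = c at h'' ⊢
  clear h' hl hb
  induction h'' with
  | refl => exact .refl _
  | comp => omega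
  | code _ hr ih => exact (ih ha).step hr

end Edit

/-! ### Optimal code changes of procedures and systems -/

/-- The required actions are executed in the situations of `V`. -/
def Right {m k : ℕ} (R : Requirements m k) (f : Situation m → Fin k) (V : List (Situation m)) :
    Prop := ∀ r ∈ R, r.1 ∈ V → f r.1 = r.2

section Right

variable {m k : ℕ} {R : Requirements m k} {f g : Situation m → Fin k} {V W : List (Situation m)}

theorem Right.mono (h : Right R f V) (hs : W ⊆ V) : Right R f W := fun r hr hV => h r hr (hs hV)

theorem Right.congr (h : Right R f V) (e : ∀ s ∈ V, g s = f s) : Right R g V := fun r hr hV =>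
  (e _ hV).trans (h r hr hV)

theorem right_allSits_iff {S : SoftSystem m k} : Right R S.exec (allSits m) ↔ S.Satisfies R :=
  ⟨fun h r hr => h r hr (mem_allSits _), fun h r hr _ => h r hr⟩

theorem right_filter_iff {P : Situation m → Prop} [DecidablePred P] :
    Right R f V ↔ Right R f (V.filter fun s => P s) ∧ Right R f (V.filter fun s => ¬ P s) := by
  refine ⟨fun h => ⟨h.mono List.filter_sublist.subset, h.mono List.filter_sublist.subset⟩,
    fun h r hr hV => ?_⟩
  by_cases hP : P r.1
  · exact h.1 r hr (by simpa using ⟨hV, hP⟩)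
  · exact h.2 r hr (by simpa using ⟨hV, hP⟩)

/-- The first condition splits `V` into situations governed by the first body and situations
governed by the rest. The interpretation `F` of bodies makes this usable on both levels: a body is
an action or a procedure. -/
theorem right_cons_iff {α : Type} {F : α → Situation m → Fin k} {l : Literal m} {b o : α}
    {bs : List (Literal m × α)} :
    Right R (fun s => F (Block.runAux s o ((l, b) :: bs)) s) V ↔
      Right R (F b) (V.filter fun s => l.holds s = true) ∧
      Right R (fun s => F (Block.runAux s o bs) s) (V.filter fun s => ¬ l.holds s = true) := by
  rw [right_filter_iff (P := fun s => l.holds s = true)]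
  refine and_congr ⟨fun h => h.congr fun s hs => ?_, fun h => h.congr fun s hs => ?_⟩
    ⟨fun h => h.congr fun s hs => ?_, fun h => h.congr fun s hs => ?_⟩ <;>
  · simp only [List.mem_filter, decide_eq_true_eq] at hs
    simp [Block.runAux, hs.2]

end Right

section fixes

variable {m k : ℕ} {R : Requirements m k}

/-- The number of code changes needed to transform `p` into `p'`. -/
noncomputable def Block.dist {α : Type} (p p' : Block m α) : ℕ :=
  ham p.conds p'.conds + ham p.bodies p'.bodies

/-- The item `i` contains the branches at one position of several source procedures. All of them are
turned into the same branch, so their costs are added. -/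
noncomputable def fixBody (R : Requirements m k) (i : List (Literal m × Fin k)) (l : Literal m)
    (V : List (Situation m)) : List (ℕ × Fin k) :=
  open Classical in
  ((List.finRange k).filter fun a => Right R (fun _ => a) V).map fun a =>
    ((i.map fun e => neq e.1 l + neq e.2 a).sum, a)

noncomputable def fixFin (R : Requirements m k) (os : List (Fin k)) (V : List (Situation m)) :
    List (ℕ × Fin k) :=
  open Classical in
  ((List.finRange k).filter fun a => Right R (fun _ => a) V).map fun a =>
    ((os.map fun o => neq o a).sum, a)

theorem mem_fixBody {i : List (Literal m × Fin k)} {l : Literal m} {V : List (Situation m)} {n : ℕ}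
    {a : Fin k} : (n, a) ∈ fixBody R i l V ↔ Right R (fun _ => a) V ∧
      n = (i.map fun e => neq e.1 l + neq e.2 a).sum := by
  simp only [fixBody, List.mem_map, List.mem_filter, List.mem_finRange, true_and, Prod.mk.injEq,
    decide_eq_true_eq]
  constructor
  · rintro ⟨a, h, rfl, rfl⟩
    exact ⟨h, rfl⟩
  · rintro ⟨h, rfl⟩
    exact ⟨a, h, rfl, rfl⟩

theorem mem_fixFin {os : List (Fin k)} {V : List (Situation m)} {n : ℕ} {a : Fin k} :
    (n, a) ∈ fixFin R os V ↔ Right R (fun _ => a) V ∧ n = (os.map fun o => neq o a).sum := by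
  simp only [fixFin, List.mem_map, List.mem_filter, List.mem_finRange, true_and, Prod.mk.injEq,
    decide_eq_true_eq]
  constructor
  · rintro ⟨a, h, rfl, rfl⟩
    exact ⟨h, rfl⟩
  · rintro ⟨h, rfl⟩
    exact ⟨a, h, rfl, rfl⟩

noncomputable def itemCost (items : List (List (Literal m × Fin k)))
    (bs : List (Literal m × Fin k)) : ℕ :=
  ((items.zip bs).map fun e => (e.1.map fun f => neq f.1 e.2.1 + neq f.2 e.2.2).sum).sum

/-- Being right splits at the first branch by `right_cons_iff`, and the cost splits likewise,
position by position. -/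
theorem blockRun_fix_iff {items : List (List (Literal m × Fin k))} {os : List (Fin k)}
    {V : List (Situation m)} {n : ℕ} {bs : List (Literal m × Fin k)} {o : Fin k} :
    BlockRun (fixBody R) (fixFin R os) items V n bs o ↔ bs.length = items.length ∧
      Right R (fun s => Block.runAux s o bs) V ∧
      n = itemCost items bs + (os.map fun o' => neq o' o).sum := by
  induction items generalizing V n bs with
  | nil =>
    simp only [BlockRun, mem_fixFin, List.length_nil, List.length_eq_zero_iff]
    refine and_congr_right ?_
    rintro rfl
    simp [Block.runAux, itemCost]
  | cons i is ih =>
    simp only [BlockRun, mem_fixBody, ih]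
    constructor
    · rintro ⟨l, b, bs, n₁, n₂, rfl, rfl, ⟨h, rfl⟩, hl, hr, rfl⟩
      refine ⟨by simp [hl], (right_cons_iff (F := fun a _ => a)).2 ⟨h, hr⟩, ?_⟩
      simp [itemCost, add_assoc]
    · rintro ⟨hl, hr, rfl⟩
      rcases bs with _ | ⟨⟨l, b⟩, bs⟩
      · simp at hl
      · obtain ⟨h, hr⟩ := (right_cons_iff (F := fun a _ => a)).1 hr
        exact ⟨l, b, bs, _, _, rfl, by simp [itemCost, add_assoc], ⟨h, rfl⟩, by simpa using hl, hr,
          rfl⟩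

/-- The branches with the same number in several procedures of length `J`. -/
def rows (J : ℕ) (srcs : List (Procedure m k)) : List (List (Literal m × Fin k)) :=
  (List.range J).map fun j => srcs.flatMap fun p => (p.branches.drop j).head?.toList

theorem itemCost_append (f g : ℕ → List (Literal m × Fin k)) (r : List ℕ)
    (bs : List (Literal m × Fin k)) : itemCost (r.map fun j => f j ++ g j) bs =
      itemCost (r.map f) bs + itemCost (r.map g) bs := by
  induction r generalizing bs with
  | nil => rfl
  | cons j r ih =>
    rcases bs with _ | ⟨b, bs⟩
    · rfl
    · have := ih bs
      simp only [itemCost, List.map_cons, List.zip_cons_cons, List.sum_cons, List.map_append,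
        List.sum_append] at this ⊢
      omega

theorem itemCost_singletons (l l' : List (Literal m × Fin k)) :
    itemCost (l.map fun e => [e]) l' = ham (l.map Prod.fst) (l'.map Prod.fst) +
      ham (l.map Prod.snd) (l'.map Prod.snd) := by
  induction l generalizing l' with
  | nil => rfl
  | cons e l ih =>
    rcases l' with _ | ⟨b, bs⟩
    · simp [itemCost, ham]
    · have := ih bs
      simp only [itemCost] at this
      simp only [itemCost, List.map_cons, List.zip_cons_cons, List.sum_cons, ham_cons, this,
        List.map_nil, List.sum_nil]
      omega

theorem rows_singleton (p : Procedure m k) :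
    (List.range p.branches.length).map (fun j => (p.branches.drop j).head?.toList) =
      p.branches.map fun e => [e] := by
  refine List.ext_getElem (by simp) fun i h1 h2 => ?_
  have : i < p.branches.length := by simpa using h1
  simp [List.head?_drop, this]

/-- Double counting: the changes are summed by positions on one side and by source procedures on the
other. Each source contributes one entry to every row. -/
theorem itemCost_rows {J : ℕ} {srcs : List (Procedure m k)} {p' : Procedure m k}
    (h : ∀ p ∈ srcs, p.branches.length = J) (h' : p'.branches.length = J) :
    itemCost (rows J srcs) p'.branches + ((srcs.map Block.otherwise).map fun o =>
      neq o p'.otherwise).sum = (srcs.map fun p => p.dist p').sum := by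
  induction srcs with
  | nil =>
    have : ∀ (r : List ℕ) (bs : List (Literal m × Fin k)), itemCost (r.map fun _ => []) bs = 0 := by
      intro r
      induction r with
      | nil => intro _; rfl
      | cons j r ih =>
        intro bs
        rcases bs with _ | ⟨b, bs⟩
        · rfl
        · simpa [itemCost] using ih bs
    exact this _ _
  | cons p srcs ih =>
    have ih := ih fun q hq => h q (by simp [hq])
    have hp := h p (by simp)
    have e : itemCost (rows J (p :: srcs)) p'.branches =
        ham p.conds p'.conds + ham (p.branches.map Prod.snd) (p'.branches.map Prod.snd) +
          itemCost (rows J srcs) p'.branches := by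
      simp only [rows, List.flatMap_cons]
      rw [itemCost_append, ← hp, rows_singleton, itemCost_singletons]
      rfl
    have e' : p.dist p' = ham p.conds p'.conds + (ham (p.branches.map Prod.snd)
        (p'.branches.map Prod.snd) + neq p.otherwise p'.otherwise) := by
      rw [Block.dist, Block.bodies, Block.bodies, ham_append (by simp [hp, h'])]
      simp
    simp only [List.map_cons, List.sum_cons, e, e', ← ih]
    omega

/-- Procedures with `J` conditions that are right in `V`, with the total number of code changes
that transform the procedures in `srcs` into this procedure; one procedure for each number. -/
noncomputable def fixMulti (R : Requirements m k) (J : ℕ) (srcs : List (Procedure m k))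
    (V : List (Situation m)) : List (ℕ × Procedure m k) :=
  if ∀ p ∈ srcs, p.branches.length = J then
    (blockDP (fixBody R) (fixFin R (srcs.map Block.otherwise)) (rows J srcs) V).map fun e =>
      (e.1, ⟨e.2.1, e.2.2⟩)
  else []

theorem of_mem_fixMulti {J : ℕ} {srcs : List (Procedure m k)} {V : List (Situation m)} {n : ℕ}
    {p' : Procedure m k} (h : (n, p') ∈ fixMulti R J srcs V) :
    (∀ p ∈ srcs, p.branches.length = J) ∧ p'.branches.length = J ∧ Right R p'.run V ∧
      n = (srcs.map fun p => p.dist p').sum := by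
  rw [fixMulti] at h
  split_ifs at h with hs
  · obtain ⟨⟨n, bs, o⟩, he, h⟩ := List.mem_map.1 h
    simp only [Prod.mk.injEq] at h
    obtain ⟨rfl, rfl⟩ := h
    obtain ⟨hl, hr, rfl⟩ := blockRun_fix_iff.1 (blockRun_of_mem_blockDP he)
    have hl' : bs.length = J := by simpa [rows] using hl
    exact ⟨hs, hl', hr, itemCost_rows hs (p' := ⟨bs, o⟩) hl'⟩
  · simp at h

theorem exists_mem_fixMulti {J : ℕ} {srcs : List (Procedure m k)} {V : List (Situation m)}
    {p' : Procedure m k} (hs : ∀ p ∈ srcs, p.branches.length = J) (hl : p'.branches.length = J)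
    (hr : Right R p'.run V) :
    ∃ q, ((srcs.map fun p => p.dist p').sum, q) ∈ fixMulti R J srcs V := by
  rw [fixMulti, if_pos hs]
  obtain ⟨bs, o, h⟩ := exists_mem_blockDP (blockRun_fix_iff.2 ⟨by simpa [rows] using hl, hr,
    (itemCost_rows hs hl).symm⟩)
  exact ⟨_, List.mem_map.2 ⟨_, h, rfl⟩⟩

/-- The numbers of code changes that make the procedure `p` right in `V`, with one result for each
of these numbers. -/
noncomputable def fixes (R : Requirements m k) (p : Procedure m k) (V : List (Situation m)) :
    List (ℕ × Procedure m k) :=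
  fixMulti R p.branches.length [p] V

theorem of_mem_fixes {p p' : Procedure m k} {V : List (Situation m)} {n : ℕ}
    (h : (n, p') ∈ fixes R p V) : Sim p p' n ∧ Right R p'.run V := by
  obtain ⟨-, h1, h2, h3⟩ := of_mem_fixMulti h
  exact ⟨⟨by simp [Block.conds, h1], by simpa [Block.dist] using h3⟩, h2⟩

theorem exists_mem_fixes {p p' : Procedure m k} {V : List (Situation m)} {n : ℕ}
    (h : Sim p p' n) (h' : Right R p'.run V) : ∃ q, (n, q) ∈ fixes R p V := by
  have := exists_mem_fixMulti (R := R) (J := p.branches.length) (srcs := [p]) (V := V) (p' := p')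
    (by simp) (by simpa [Block.conds] using h.1.symm) h'
  have e : ([p].map fun p => p.dist p').sum = n := by simp [Block.dist, h.2]
  rwa [e] at this

end fixes

/-! ### The dynamic program for both levels of a system. -/

section sysDP

variable {m k : ℕ} {R : Requirements m k}

/-- The chosen candidate is kept next to its repaired version, so that the system before the code
changes can be read off from a run. -/
noncomputable def sysBody (R : Requirements m k) (i : Literal m × List (Procedure m k))
    (l : Literal m) (V : List (Situation m)) : List (ℕ × (Procedure m k × Procedure m k)) :=
  i.2.flatMap fun q => (fixes R q V).map fun e => (neq i.1 l + e.1, (q, e.2))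

noncomputable def sysFin (R : Requirements m k) (P : List (Procedure m k))
    (V : List (Situation m)) : List (ℕ × (Procedure m k × Procedure m k)) :=
  P.flatMap fun q => (fixes R q V).map fun e => (e.1, (q, e.2))

theorem mem_sysBody {i : Literal m × List (Procedure m k)} {l : Literal m} {V : List (Situation m)}
    {n : ℕ} {b : Procedure m k × Procedure m k} : (n, b) ∈ sysBody R i l V ↔
      b.1 ∈ i.2 ∧ ∃ c, (c, b.2) ∈ fixes R b.1 V ∧ n = neq i.1 l + c := by
  simp only [sysBody, List.mem_flatMap, List.mem_map]
  constructor
  · rintro ⟨q, hq, ⟨c, p⟩, hp, h⟩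
    simp only [Prod.mk.injEq] at h
    obtain ⟨rfl, rfl⟩ := h
    exact ⟨hq, c, hp, rfl⟩
  · rintro ⟨hq, c, hp, rfl⟩
    exact ⟨b.1, hq, (c, b.2), hp, rfl⟩

theorem mem_sysFin {P : List (Procedure m k)} {V : List (Situation m)} {n : ℕ}
    {b : Procedure m k × Procedure m k} : (n, b) ∈ sysFin R P V ↔
      b.1 ∈ P ∧ (n, b.2) ∈ fixes R b.1 V := by
  simp only [sysFin, List.mem_flatMap, List.mem_map]
  constructor
  · rintro ⟨q, hq, ⟨c, p⟩, hp, h⟩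
    simp only [Prod.mk.injEq] at h
    obtain ⟨rfl, rfl⟩ := h
    exact ⟨hq, hp⟩
  · rintro ⟨hq, hp⟩
    exact ⟨b.1, hq, (n, b.2), hp, rfl⟩

theorem SumRel.cons_iff {α β : Type} {e : α → β → ℕ → ℕ → Prop} {x : α} {y : β} {xs : List α}
    {ys : List β} {a c : ℕ} : SumRel e (x :: xs) (y :: ys) a c ↔
      ∃ a₁ c₁ a₂ c₂, e x y a₁ c₁ ∧ SumRel e xs ys a₂ c₂ ∧ a = a₁ + a₂ ∧ c = c₁ + c₂ := by
  constructor
  · rintro (_ | ⟨h1, h2⟩)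
    exact ⟨_, _, _, _, h1, h2, rfl, rfl⟩
  · rintro ⟨a₁, c₁, a₂, c₂, h1, h2, rfl, rfl⟩
    exact .cons h1 h2

theorem codeEdit_nil {o o' : Procedure m k} {c : ℕ} (h : Sim o o' c) : CodeEdit ⟨[], o⟩ ⟨[], o'⟩ c :=
  ⟨c + 0, rfl, .cons (a := 0) (a' := 0) ⟨rfl, h⟩ .nil, (Nat.zero_add _).symm⟩

theorem codeEdit_cons_iff {bs bs' : List (Literal m × Procedure m k)} {l l' : Literal m}
    {p p' o o' : Procedure m k} {c : ℕ} :
    CodeEdit ⟨(l, p) :: bs, o⟩ ⟨(l', p') :: bs', o'⟩ c ↔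
      ∃ c₁ c₂, Sim p p' c₁ ∧ CodeEdit ⟨bs, o⟩ ⟨bs', o'⟩ c₂ ∧ c = neq l l' + c₁ + c₂ := by
  simp only [CodeEdit, Block.conds, Block.bodies, List.map_cons, List.length_cons, ham_cons,
    List.cons_append, Nat.add_right_cancel_iff]
  constructor
  · rintro ⟨c₂, hl, h, rfl⟩
    obtain ⟨a, c₁, a', c₂, ⟨rfl, h1⟩, h2, ha, rfl⟩ := SumRel.cons_iff.1 h
    obtain rfl : a' = 0 := by omega
    exact ⟨c₁, _, h1, ⟨c₂, hl, h2, rfl⟩, by omega⟩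
  · rintro ⟨c₁, c₂, h1, ⟨c₃, hl, h2, rfl⟩, rfl⟩
    exact ⟨c₁ + c₃, hl, .cons (a := 0) (a' := 0) ⟨rfl, h1⟩ h2, by omega⟩

theorem CodeEdit.sim {o o' : Procedure m k} {c : ℕ} (h : CodeEdit ⟨[], o⟩ ⟨[], o'⟩ c) :
    Sim o o' c := by
  obtain ⟨c₂, -, h, rfl⟩ := h
  simp only [Block.conds, Block.bodies, List.map_nil, List.nil_append] at h ⊢
  obtain ⟨a, c₁, a', c₂, ⟨rfl, h1⟩, h2, ha, rfl⟩ := SumRel.cons_iff.1 h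
  rcases h2
  simpa using h1

/-- The system `bs₀` consists of the old conditions and the candidates stored in the run. -/
theorem of_blockRun_sys {oP : List (Procedure m k)}
    {items : List (Literal m × List (Procedure m k))} {U : List (Situation m)} {n : ℕ}
    {bs : List (Literal m × (Procedure m k × Procedure m k))} {o : Procedure m k × Procedure m k}
    (h : BlockRun (sysBody R) (sysFin R oP) items U n bs o) :
    ∃ bs₀, bs₀.map Prod.fst = items.map Prod.fst ∧
      List.Forall₂ (· ∈ ·) (bs₀.map Prod.snd) (items.map Prod.snd) ∧ o.1 ∈ oP ∧
      CodeEdit ⟨bs₀, o.1⟩ ⟨bs.map fun b => (b.1, b.2.2), o.2⟩ n ∧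
      Right R (SoftSystem.exec ⟨bs.map fun b => (b.1, b.2.2), o.2⟩) U := by
  induction items generalizing U n bs with
  | nil =>
    obtain ⟨rfl, h⟩ := h
    obtain ⟨h1, h2⟩ := mem_sysFin.1 h
    obtain ⟨h3, h4⟩ := of_mem_fixes h2
    exact ⟨[], rfl, .nil, h1, codeEdit_nil h3, h4⟩
  | cons i is ih =>
    obtain ⟨l, b, bs, n₁, n₂, rfl, rfl, hb, hr⟩ := h
    obtain ⟨bs₀, hc, hm, ho, he, hR⟩ := ih hr
    obtain ⟨h1, c, h2, rfl⟩ := mem_sysBody.1 hb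
    obtain ⟨h3, h4⟩ := of_mem_fixes h2
    exact ⟨(i.1, b.1) :: bs₀, by simp [hc], .cons h1 hm, ho,
      codeEdit_cons_iff.2 ⟨_, _, h3, he, rfl⟩, (right_cons_iff (F := Block.run)).2 ⟨h4, hR⟩⟩

theorem exists_blockRun_sys {oP : List (Procedure m k)}
    {items : List (Literal m × List (Procedure m k))} {U : List (Situation m)} {n : ℕ}
    {bs₀ bs : List (Literal m × Procedure m k)} {o₀ o : Procedure m k}
    (hc : bs₀.map Prod.fst = items.map Prod.fst)
    (hm : List.Forall₂ (· ∈ ·) (bs₀.map Prod.snd) (items.map Prod.snd)) (ho : o₀ ∈ oP)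
    (he : CodeEdit ⟨bs₀, o₀⟩ ⟨bs, o⟩ n) (hR : Right R (SoftSystem.exec ⟨bs, o⟩) U) :
    ∃ bs' o', BlockRun (sysBody R) (sysFin R oP) items U n bs' o' := by
  induction items generalizing U n bs₀ bs with
  | nil =>
    obtain rfl : bs₀ = [] := by simpa using hc
    obtain rfl : bs = [] := by simpa [Block.conds] using he.choose_spec.1.symm
    obtain ⟨q, hq⟩ := exists_mem_fixes he.sim hR
    exact ⟨[], (o₀, q), rfl, mem_sysFin.2 ⟨ho, hq⟩⟩
  | cons i is ih =>
    rcases bs₀ with _ | ⟨⟨l₀, p₀⟩, bs₀⟩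
    · simp at hc
    rcases bs with _ | ⟨⟨l, p⟩, bs⟩
    · simpa [Block.conds] using he.choose_spec.1
    obtain ⟨c₁, c₂, h1, h2, rfl⟩ := codeEdit_cons_iff.1 he
    obtain ⟨hR₁, hR₂⟩ := (right_cons_iff (F := Block.run)).1 hR
    simp only [List.map_cons, List.cons.injEq] at hc
    obtain ⟨rfl, hc⟩ := hc
    rcases hm with _ | ⟨hp, hm⟩
    obtain ⟨bs', o', h⟩ := ih hc hm h2 hR₂
    obtain ⟨q, hq⟩ := exists_mem_fixes h1 hR₁
    exact ⟨_, o', l, (p₀, q), bs', _, c₂, rfl, rfl, mem_sysBody.2 ⟨hp, c₁, hq, rfl⟩, h⟩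

/-- Systems that are right in `U`, with the number of code changes that transform a system
with the conditions and candidates for the procedures in `items` and `oP` into this system. -/
noncomputable def sysDP (R : Requirements m k) (items : List (Literal m × List (Procedure m k)))
    (oP : List (Procedure m k)) (U : List (Situation m)) : List (ℕ × SoftSystem m k) :=
  (blockDP (sysBody R) (sysFin R oP) items U).map fun e =>
    (e.1, ⟨e.2.1.map fun b => (b.1, b.2.2), e.2.2.2⟩)

theorem of_mem_sysDP {items : List (Literal m × List (Procedure m k))} {oP : List (Procedure m k)}
    {U : List (Situation m)} {n : ℕ} {S : SoftSystem m k} (h : (n, S) ∈ sysDP R items oP U) :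
    ∃ S₀ : SoftSystem m k, S₀.conds = items.map Prod.fst ∧
      List.Forall₂ (· ∈ ·) (S₀.branches.map Prod.snd) (items.map Prod.snd) ∧ S₀.otherwise ∈ oP ∧
      CodeEdit S₀ S n ∧ Right R S.exec U := by
  obtain ⟨⟨n, bs, o⟩, he, h⟩ := List.mem_map.1 h
  simp only [Prod.mk.injEq] at h
  obtain ⟨rfl, rfl⟩ := h
  obtain ⟨bs₀, h⟩ := of_blockRun_sys (blockRun_of_mem_blockDP he)
  exact ⟨⟨bs₀, o.1⟩, h⟩

theorem exists_mem_sysDP {items : List (Literal m × List (Procedure m k))}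
    {oP : List (Procedure m k)} {U : List (Situation m)} {n : ℕ}
    {bs : List (Literal m × (Procedure m k × Procedure m k))} {o : Procedure m k × Procedure m k}
    (h : BlockRun (sysBody R) (sysFin R oP) items U n bs o) : ∃ S, (n, S) ∈ sysDP R items oP U := by
  obtain ⟨bs', o', h⟩ := exists_mem_blockDP h
  exact ⟨_, List.mem_map.2 ⟨_, h, rfl⟩⟩

end sysDP

/-! ### Computing optimal code changes. -/

section

variable {X : Type} [Scale X] {β : X → Type} [∀ x, Enc (β x)] {c : X → Val} {m k : X → ℕ}
  {R : ∀ x, Requirements (m x) (k x)} {V : ∀ x, List (Situation (m x))}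

theorem FPD.right {f : ∀ x, Situation (m x) → Fin (k x)} (hR : FP c R) (hV : FP c V)
    (hf : FP (ext c) (fun z : Σ x, {y // y ∈ R x} => z.2.1.1) →
      FP (ext c) fun z : Σ x, {y // y ∈ R x} => f z.1 z.2.1.1) :
    FPD c fun x => Right (R x) (f x) (V x) :=
  FPD.ball hR fun hr => (FPD.mem hr.fst hV.wk).imp (FPD.eq (hf hr.fst) hr.snd)

namespace FP

theorem neq [∀ x, LawfulEnc (β x)] {a b : ∀ x, β x} (ha : FP c a) (hb : FP c b) :
    FP c fun x => neq (a x) (b x) :=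
  FP.ite (FPD.eq ha hb) (const 0) (const 1)

theorem fixBody {i : ∀ x, List (Literal (m x) × Fin (k x))} {l : ∀ x, Literal (m x)} (hk : FP c k)
    (hR : FP c R) (hi : FP c i) (hl : FP c l) (hV : FP c V) :
    FP c fun x => fixBody (R x) (i x) (l x) (V x) :=
  (hk.finRange.filter (inst := fun _ _ => Classical.propDecidable _)
    fun ha => FPD.right hR.wk hV.wk fun _ => ha.wk).map fun ha =>
    (hi.wk.map fun he => (he.fst.neq hl.wk.wk).add (he.snd.neq ha.wk)).sum.pair ha

theorem fixFin {os : ∀ x, List (Fin (k x))} (hk : FP c k) (hR : FP c R) (ho : FP c os)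
    (hV : FP c V) : FP c fun x => fixFin (R x) (os x) (V x) :=
  (hk.finRange.filter (inst := fun _ _ => Classical.propDecidable _)
    fun ha => FPD.right hR.wk hV.wk fun _ => ha.wk).map fun ha =>
    (ho.wk.map fun he => he.neq ha.wk).sum.pair ha

theorem rows {J : X → ℕ} {srcs : ∀ x, List (Procedure (m x) (k x))} (hJ : FP c J)
    (hs : FP c srcs) : FP c fun x => rows (J x) (srcs x) :=
  hJ.range.map fun hj => hs.wk.flatMap fun hp => ((hj.wk.drop hp.branches).head?.elim
    (f := fun _ y => [y]) nil fun hy => hy.cons nil).congr fun z => by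
      cases (z.2.1.branches.drop z.1.2.1).head? <;> rfl

theorem fixMulti {J : X → ℕ} {srcs : ∀ x, List (Procedure (m x) (k x))} (hm : FP c m)
    (hp : ∀ x, m x = Scale.par x) (hk : FP c k) (hR : FP c R) (hJ : FP c J) (hs : FP c srcs)
    (hV : FP c V) (hVs : ∀ x, (V x).Sublist (_root_.allSits (m x))) :
    FP c fun x => fixMulti (R x) (J x) (srcs x) (V x) :=
  FP.ite (FPD.ball hs fun hy => FPD.eq hy.branches.length hJ.wk)
    ((FP.blockDP hm hp (hJ.rows hs) hV hVs
      (fun _ _ _ _ _ hi hl hV => FP.fixBody hk.wk hR.wk hi hl hV)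
      fun _ _ hV => FP.fixFin hk.wk hR.wk
        (hs.map (f := fun _ y => y.otherwise) fun hy => hy.otherwise).wk hV).map fun he =>
      he.fst.pair (he.snd.fst.block he.snd.snd)) nil

theorem fixes {p : ∀ x, Procedure (m x) (k x)} (hm : FP c m) (hp : ∀ x, m x = Scale.par x)
    (hk : FP c k) (hR : FP c R) (hq : FP c p) (hV : FP c V)
    (hVs : ∀ x, (V x).Sublist (_root_.allSits (m x))) : FP c fun x => fixes (R x) (p x) (V x) :=
  FP.fixMulti hm hp hk hR hq.branches.length (hq.cons nil) hV hVs

theorem sysDP {items : ∀ x, List (Literal (m x) × List (Procedure (m x) (k x)))}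
    {oP : ∀ x, List (Procedure (m x) (k x))} (hm : FP c m) (hp : ∀ x, m x = Scale.par x)
    (hk : FP c k) (hR : FP c R) (hi : FP c items) (ho : FP c oP) (hV : FP c V)
    (hVs : ∀ x, (V x).Sublist (_root_.allSits (m x))) :
    FP c fun x => sysDP (R x) (items x) (oP x) (V x) :=
  (FP.blockDP hm hp hi hV hVs
    (fun _ _ _ _ hVs hi hl hV => hi.snd.flatMap fun hq =>
      (FP.fixes hm.wk.wk (fun _ => hp _) hk.wk.wk hR.wk.wk hq hV.wk fun _ => hVs _).map fun he =>
        ((hi.fst.neq hl).wk.wk.add he.fst).pair (hq.wk.pair he.snd))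
    fun _ hVs hV => ho.wk.flatMap fun hq =>
      (FP.fixes hm.wk.wk (fun _ => hp _) hk.wk.wk hR.wk.wk hq hV.wk fun _ => hVs _).map fun he =>
        he.fst.pair (hq.wk.pair he.snd)).map fun he =>
    he.fst.pair ((he.snd.fst.map fun hb => hb.fst.pair hb.snd.snd).block he.snd.snd.snd)

end FP

end

/-! ### Reading the input, and selecting a solution -/

/-- The first solution the cost of which obeys the bound. -/
noncomputable def pick {α : Type} (l : List (ℕ × α)) (d : Option Bin) : Option α :=
  open Classical in ((l.filter fun e => LeOpt e.1 d).map Prod.snd).head?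

theorem mem_of_pick_eq_some {α : Type} {l : List (ℕ × α)} {d : Option Bin} {a : α}
    (h : pick l d = some a) : ∃ n, (n, a) ∈ l ∧ LeOpt n d := by
  obtain ⟨⟨n, a⟩, he, rfl⟩ := List.mem_map.1 (List.mem_of_head? h)
  exact ⟨n, by simpa using he⟩

theorem not_mem_of_pick_eq_none {α : Type} {l : List (ℕ × α)} {d : Option Bin}
    (h : pick l d = none) (n : ℕ) (a : α) (hm : (n, a) ∈ l) : ¬ LeOpt n d := by
  rw [pick, List.head?_eq_none_iff, List.map_eq_nil_iff, List.filter_eq_nil_iff] at h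
  simpa using h _ hm

theorem FP.pick {X : Type} [Scale X] {β : X → Type} [∀ x, Enc (β x)] {c : X → Val}
    {l : ∀ x, List (ℕ × β x)} {d : X → Option Bin} (hl : FP c l) (hd : FP c d) :
    FP c fun x => pick (l x) (d x) :=
  ((hl.filter (inst := fun _ _ => Classical.propDecidable _)
    fun he => FPD.leOpt he.fst hd.wk).map fun he => he.snd).head?

/-- Reading an entry of the tuple that codes the input. -/
theorem FP.entry {X : Type} [Scale X] {β : X → Type} [∀ x, Enc (β x)] {c : X → Val}
    {t : ∀ x, β x} (n : ℕ) (h : ∀ x, enc (t x) = (Val.tl^[n] (c x)).hd)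
    (hs : ∀ x, (c x).size ≤ Scale.size x) : FP c t := by
  have htl : ∀ v : Val, v.tl.size ≤ v.size := fun v => by cases v <;> simp [Val.tl, Val.size]; omega
  have hhd : ∀ v : Val, v.hd.size ≤ v.size := fun v => by cases v <;> simp [Val.hd, Val.size]; omega
  have h1 : Comp c (fun x => Val.tl^[n] (c x)) ∧ ∀ x, (Val.tl^[n] (c x)).size ≤ (c x).size := by
    clear h
    induction n with
    | zero => exact ⟨Comp.self c, fun _ => le_rfl⟩
    | succ n ih =>
      simp only [Function.iterate_succ_apply']
      exact ⟨ih.1.tl, fun x => (htl _).trans (ih.2 x)⟩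
  simp only [FP, h]
  exact ⟨h1.1.hd, Bdd.scale.mono fun x => (hhd _).trans ((h1.2 x).trans (hs x))⟩

/-! ### Reconfiguration relative to a specification -/

section

variable {m k : ℕ}

theorem SumRel.exists_of_mem {α β : Type} {e : α → β → ℕ → ℕ → Prop} {xs : List α} {ys : List β}
    {a c : ℕ} (h : SumRel e xs ys a c) {y : β} (hy : y ∈ ys) :
    ∃ x ∈ xs, ∃ a' c', e x y a' c' := by
  induction h with
  | nil => simp at hy
  | cons h _ ih =>
    rcases List.mem_cons.1 hy with rfl | hy
    · exact ⟨_, by simp, _, _, h⟩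
    · obtain ⟨x, hx, h⟩ := ih hy
      exact ⟨x, by simp [hx], h⟩

/-- Code changes never alter a number of conditions, so the two size bounds are inherited. -/
theorem CodeEdit.consistent {S T : SoftSystem m k} {c a b : ℕ} (h : CodeEdit S T c)
    (hS : S.Consistent a b) : T.Consistent a b := by
  obtain ⟨c₂, hl, hb, -⟩ := h
  refine ⟨hl ▸ hS.1, fun p hp => ?_⟩
  obtain ⟨q, hq, _, _, -, h⟩ := hb.exists_of_mem hp
  exact h.1 ▸ hS.2 q hq

/-- Systems that satisfy `R`, with the number of code changes that transform `S` into them. -/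
noncomputable def codeFixes (R : Requirements m k) (S : SoftSystem m k) :
    List (ℕ × SoftSystem m k) :=
  sysDP R (S.branches.map fun e => (e.1, [e.2])) [S.otherwise] (allSits m)

theorem of_mem_codeFixes {R : Requirements m k} {S T : SoftSystem m k} {n : ℕ}
    (h : (n, T) ∈ codeFixes R S) : CodeEdit S T n ∧ T.Satisfies R := by
  obtain ⟨S₀, hc, hb, ho, he, hr⟩ := of_mem_sysDP h
  -- Each slot has just one candidate, so there is only one system from which the code changes can
  -- start.
  have : S₀ = S := by
    refine Block.ext_conds_bodies (by rw [hc, List.map_map]; rfl) ?_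
    rw [Block.bodies, Block.bodies, List.mem_singleton.1 ho]
    congr 1
    rw [List.map_map, List.forall₂_map_right_iff] at hb
    simp only [Function.comp_def, List.mem_singleton] at hb
    rw [← List.forall₂_eq_eq_eq, List.forall₂_map_right_iff]
    exact hb
  exact ⟨this ▸ he, right_allSits_iff.1 hr⟩

theorem exists_mem_codeFixes {R : Requirements m k} {S T : SoftSystem m k} {n : ℕ}
    (h : CodeEdit S T n) (hr : T.Satisfies R) : ∃ T', (n, T') ∈ codeFixes R S := by
  obtain ⟨bs, o, h⟩ := exists_blockRun_sys (R := R) (U := allSits m) (oP := [S.otherwise])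
    (items := S.branches.map fun e => (e.1, [e.2])) (by simp) (by
      rw [List.map_map, List.forall₂_map_right_iff, List.forall₂_map_left_iff, List.forall₂_same]
      simp) (by simp) h (right_allSits_iff.2 hr)
  exact exists_mem_sysDP h

end

instance : Scale SRecSpec.Inst where
  par := SRecSpecInput.nI
  size x := (SRecSpec.codeInst x).size
  size_pos _ := Val.size_pos _

instance (x : SRecSpec.Inst) : Enc (SRecSpec.Out x) := inferInstanceAs (Enc (SoftSystem x.nI x.nA))

theorem SRecSpec.fpTractable : SRecSpec.FPTractable (fun x : SRecSpecInput => x.nI) := by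
  refine SearchProblem.FPTractable.of_FP (fun _ => rfl) (fun _ => rfl) (fun _ _ => rfl)
    (fun x : SRecSpecInput => pick (codeFixes (x.R ++ x.Rnew) x.S) (some ⟨x.cc⟩)) ?_ ?_ ?_
  · have hm : FP (fun x : {x // SRecSpec.Valid x} => SRecSpec.codeInst x.1)
      (fun x => x.1.nI) := FP.entry 0 (fun _ => rfl) fun _ => le_rfl
    have hk : FP (fun x : {x // SRecSpec.Valid x} => SRecSpec.codeInst x.1)
      (fun x => x.1.nA) := FP.entry 1 (fun _ => rfl) fun _ => le_rfl
    have hR : FP (fun x : {x // SRecSpec.Valid x} => SRecSpec.codeInst x.1)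
      (fun x => x.1.R) := FP.entry 2 (fun _ => rfl) fun _ => le_rfl
    have hS : FP (fun x : {x // SRecSpec.Valid x} => SRecSpec.codeInst x.1)
      (fun x => x.1.S) := FP.entry 3 (fun _ => rfl) fun _ => le_rfl
    have hN : FP (fun x : {x // SRecSpec.Valid x} => SRecSpec.codeInst x.1)
      (fun x => x.1.Rnew) := FP.entry 6 (fun _ => rfl) fun _ => le_rfl
    have hc : FP (fun x : {x // SRecSpec.Valid x} => SRecSpec.codeInst x.1)
      (fun x => (⟨x.1.cc⟩ : Bin)) := FP.entry 7 (fun _ => rfl) fun _ => le_rfl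
    exact (FP.sysDP hm (fun _ => rfl) hk (hR.append hN)
      (hS.branches.map fun he => he.fst.pair (he.snd.cons FP.nil)) (hS.otherwise.cons FP.nil)
      (FP.allSits hm fun _ => rfl) fun _ => List.Sublist.refl _).pick hc.some
  · intro x hx y hy
    obtain ⟨n, hn, hb⟩ := mem_of_pick_eq_some hy
    obtain ⟨he, hr⟩ := of_mem_codeFixes hn
    exact ⟨⟨n, hb _ rfl, he.codeDerives⟩, he.consistent hx.2, hr⟩
  · rintro x hx hn y ⟨⟨c, hc, h⟩, -, hr⟩
    obtain ⟨c', hc', he⟩ := h.codeEdit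
    obtain ⟨T, hT⟩ := exists_mem_codeFixes he hr
    exact not_mem_of_pick_eq_none hn _ _ hT fun b hb => by
      obtain rfl := Option.mem_some_iff.1 hb
      exact hc'.trans hc

/-! ### Repeated conditions are redundant -/

section

variable {m k : ℕ} {α : Type}

theorem runAux_filter_ne {s : Situation m} {l : Literal m} (h : ¬ l.holds s = true) (o : α)
    [DecidableEq (Literal m)] (bs : List (Literal m × α)) :
    Block.runAux s o (bs.filter fun e => e.1 ≠ l) = Block.runAux s o bs := by
  induction bs with
  | nil => rfl
  | cons e bs ih =>
    by_cases he : e.1 = l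
    · rw [List.filter_cons_of_neg (by simpa using he), ih, Block.runAux, if_neg (by rwa [he])]
    · rw [List.filter_cons_of_pos (by simpa using he), Block.runAux, Block.runAux, ih]

/-- A condition that has failed fails again further down, so later copies can be deleted. -/
theorem exists_nodup_runAux_eq (bs : List (Literal m × α)) : ∃ es : List (Literal m × α),
    es.Sublist bs ∧ (es.map Prod.fst).Nodup ∧
      ∀ s o, Block.runAux s o es = Block.runAux s o bs := by
  classical
  induction bs with
  | nil => exact ⟨[], List.Sublist.refl _, by simp, fun _ _ => rfl⟩
  | cons e bs ih =>
    obtain ⟨es, hs, hn, hr⟩ := ih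
    refine ⟨e :: es.filter fun f => f.1 ≠ e.1, (List.filter_sublist.trans hs).cons_cons e, ?_,
      fun s o => ?_⟩
    · rw [List.map_cons, List.nodup_cons]
      exact ⟨by simp, hn.sublist (List.filter_sublist.map _)⟩
    · by_cases h : e.1.holds s = true
      · simp [Block.runAux, h]
      · rw [Block.runAux, Block.runAux, runAux_filter_ne h, hr]

theorem length_le_of_nodup {l : List (Literal m)} (h : l.Nodup) : l.length ≤ 2 * m :=
  length_allLits m ▸ (h.subperm fun a _ => mem_allLits a).length_le

/-- A block with at most `2 * m` conditions. -/
theorem Block.exists_short (b : Block m α) : ∃ b' : Block m α, b'.branches.Sublist b.branches ∧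
    b'.conds.length ≤ 2 * m ∧ b'.otherwise = b.otherwise ∧ ∀ s, b'.run s = b.run s := by
  obtain ⟨es, hs, hn, hr⟩ := exists_nodup_runAux_eq b.branches
  exact ⟨⟨es, b.otherwise⟩, hs, length_le_of_nodup hn, rfl, fun s => hr s _⟩

theorem ham_append_drop_le (xs pre : List α) :
    ham xs (pre ++ xs.drop pre.length) ≤ pre.length := by
  induction pre generalizing xs with
  | nil => simp
  | cons a pre ih =>
    rcases xs with _ | ⟨b, xs⟩
    · simp
    · have := ih xs
      have := neq_le_one b a
      simp only [List.cons_append, List.length_cons, List.drop_succ_cons, ham_cons]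
      omega

/-- One of two complementary conditions holds in every situation, so the branches below them are
unreachable. -/
theorem runAux_append_pair (s : Situation m) (a o : α) (v : Fin m)
    (es bs : List (Literal m × α)) :
    Block.runAux s o (es ++ (⟨v, false⟩, a) :: (⟨v, true⟩, a) :: bs) = Block.runAux s a es := by
  induction es with
  | nil => cases h : s v <;> simp [Block.runAux, Literal.holds, h]
  | cons e es ih => simp [Block.runAux, ih]

/-- A procedure can be made right in `V` by few code changes, unless this is impossible. -/
theorem exists_cheap_fix {R : Requirements m k} {p p' : Procedure m k} {V : List (Situation m)}
    {c : ℕ} (h : Sim p p' c) (hr : Right R p'.run V) :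
    ∃ q c', c' ≤ c ∧ c' < 4 * m + 5 ∧ Sim p q c' ∧ Right R q.run V := by
  by_cases hc : c < 4 * m + 5
  · exact ⟨p', c, le_rfl, hc, h, hr⟩
  obtain ⟨hl, hd⟩ := h
  have h1 := ham_le p.conds p'.conds
  have h2 := ham_le p.bodies p'.bodies
  have h3 := p.length_bodies
  obtain ⟨⟨es, o⟩, -, hes, ho, hrun⟩ := p'.exists_short
  simp only at ho
  subst ho
  -- A procedure without conditions cannot need that many changes, so `p` has a condition and there
  -- is a variable.
  obtain ⟨v⟩ : Nonempty (Fin m) := by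
    rcases hp : p.conds with _ | ⟨l, ls⟩
    · have : p.conds.length = 0 := by rw [hp, List.length_nil]
      omega
    · exact ⟨l.var⟩
  have hes' : es.length ≤ 2 * m := by simpa [Block.conds] using hes
  -- A short version of `p'` is written over the top of `p` and sealed by a complementary pair of
  -- conditions. At most `2 * m + 2` conditions and as many actions change, which gives at most `4 *
  -- m + 4` changes.
  set pre := es ++ [(⟨v, false⟩, p'.otherwise), (⟨v, true⟩, p'.otherwise)] with hpre
  have hpl : pre.length = es.length + 2 := by simp [hpre]
  -- The cost `c ≥ 4 * m + 5` is at most twice the number of conditions plus one, so `p` has at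
  -- least `2 * m + 2` conditions.
  have hpb : pre.length ≤ p.branches.length := by
    rw [hpl, ← Block.length_conds]
    omega
  have e1 : (⟨pre ++ p.branches.drop pre.length, p.otherwise⟩ : Procedure m k).conds =
      pre.map Prod.fst ++ p.conds.drop (pre.map Prod.fst).length := by
    simp [Block.conds]
  have e2 : (⟨pre ++ p.branches.drop pre.length, p.otherwise⟩ : Procedure m k).bodies =
      pre.map Prod.snd ++ p.bodies.drop (pre.map Prod.snd).length := by
    simp only [Block.bodies, List.map_append, List.map_drop, List.append_assoc, List.length_map]
    rw [List.drop_append_of_le_length (by simpa using hpb)]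
  refine ⟨⟨pre ++ p.branches.drop pre.length, p.otherwise⟩, _, ?_, ?_, ⟨?_, rfl⟩, ?_⟩
  · have k1 := ham_append_drop_le p.conds (pre.map Prod.fst)
    have k2 := ham_append_drop_le p.bodies (pre.map Prod.snd)
    rw [e1, e2]
    simp only [List.length_map] at k1 k2 ⊢
    omega
  · have k1 := ham_append_drop_le p.conds (pre.map Prod.fst)
    have k2 := ham_append_drop_le p.bodies (pre.map Prod.snd)
    rw [e1, e2]
    simp only [List.length_map] at k1 k2 ⊢
    omega
  · simp only [Block.length_conds, List.length_append, List.length_drop]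
    omega
  · refine hr.congr fun s _ => ?_
    rw [← hrun]
    simp only [Block.run, hpre, List.append_assoc, List.cons_append, List.nil_append]
    exact runAux_append_pair s _ _ v _ _

end

/-! ### Creation of adaptable systems from libraries -/

/-- The conditions of the run are retained, so every branch receives the same situations as before,
and its option can be exchanged for one that costs no more. -/
theorem BlockRun.mono {m : ℕ} {ι ι' β β' γ γ' : Type}
    {body : ι → Literal m → List (Situation m) → List (ℕ × β)}
    {fin : List (Situation m) → List (ℕ × γ)}
    {body' : ι' → Literal m → List (Situation m) → List (ℕ × β')}
    {fin' : List (Situation m) → List (ℕ × γ')} {items : List ι} {items' : List ι'}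
    {U : List (Situation m)} {n : ℕ} {bs : List (Literal m × β)} {o : γ}
    (h : BlockRun body fin items U n bs o) (hU : U.Sublist (allSits m))
    (hb : List.Forall₂ (fun i i' => ∀ l V, V.Sublist (allSits m) → ∀ n b, (n, b) ∈ body i l V →
      ∃ n' ≤ n, ∃ b', (n', b') ∈ body' i' l V) items items')
    (hf : ∀ V, V.Sublist (allSits m) → ∀ n o, (n, o) ∈ fin V → ∃ n' ≤ n, ∃ o', (n', o') ∈ fin' V) :
    ∃ n' ≤ n, ∃ bs' o', BlockRun body' fin' items' U n' bs' o' := by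
  induction hb generalizing U n bs with
  | nil =>
    obtain ⟨rfl, h⟩ := h
    obtain ⟨n', hn, o', h⟩ := hf U hU n o h
    exact ⟨n', hn, [], o', rfl, h⟩
  | cons hi _ ih =>
    obtain ⟨l, b, bs, n₁, n₂, rfl, rfl, hb, hr⟩ := h
    obtain ⟨n₁', h1, b', hb'⟩ := hi l _ (List.filter_sublist.trans hU) _ _ hb
    obtain ⟨n₂', h2, bs', o', h'⟩ := ih hr (List.filter_sublist.trans hU)
    exact ⟨n₁' + n₂', by omega, _, o', l, b', bs', n₁', n₂', rfl, rfl, hb', h'⟩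

theorem ncard_le_length {α : Type} {s : Set α} {l : List α} (h : ∀ a ∈ s, a ∈ l) :
    s.ncard ≤ l.length := by
  classical
  calc s.ncard ≤ (l.toFinset : Set α).ncard :=
        Set.ncard_le_ncard (fun a ha => by simpa using h a ha) (Finset.finite_toSet _)
    _ ≤ l.length := by
        rw [Set.ncard_coe_finset]
        exact l.toFinset_card_le

theorem length_le_ncard {α : Type} {s : Set α} {l : List α} (hl : l.Nodup) (h : ∀ a ∈ l, a ∈ s)
    (hs : s.Finite) : l.length ≤ s.ncard := by
  classical
  rw [← List.toFinset_card_of_nodup hl, ← Set.ncard_coe_finset]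
  exact Set.ncard_le_ncard (fun a ha => h a (by simpa using ha)) hs

section

variable {m k : ℕ} {R : Requirements m k} {L : Libraries m k} {d cc : Option Bin}

/-- The numbers of code changes that make `p` right in `V`, for all `V`. -/
noncomputable def profile (R : Requirements m k) (p : Procedure m k) : List (List Bool) :=
  open Classical in
  (allSits m).sublists'.map fun V => (List.range (4 * m + 5)).map fun c =>
    decide (∃ e ∈ fixes R p V, e.1 = c)

theorem profile_mem_words (p : Procedure m k) :
    profile R p ∈ words (words [false, true] (4 * m + 5)) (2 ^ 2 ^ m) := by
  rw [mem_words]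
  refine ⟨by simp [profile, length_allSits], fun w hw => ?_⟩
  obtain ⟨V, -, rfl⟩ := List.mem_map.1 hw
  exact mem_words.2 ⟨by simp, fun b _ => by cases b <;> simp⟩

/-- By `exists_cheap_fix` a repair can be assumed to cost less than `4 * m + 5`, and such costs are
recorded in the profile. -/
theorem exists_fix_of_profile_eq {p q : Procedure m k} (h : profile R p = profile R q)
    {V : List (Situation m)} (hV : V.Sublist (allSits m)) {p' : Procedure m k} {n : ℕ}
    (hp : (n, p') ∈ fixes R p V) : ∃ n' ≤ n, ∃ q', (n', q') ∈ fixes R q V := by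
  classical
  obtain ⟨hs, hr⟩ := of_mem_fixes hp
  obtain ⟨p₁, n', hn, hn', hs, hr⟩ := exists_cheap_fix hs hr
  obtain ⟨p₂, hp₂⟩ := exists_mem_fixes hs hr
  rw [profile, profile, List.map_inj_left] at h
  have h := h V (List.mem_sublists'.2 hV)
  rw [List.map_inj_left] at h
  have h := h n' (List.mem_range.2 hn')
  obtain ⟨⟨_, q'⟩, hq, rfl⟩ := (decide_eq_decide.1 h).1 ⟨_, hp₂, rfl⟩
  exact ⟨_, hn, q', hq⟩

/-- One procedure of the library for each profile. -/
noncomputable def reps (R : Requirements m k) (L : Libraries m k) : List (Procedure m k) :=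
  dedupBy (profile R) L.prc

/-- `D` contains the procedures allowed in the slots. Since all sets of representatives are tried,
the dynamic program itself need not count component types. -/
noncomputable def adaptations (R : Requirements m k) (L : Libraries m k) (d : Option Bin) :
    List (ℕ × SoftSystem m k) :=
  open Classical in
  ((reps R L).sublists'.filter fun D => LeOpt (D.length + 1) d).flatMap fun D =>
    L.sel.flatMap fun σ => sysDP R (σ.map fun l => (l, D)) D (allSits m)

theorem forall₂_mem_const {α β : Type} {xs : List α} {ys : List β} {D : List α} :
    List.Forall₂ (· ∈ ·) xs (ys.map fun _ => D) ↔ xs.length = ys.length ∧ ∀ x ∈ xs, x ∈ D := by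
  induction xs generalizing ys with
  | nil => cases ys <;> simp
  | cons x xs ih =>
    cases ys with
    | nil => simp
    | cons y ys =>
      simp only [List.map_cons, List.forall₂_cons, ih, List.length_cons, Nat.add_right_cancel_iff,
        List.forall_mem_cons]
      tauto

theorem of_mem_adaptations {S : SoftSystem m k} {n : ℕ} (h : (n, S) ∈ adaptations R L d) :
    ∃ S₀ : SoftSystem m k, S₀.DrawnFrom L ∧ LeOpt S₀.numTypes d ∧ CodeEdit S₀ S n ∧
      S.Satisfies R := by
  simp only [adaptations, List.mem_flatMap, List.mem_filter, List.mem_sublists',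
    decide_eq_true_eq] at h
  obtain ⟨D, ⟨hD, hd⟩, σ, hσ, h⟩ := h
  obtain ⟨S₀, hc, hb, ho, he, hr⟩ := of_mem_sysDP h
  rw [List.map_map, Function.comp_def, List.map_id'] at hc
  rw [List.map_map] at hb
  have hb := (forall₂_mem_const.1 hb).2
  have hbD : ∀ p ∈ S₀.bodies, p ∈ D := by
    intro p hp
    rcases List.mem_append.1 hp with hp | hp
    · exact hb p hp
    · rwa [List.mem_singleton.1 hp]
  refine ⟨S₀, ⟨hc ▸ hσ, fun p hp => mem_of_mem_dedupBy (hD.subset (hbD p hp))⟩, fun b hb => ?_, he,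
    right_allSits_iff.1 hr⟩
  refine le_trans ?_ (hd b hb)
  rw [SoftSystem.numTypes, add_comm]
  exact Nat.add_le_add_right (ncard_le_length hbD) 1

/-- Each procedure of `S₀` is exchanged for the representative of its profile. No repair becomes
more expensive, and the number of types does not grow, because different representatives have
different profiles. -/
theorem exists_mem_adaptations {S₀ S : SoftSystem m k} {n : ℕ} (h : S₀.DrawnFrom L)
    (hd : LeOpt S₀.numTypes d) (he : CodeEdit S₀ S n) (hr : S.Satisfies R) :
    ∃ n' ≤ n, ∃ T, (n', T) ∈ adaptations R L d := by
  classical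
  set D := (reps R L).filter fun r => ∃ q ∈ S₀.bodies, profile R q = profile R r with hD
  have hrep : ∀ q ∈ S₀.bodies, ∃ r ∈ D, profile R q = profile R r := by
    intro q hq
    obtain ⟨r, hr, e⟩ := exists_mem_dedupBy (profile R) (h.2 q hq)
    exact ⟨r, List.mem_filter.2 ⟨hr, by simpa using ⟨q, hq, e.symm⟩⟩, e.symm⟩
  have hfin : {p | p ∈ S₀.bodies}.Finite := List.finite_toSet _
  have hlen : D.length + 1 ≤ S₀.numTypes := by
    rw [SoftSystem.numTypes, add_comm]
    refine Nat.add_le_add_left (le_trans ?_ (Set.ncard_image_le (f := profile R) hfin)) 1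
    rw [← List.length_map (f := profile R)]
    refine length_le_ncard ((nodup_map_dedupBy (profile R) L.prc).sublist
      (List.filter_sublist.map _)) ?_ (hfin.image _)
    intro w hw
    obtain ⟨r, hr, rfl⟩ := List.mem_map.1 hw
    obtain ⟨q, hq, e⟩ := of_decide_eq_true (List.mem_filter.1 hr).2
    exact ⟨q, hq, e⟩
  obtain ⟨bs, o, hrun⟩ := exists_blockRun_sys (R := R) (U := allSits m) (oP := S₀.bodies)
    (items := S₀.conds.map fun l => (l, S₀.bodies)) (by simp [Block.conds]) (by
      rw [List.map_map]
      exact forall₂_mem_const.2 ⟨by simp [Block.conds], fun p hp => List.mem_append_left _ hp⟩)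
    (List.mem_append_right _ (List.mem_singleton_self _)) he (right_allSits_iff.2 hr)
  obtain ⟨n', hn, bs', o', hrun'⟩ := hrun.mono (body' := sysBody R) (fin' := sysFin R D)
    (items' := S₀.conds.map fun l => (l, D)) (List.Sublist.refl _) (by
      rw [List.forall₂_map_left_iff, List.forall₂_map_right_iff, List.forall₂_same]
      intro l₀ _ l V hV n b hb
      obtain ⟨hb', c, hc, rfl⟩ := mem_sysBody.1 hb
      obtain ⟨r, hr, e⟩ := hrep _ hb'
      obtain ⟨c', hc', q', hq'⟩ := exists_fix_of_profile_eq e hV hc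
      exact ⟨_, Nat.add_le_add_left hc' _, (r, q'), mem_sysBody.2 ⟨hr, c', hq', rfl⟩⟩) (by
      intro V hV n b hb
      obtain ⟨hb, hc⟩ := mem_sysFin.1 hb
      obtain ⟨r, hr, e⟩ := hrep _ hb
      obtain ⟨c', hc', q', hq'⟩ := exists_fix_of_profile_eq e hV hc
      exact ⟨c', hc', (r, q'), mem_sysFin.2 ⟨hr, hq'⟩⟩)
  obtain ⟨T, hT⟩ := exists_mem_sysDP hrun'
  refine ⟨n', hn, T, ?_⟩
  simp only [adaptations, List.mem_flatMap, List.mem_filter, List.mem_sublists',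
    decide_eq_true_eq]
  exact ⟨D, ⟨List.filter_sublist, fun b hb => hlen.trans (hd b hb)⟩, S₀.conds, h.1, hT⟩

end

/-! ### Computing profiles and adaptations. -/

section

variable {X : Type} [Scale X] {c : X → Val} {m k : X → ℕ} {R : ∀ x, Requirements (m x) (k x)}

namespace FP

theorem profile {p : ∀ x, Procedure (m x) (k x)} (hm : FP c m) (hp : ∀ x, m x = Scale.par x)
    (hk : FP c k) (hR : FP c R) (hq : FP c p) : FP c fun x => profile (R x) (p x) := by
  have hS := FP.allSits hm hp
  have h4 : FP c fun x => 4 * m x + 5 :=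
    ((((hm.add hm).add hm).add hm).add (const 5)).congr fun x => by ring
  refine (hS.sublists ?_).map fun hV => h4.range.wk.map fun hn =>
    (FPD.bex (FP.fixes hm.wk (fun _ => hp _) hk.wk hR.wk hq.wk hV fun z =>
      List.mem_sublists'.1 z.2.2).wk fun he => FPD.eq he.fst hn.wk).decide _
  simp only [length_allSits, hp]
  exact Bdd.par fun n => 2 ^ 2 ^ n

theorem adaptations {L : ∀ x, Libraries (m x) (k x)} {d : X → Option Bin} (hm : FP c m)
    (hp : ∀ x, m x = Scale.par x) (hk : FP c k) (hR : FP c R) (hL : FP c L) (hd : FP c d) :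
    FP c fun x => adaptations (R x) (L x) (d x) := by
  have hr : FP c fun x => reps (R x) (L x) := hL.librariesPrc.dedupBy fun hq =>
    FP.profile hm.wk (fun _ => hp _) hk.wk hR.wk hq
  refine ((hr.sublists ?_).filter (inst := fun _ _ => Classical.propDecidable _) fun hD =>
    FPD.leOpt (hD.length.add (const 1)) hd.wk).flatMap fun hD => hL.librariesSel.wk.flatMap
    fun hσ => FP.sysDP hm.wk.wk (fun _ => hp _) hk.wk.wk hR.wk.wk
      (hσ.map fun hl => hl.pair hD.wk.wk) hD.wk (FP.allSits hm hp).wk.wk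
      fun _ => List.Sublist.refl _
  -- A profile has `2 ^ 2 ^ m` rows of `4 * m + 5` bits each; this bounds the number of
  -- representatives, of which all subsets are enumerated.
  refine Bdd.mono (Bdd.par (X := X) fun n => 2 ^ (2 ^ (4 * n + 5)) ^ 2 ^ 2 ^ n) fun x => ?_
  refine Nat.pow_le_pow_right (by norm_num) ((length_dedupBy_le _ _ _ fun p _ =>
    profile_mem_words p).trans ?_)
  rw [length_words, length_words, hp]
  rfl

end FP

end

instance : Scale SCreCompA.Inst where
  par := SCreCompAInput.nI
  size x := (SCreCompA.codeInst x).size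
  size_pos _ := Val.size_pos _

instance (x : SCreCompA.Inst) : Enc (SCreCompA.Out x) :=
  inferInstanceAs (Enc (SoftSystem x.nI x.nA))

theorem SCreCompA.fpTractable : SCreCompA.FPTractable (fun x : SCreCompAInput => x.nI) := by
  refine SearchProblem.FPTractable.of_FP (fun _ => rfl) (fun _ => rfl) (fun _ _ => rfl)
    (fun x : SCreCompAInput => pick (adaptations x.R x.L (some ⟨x.d⟩)) (some ⟨x.cc⟩)) ?_ ?_ ?_
  · have hm : FP (fun x : {x // SCreCompA.Valid x} => SCreCompA.codeInst x.1)
      (fun x => x.1.nI) := FP.entry 0 (fun _ => rfl) fun _ => le_rfl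
    have hk : FP (fun x : {x // SCreCompA.Valid x} => SCreCompA.codeInst x.1)
      (fun x => x.1.nA) := FP.entry 1 (fun _ => rfl) fun _ => le_rfl
    have hR : FP (fun x : {x // SCreCompA.Valid x} => SCreCompA.codeInst x.1)
      (fun x => x.1.R) := FP.entry 2 (fun _ => rfl) fun _ => le_rfl
    have hL : FP (fun x : {x // SCreCompA.Valid x} => SCreCompA.codeInst x.1)
      (fun x => x.1.L) := FP.entry 3 (fun _ => rfl) fun _ => le_rfl
    have hd : FP (fun x : {x // SCreCompA.Valid x} => SCreCompA.codeInst x.1)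
      (fun x => (⟨x.1.d⟩ : Bin)) := FP.entry 4 (fun _ => rfl) fun _ => le_rfl
    have hc : FP (fun x : {x // SCreCompA.Valid x} => SCreCompA.codeInst x.1)
      (fun x => (⟨x.1.cc⟩ : Bin)) := FP.entry 5 (fun _ => rfl) fun _ => le_rfl
    exact (FP.adaptations hm (fun _ => rfl) hk hR hL hd.some).pick hc.some
  · intro x _ y hy
    obtain ⟨n, hn, hb⟩ := mem_of_pick_eq_some hy
    obtain ⟨S₀, h, hd, he, hr⟩ := of_mem_adaptations hn
    exact ⟨S₀, h, hd _ rfl, ⟨n, hb _ rfl, he.codeDerives⟩, hr⟩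
  · rintro x _ hn y ⟨S₀, h, hd, ⟨c, hc, hcd⟩, hr⟩
    obtain ⟨c', hc', he⟩ := hcd.codeEdit
    obtain ⟨c'', hc'', T, hT⟩ := exists_mem_adaptations (d := some ⟨x.d⟩) h (fun b hb => by
      obtain rfl := Option.mem_some_iff.1 hb
      exact hd) he hr
    exact not_mem_of_pick_eq_none hn _ _ hT fun b hb => by
      obtain rfl := Option.mem_some_iff.1 hb
      exact (hc''.trans hc').trans hc

instance : Scale SCreComp.Inst where
  par := SCreCompInput.nI
  size x := (SCreComp.codeInst x).size
  size_pos _ := Val.size_pos _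

instance (x : SCreComp.Inst) : Enc (SCreComp.Out x) :=
  inferInstanceAs (Enc (SoftSystem x.nI x.nA))

theorem SCreComp.fpTractable : SCreComp.FPTractable (fun x : SCreCompInput => x.nI) := by
  refine SearchProblem.FPTractable.of_FP (fun _ => rfl) (fun _ => rfl) (fun _ _ => rfl)
    (fun x : SCreCompInput => pick (adaptations x.R x.L (some ⟨x.d⟩)) (some ⟨0⟩)) ?_ ?_ ?_
  · have hm : FP (fun x : {x // SCreComp.Valid x} => SCreComp.codeInst x.1)
      (fun x => x.1.nI) := FP.entry 0 (fun _ => rfl) fun _ => le_rfl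
    have hk : FP (fun x : {x // SCreComp.Valid x} => SCreComp.codeInst x.1)
      (fun x => x.1.nA) := FP.entry 1 (fun _ => rfl) fun _ => le_rfl
    have hR : FP (fun x : {x // SCreComp.Valid x} => SCreComp.codeInst x.1)
      (fun x => x.1.R) := FP.entry 2 (fun _ => rfl) fun _ => le_rfl
    have hL : FP (fun x : {x // SCreComp.Valid x} => SCreComp.codeInst x.1)
      (fun x => x.1.L) := FP.entry 3 (fun _ => rfl) fun _ => le_rfl
    have hd : FP (fun x : {x // SCreComp.Valid x} => SCreComp.codeInst x.1)
      (fun x => (⟨x.1.d⟩ : Bin)) := FP.entry 4 (fun _ => rfl) fun _ => le_rfl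
    exact (FP.adaptations hm (fun _ => rfl) hk hR hL hd.some).pick (FP.const _)
  · intro x _ y hy
    obtain ⟨n, hn, hb⟩ := mem_of_pick_eq_some hy
    obtain ⟨S₀, h, hd, he, hr⟩ := of_mem_adaptations hn
    -- The budget is zero, so the system found is itself drawn from the libraries.
    obtain rfl : n = 0 := Nat.le_zero.1 (hb _ rfl)
    have hcd := he.codeDerives
    generalize h0 : 0 = c at hcd
    cases hcd with
    | refl => exact ⟨h, hd _ rfl, hr⟩
    | step => omega
  · rintro x _ hn y ⟨h, hd, hr⟩
    obtain ⟨c', hc', he⟩ := (SoftSystem.CodeDerives.refl y).codeEdit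
    obtain ⟨c'', hc'', T, hT⟩ := exists_mem_adaptations (d := some ⟨x.d⟩) h (fun b hb => by
      obtain rfl := Option.mem_some_iff.1 hb
      exact hd) he hr
    exact not_mem_of_pick_eq_none hn _ _ hT fun b hb => by
      obtain rfl := Option.mem_some_iff.1 hb
      exact hc''.trans hc'

/-! ### Creation of systems relative to a specification -/

section

variable {m k : ℕ} {R : Requirements m k}

/-- Words of length at most `N` and at most `b`. -/
def shortWords {α : Type} (A : List α) (N : ℕ) (b : Bin) : List (List α) :=
  ((List.range (N + 1)).filter fun n => n ≤ b.val).flatMap (words A)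

theorem mem_shortWords {α : Type} {A : List α} {N : ℕ} {b : Bin} {w : List α} :
    w ∈ shortWords A N b ↔ w.length ≤ N ∧ w.length ≤ b.val ∧ ∀ a ∈ w, a ∈ A := by
  simp only [shortWords, List.mem_flatMap, List.mem_filter, List.mem_range, decide_eq_true_eq,
    mem_words]
  constructor
  · rintro ⟨n, ⟨h1, h2⟩, rfl, h3⟩
    exact ⟨by omega, h2, h3⟩
  · rintro ⟨h1, h2, h3⟩
    exact ⟨w.length, ⟨by omega, h2⟩, rfl, h3⟩

/-- All short procedures that execute nothing but the action `a`. -/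
def blanks (m : ℕ) {k : ℕ} (a : Fin k) (b : Bin) : List (Procedure m k) :=
  (shortWords ((allLits m).map fun l => (l, a)) (2 * m) b).map fun bs => ⟨bs, a⟩

/-- Blank candidates keep their number independent of the number of actions. The dynamic program
fills in the actions by code changes, the number of which is irrelevant here. -/
noncomputable def creations (R : Requirements m k) (a : Fin k) (maxSel maxPrc : Bin) :
    List (ℕ × SoftSystem m k) :=
  (shortWords (allLits m) (2 * m) maxSel).flatMap fun σ =>
    sysDP R (σ.map fun l => (l, blanks m a maxPrc)) (blanks m a maxPrc) (allSits m)

theorem of_mem_creations {a : Fin k} {maxSel maxPrc : Bin} {S : SoftSystem m k} {n : ℕ}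
    (h : (n, S) ∈ creations R a maxSel maxPrc) :
    S.Consistent maxSel.val maxPrc.val ∧ S.Satisfies R := by
  simp only [creations, List.mem_flatMap] at h
  obtain ⟨σ, hσ, h⟩ := h
  obtain ⟨S₀, hc, hb, ho, he, hr⟩ := of_mem_sysDP h
  rw [List.map_map, Function.comp_def, List.map_id'] at hc
  rw [List.map_map] at hb
  have hb := (forall₂_mem_const.1 hb).2
  refine ⟨he.consistent ⟨hc ▸ (mem_shortWords.1 hσ).2.1, fun p hp => ?_⟩, right_allSits_iff.1 hr⟩
  have hp : p ∈ blanks m a maxPrc := by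
    rcases List.mem_append.1 hp with hp | hp
    · exact hb p hp
    · rwa [List.mem_singleton.1 hp]
  obtain ⟨bs, hbs, rfl⟩ := List.mem_map.1 hp
  simpa [Block.conds] using (mem_shortWords.1 hbs).2.1

/-- All actions are replaced by `a`. -/
def blank (a : Fin k) (p : Procedure m k) : Procedure m k := ⟨p.branches.map fun e => (e.1, a), a⟩

theorem blank_mem_blanks {a : Fin k} {b : Bin} {p : Procedure m k} (h : p.conds.length ≤ 2 * m)
    (hb : p.conds.length ≤ b.val) : blank a p ∈ blanks m a b := by
  rw [Block.length_conds] at h hb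
  refine List.mem_map.2 ⟨_, mem_shortWords.2 ⟨?_, ?_, ?_⟩, rfl⟩
  · rwa [List.length_map]
  · rwa [List.length_map]
  · simp [mem_allLits]

theorem sim_blank (a : Fin k) (p : Procedure m k) : ∃ c, Sim (blank a p) p c :=
  ⟨_, by simp [blank, Block.conds], rfl⟩

theorem codeEdit_blank (a : Fin k) (bs : List (Literal m × Procedure m k)) (o : Procedure m k) :
    ∃ n, CodeEdit ⟨bs.map fun e => (e.1, blank a e.2), blank a o⟩ ⟨bs, o⟩ n := by
  induction bs with
  | nil =>
    obtain ⟨c, h⟩ := sim_blank a o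
    exact ⟨c, codeEdit_nil h⟩
  | cons e bs ih =>
    obtain ⟨c, h⟩ := sim_blank a e.2
    obtain ⟨n, h'⟩ := ih
    exact ⟨_, codeEdit_cons_iff.2 ⟨_, _, h, h', rfl⟩⟩

/-- Selector and procedures are shortened to at most `2 * m` conditions without changing the
behaviour or violating the bounds; the resulting system arises from its blank version by code
changes. -/
theorem exists_mem_creations {a : Fin k} {maxSel maxPrc : Bin} {S : SoftSystem m k}
    (hS : S.Consistent maxSel.val maxPrc.val) (hr : S.Satisfies R) :
    ∃ n T, (n, T) ∈ creations R a maxSel maxPrc := by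
  obtain ⟨⟨bs, o⟩, hs, hl, rfl, hrun⟩ := S.exists_short
  choose short hsub hlen _ hrun' using fun p : Procedure m k => p.exists_short
  have hblank : ∀ p ∈ S.bodies, blank a (short p) ∈ blanks m a maxPrc := fun p hp => by
    refine blank_mem_blanks (hlen p) (le_trans ?_ (hS.2 p hp))
    rw [Block.length_conds, Block.length_conds]
    exact (hsub p).length_le
  set T : SoftSystem m k := ⟨bs.map fun e => (e.1, short e.2), short S.otherwise⟩ with hT
  have hTrun : ∀ s, T.run s = short (S.run s) := by
    intro s
    rw [← hrun]
    simp only [Block.run, hT]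
    clear hs hl hrun hT
    induction bs with
    | nil => rfl
    | cons e bs ih =>
      simp only [List.map_cons, Block.runAux, ih]
      split_ifs <;> rfl
  obtain ⟨n, he⟩ := codeEdit_blank a T.branches T.otherwise
  obtain ⟨bs', o', h⟩ := exists_blockRun_sys (R := R) (U := allSits m) (oP := blanks m a maxPrc)
    (items := T.conds.map fun l => (l, blanks m a maxPrc)) (by simp [Block.conds]) (by
      rw [List.map_map (l := T.conds)]
      refine forall₂_mem_const.2 ⟨by simp [Block.conds], fun p hp => ?_⟩
      simp only [hT, List.map_map, List.mem_map] at hp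
      obtain ⟨e, he, rfl⟩ := hp
      exact hblank _ (List.mem_append_left _ (List.mem_map_of_mem (hs.subset he))))
    (hblank _ (List.mem_append_right _ (List.mem_singleton_self _))) he (fun r hr' _ => by
      rw [← hr r hr']
      show (T.run _).run _ = (S.run _).run _
      rw [hTrun, hrun'])
  obtain ⟨T', hT'⟩ := exists_mem_sysDP h
  refine ⟨n, T', List.mem_flatMap.2 ⟨T.conds, mem_shortWords.2 ⟨?_, ?_, fun l _ => mem_allLits l⟩,
    hT'⟩⟩
  · simpa [hT, Block.conds] using hl
  · refine le_trans ?_ hS.1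
    simpa [hT, Block.conds] using hs.length_le

end

/-! ### Computing the creations. -/

section

variable {X : Type} [Scale X] {β : X → Type} [∀ x, Enc (β x)] {c : X → Val} {m k : X → ℕ}
  {R : ∀ x, Requirements (m x) (k x)}

namespace FP

theorem shortWords {A : ∀ x, List (β x)} {N : X → ℕ} {b : X → Bin} (hA : FP c A) (hN : FP c N)
    (hb : FP c b) (hB : Bdd fun x => ((A x).length + 1) ^ N x) :
    FP c fun x => shortWords (A x) (N x) (b x) := by
  refine ((hN.add (const 1)).range.filter (P := fun x n => n ≤ (b x).val)
    (inst := fun _ _ => inferInstance) fun hn =>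
    FPD.leBin hn hb.wk).flatMap (f := fun x n => _root_.words (A x) n) fun hn =>
    FP.words hA.wk hn ?_
  refine (hB.sigma _).mono fun z => Nat.pow_le_pow_right (Nat.succ_pos _) ?_
  have := List.mem_range.1 (List.mem_filter.1 z.2.2).1
  omega

theorem blanks {a : ∀ x, Fin (k x)} {b : X → Bin} (hm : FP c m) (hp : ∀ x, m x = Scale.par x)
    (ha : FP c a) (hb : FP c b) : FP c fun x => blanks (m x) (a x) (b x) := by
  refine (FP.shortWords (hm.allLits.map fun hl => hl.pair ha.wk)
    ((hm.add hm).congr fun x => by ring) hb ?_).map fun hw => hw.block ha.wk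
  simp only [List.length_map, length_allLits, hp]
  exact Bdd.par fun n => (2 * n + 1) ^ (2 * n)

theorem creations {a : ∀ x, Fin (k x)} {b b' : X → Bin} (hm : FP c m)
    (hp : ∀ x, m x = Scale.par x) (hk : FP c k) (hR : FP c R) (ha : FP c a) (hb : FP c b)
    (hb' : FP c b') : FP c fun x => creations (R x) (a x) (b x) (b' x) := by
  have hB := FP.blanks hm hp ha hb'
  refine (FP.shortWords hm.allLits ((hm.add hm).congr fun x => by ring) hb ?_).flatMap fun hσ =>
    FP.sysDP hm.wk (fun _ => hp _) hk.wk hR.wk (hσ.map fun hl => hl.pair hB.wk.wk) hB.wk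
      (FP.allSits hm hp).wk fun _ => List.Sublist.refl _
  simp only [length_allLits, hp]
  exact Bdd.par fun n => (2 * n + 1) ^ (2 * n)

end FP

end

instance : Scale SCreSpec.Inst where
  par := SCreSpecInput.nI
  size x := (SCreSpec.codeInst x).size
  size_pos _ := Val.size_pos _

instance (x : SCreSpec.Inst) : Enc (SCreSpec.Out x) :=
  inferInstanceAs (Enc (SoftSystem x.nI x.nA))

theorem SCreSpec.fpTractable : SCreSpec.FPTractable (fun x : SCreSpecInput => x.nI) := by
  refine SearchProblem.FPTractable.of_FP (fun _ => rfl) (fun _ => rfl) (fun _ _ => rfl)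
    (fun x : SCreSpecInput => (List.finRange x.nA).head?.elim none fun a =>
      pick (creations x.R a ⟨x.maxSel⟩ ⟨x.maxPrc⟩) none) ?_ ?_ ?_
  · have hm : FP (fun x : {x // SCreSpec.Valid x} => SCreSpec.codeInst x.1)
      (fun x => x.1.nI) := FP.entry 0 (fun _ => rfl) fun _ => le_rfl
    have hk : FP (fun x : {x // SCreSpec.Valid x} => SCreSpec.codeInst x.1)
      (fun x => x.1.nA) := FP.entry 1 (fun _ => rfl) fun _ => le_rfl
    have hR : FP (fun x : {x // SCreSpec.Valid x} => SCreSpec.codeInst x.1)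
      (fun x => x.1.R) := FP.entry 2 (fun _ => rfl) fun _ => le_rfl
    have hb : FP (fun x : {x // SCreSpec.Valid x} => SCreSpec.codeInst x.1)
      (fun x => (⟨x.1.maxSel⟩ : Bin)) := FP.entry 3 (fun _ => rfl) fun _ => le_rfl
    have hb' : FP (fun x : {x // SCreSpec.Valid x} => SCreSpec.codeInst x.1)
      (fun x => (⟨x.1.maxPrc⟩ : Bin)) := FP.entry 4 (fun _ => rfl) fun _ => le_rfl
    exact hk.finRange.head?.elim FP.none fun ha => (FP.creations hm.wk (fun _ => rfl) hk.wk hR.wk ha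
      hb.wk hb'.wk).pick FP.none
  · intro x _ y hy
    cases h : (List.finRange x.nA).head? with
    | none => simp [h] at hy
    | some a =>
      rw [h] at hy
      obtain ⟨n, hn, -⟩ := mem_of_pick_eq_some hy
      exact of_mem_creations hn
  · rintro x _ hn S ⟨hS, hr⟩
    cases h : (List.finRange x.nA).head? with
    | none =>
      rw [List.head?_eq_none_iff] at h
      have := List.mem_finRange S.otherwise.otherwise
      simp [h] at this
    | some a =>
      rw [h] at hn
      obtain ⟨n, T, hT⟩ := exists_mem_creations (a := a) (maxSel := ⟨x.maxSel⟩)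
        (maxPrc := ⟨x.maxPrc⟩) hS hr
      exact not_mem_of_pick_eq_none hn _ _ hT fun b hb => by simp at hb

/-- The members of `l` with the property `P`. -/
noncomputable def select {α : Type} (P : α → Prop) (l : List α) : List α :=
  open Classical in l.filter fun a => P a

theorem mem_select {α : Type} {P : α → Prop} {l : List α} {a : α} :
    a ∈ select P l ↔ a ∈ l ∧ P a := by
  simp [select]

theorem FP.select {X : Type} [Scale X] {β : X → Type} [∀ x, Enc (β x)] {c : X → Val}
    {l : ∀ x, List (β x)} {P : ∀ x, β x → Prop} (hl : FP c l)
    (hP : FP (ext c) (fun z : Σ x, {y // y ∈ l x} => z.2.1) →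
      FPD (ext c) fun z : Σ x, {y // y ∈ l x} => P z.1 z.2.1) :
    FP c fun x => select (P x) (l x) :=
  hl.filter hP

/-! ### Reconfiguration by component changes -/

section

variable {m k : ℕ} {α β : Type}

namespace Block

def mapBodies (g : α → β) (b : Block m α) : Block m β :=
  ⟨b.branches.map fun e => (e.1, g e.2), g b.otherwise⟩

theorem run_mapBodies (g : α → β) (b : Block m α) (s : Situation m) :
    (b.mapBodies g).run s = g (b.run s) := by
  obtain ⟨bs, o⟩ := b
  simp only [run, mapBodies]
  induction bs with
  | nil => rfl
  | cons e bs ih =>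
    simp only [List.map_cons, runAux, ih]
    split_ifs <;> rfl

theorem conds_mapBodies (g : α → β) (b : Block m α) : (b.mapBodies g).conds = b.conds := by
  simp [conds, mapBodies]

theorem bodies_mapBodies (g : α → β) (b : Block m α) :
    (b.mapBodies g).bodies = b.bodies.map g := by
  simp [bodies, mapBodies]

theorem run_mem_bodies (b : Block m α) (s : Situation m) : b.run s ∈ b.bodies := by
  obtain ⟨bs, o⟩ := b
  simp only [run, bodies]
  induction bs with
  | nil => exact List.mem_singleton_self _
  | cons e bs ih =>
    simp only [runAux]
    split_ifs
    · simp
    · exact List.mem_cons_of_mem _ ih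

/-- As the bodies of `b` are distinct, the body that is selected reveals its position, and `b'` has
the same conditions and selects the same position. -/
theorem run_eq_of_mem_zip {b : Block m α} {b' : Block m β} (hc : b.conds = b'.conds)
    (hn : b.bodies.Nodup) {e : α} {t : β} (h : (e, t) ∈ b.bodies.zip b'.bodies) {s : Situation m}
    (hs : b.run s = e) : b'.run s = t := by
  obtain ⟨bs, o⟩ := b
  obtain ⟨bs', o'⟩ := b'
  simp only [conds] at hc
  induction bs generalizing bs' with
  | nil =>
    obtain rfl : bs' = [] := by simpa using hc.symm
    simp only [bodies, List.map_nil, List.nil_append, List.zip_cons_cons, List.zip_nil_right,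
      List.mem_singleton, Prod.mk.injEq] at h
    exact h.2.symm
  | cons f bs ih =>
    rcases bs' with _ | ⟨f', bs'⟩
    · simp at hc
    simp only [List.map_cons, List.cons.injEq] at hc
    have hn' : f.2 ∉ (⟨bs, o⟩ : Block m α).bodies ∧ (⟨bs, o⟩ : Block m α).bodies.Nodup :=
      List.nodup_cons.1 hn
    have h' : (e, t) = (f.2, f'.2) ∨
      (e, t) ∈ (⟨bs, o⟩ : Block m α).bodies.zip (⟨bs', o'⟩ : Block m β).bodies := List.mem_cons.1 h
    simp only [run, runAux, ← hc.1] at hs ⊢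
    split_ifs at hs ⊢ with hl
    · rcases h' with h' | h'
      · exact (congrArg Prod.snd h').symm
      · exact absurd (hs ▸ (List.of_mem_zip h').1) hn'.1
    · rcases h' with h' | h'
      · have h1 : e ∈ (⟨bs, o⟩ : Block m α).bodies := hs ▸ run_mem_bodies ⟨bs, o⟩ s
        rw [show e = f.2 from congrArg Prod.fst h'] at h1
        exact absurd h1 hn'.1
      · exact ih hn'.2 hs bs' hc.2 h'

end Block

theorem ham_map_map {γ : Type} (f g : γ → α) (l : List γ) :
    ham (l.map f) (l.map g) = (l.map fun e => neq (f e) (g e)).sum := by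
  induction l with
  | nil => rfl
  | cons a l ih => simp [ih]

theorem sum_map_sum_comm (f : α → β → ℕ) (l : List α) (r : List β) :
    (l.map fun a => (r.map (f a)).sum).sum = (r.map fun b => (l.map fun a => f a b).sum).sum := by
  induction l with
  | nil => simp
  | cons a l ih => simp [ih, List.sum_map_add]

theorem sum_map_le_of_nodup {l : List α} (hl : l.Nodup) (f : α → ℕ) (a : α)
    (h : ∀ b ∈ l, b ≠ a → f b = 0) : (l.map f).sum ≤ f a := by
  induction l with
  | nil => simp
  | cons b l ih =>
    rw [List.nodup_cons] at hl
    rw [List.map_cons, List.sum_cons]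
    by_cases hb : b = a
    · subst hb
      have : (l.map f).sum = 0 := List.sum_eq_zero fun n hn => by
        obtain ⟨c, hc, rfl⟩ := List.mem_map.1 hn
        exact h c (by simp [hc]) fun e => hl.1 (e ▸ hc)
      omega
    · have := ih hl.2 fun c hc => h c (by simp [hc])
      rw [h b (by simp) hb]
      omega

/-- The slots of the selector `σ`, numbered, and with the procedures of `S` in these slots. -/
def slotsOf (σ : Selector m) (S : SoftSystem m k) : Block m (ℕ × Procedure m k) :=
  ⟨σ.zip ((List.range S.branches.length).zip (S.branches.map Prod.snd)),
    (S.branches.length, S.otherwise)⟩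

section slotsOf

variable {σ : Selector m} {S : SoftSystem m k}

theorem conds_slotsOf (h : σ.length = S.conds.length) : (slotsOf σ S).conds = σ :=
  List.map_fst_zip (by simp [h, Block.conds])

theorem bodies_slotsOf (h : σ.length = S.conds.length) :
    (slotsOf σ S).bodies = (List.range (S.branches.length + 1)).zip S.bodies := by
  rw [Block.bodies, slotsOf, List.map_snd_zip (by simp [h, Block.conds]), Block.bodies,
    List.range_succ, List.zip_append (by simp)]
  rfl

theorem map_snd_bodies_slotsOf (h : σ.length = S.conds.length) :
    (slotsOf σ S).bodies.map Prod.snd = S.bodies := by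
  rw [bodies_slotsOf h]
  exact List.map_snd_zip (by simp [Block.bodies])

/-- The numbers distinguish slots that contain the same procedure. -/
theorem nodup_bodies_slotsOf (h : σ.length = S.conds.length) : (slotsOf σ S).bodies.Nodup := by
  refine List.Nodup.of_map Prod.fst ?_
  rw [bodies_slotsOf h, List.map_fst_zip (by simp [Block.bodies])]
  exact List.nodup_range

end slotsOf

variable {R : Requirements m k} {B : Block m (ℕ × Procedure m k)}

/-- The contribution of the slot `e` to the number of changes, if the procedure `q` is not in
use (`none`), or is used in the situations in `W`. -/
noncomputable def weight (B : Block m (ℕ × Procedure m k)) (e : ℕ × Procedure m k)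
    (q : Procedure m k) (u : Option (List (Situation m))) : ℕ :=
  open Classical in
  u.elim (if (∀ s ∈ allSits m, B.run s ≠ e) ∧ e.2 = q then 1 else 0) fun W =>
    if (∃ s ∈ W, B.run s = e) ∧ ¬ e.2 = q then 1 else 0

/-- A replacement is charged when the search passes a suitable library procedure. A slot reached by
some situation is charged to the procedure that it receives, if this is new to the slot. A slot that
no situation reaches is charged to its present procedure, if that one is declared unused; otherwise
the slot can stay as it is. -/
noncomputable def charge (B : Block m (ℕ × Procedure m k)) (q : Procedure m k)
    (u : Option (List (Situation m))) : ℕ := (B.bodies.map fun e => weight B e q u).sum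

/-- All situations that use the same slot as a situation in `W`. -/
noncomputable def slotMates (B : Block m (ℕ × Procedure m k)) (W : List (Situation m)) :
    List (Situation m) :=
  open Classical in (allSits m).filter fun s => ∃ t ∈ W, B.run t = B.run s

/-- The key consists of the situations not yet assigned, the number of procedures in use and the
charges so far. A procedure must be right in all situations that share a slot with one of its own,
so it may be put into any slot that `W` meets, even if other procedures are assigned to situations
of this slot. -/
noncomputable def assignStep (R : Requirements m k) (B : Block m (ℕ × Procedure m k))
    (q : Procedure m k)
    (e : (List (Situation m) × (ℕ × ℕ)) × List (Procedure m k × List (Situation m))) :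
    List ((List (Situation m) × (ℕ × ℕ)) × List (Procedure m k × List (Situation m))) :=
  open Classical in
  ((e.1.1, (e.1.2.1, e.1.2.2 + charge B q none)), e.2) ::
    (e.1.1.sublists'.filter fun W => Right R q.run (slotMates B W)).map fun W =>
      ((e.1.1.filter fun s => s ∉ W, (e.1.2.1 + 1, e.1.2.2 + charge B q (some W))), (q, W) :: e.2)

theorem mem_assignStep {q : Procedure m k}
    {e e' : (List (Situation m) × (ℕ × ℕ)) × List (Procedure m k × List (Situation m))} :
    e' ∈ assignStep R B q e ↔ e' = ((e.1.1, (e.1.2.1, e.1.2.2 + charge B q none)), e.2) ∨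
      ∃ W, W.Sublist e.1.1 ∧ Right R q.run (slotMates B W) ∧
        e' = ((open Classical in e.1.1.filter fun s => s ∉ W,
          (e.1.2.1 + 1, e.1.2.2 + charge B q (some W))), (q, W) :: e.2) := by
  simp only [assignStep, List.mem_cons, List.mem_map, List.mem_filter, List.mem_sublists',
    decide_eq_true_eq]
  refine or_congr_right (exists_congr fun W => ?_)
  constructor
  · rintro ⟨⟨h1, h2⟩, rfl⟩
    exact ⟨h1, h2, rfl⟩
  · rintro ⟨h1, h2, rfl⟩
    exact ⟨⟨h1, h2⟩, rfl⟩

/-- The new procedure in the slot `e`. -/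
noncomputable def newProc (B : Block m (ℕ × Procedure m k))
    (tr : List (Procedure m k × List (Situation m))) (e : ℕ × Procedure m k) : Procedure m k :=
  open Classical in
  (((tr.filter fun f => ∃ s ∈ f.2, B.run s = e) ++ ((tr.filter fun f => f.1 = e.2) ++
    tr)).map Prod.fst).head?.getD e.2

/-- The choices made along a search path. -/
theorem exists_choices {items : List (Procedure m k)}
    {e e' : (List (Situation m) × (ℕ × ℕ)) × List (Procedure m k × List (Situation m))}
    (h : SearchPath (assignStep R B) items e e') :
    ∃ us : List (Procedure m k × Option (List (Situation m))), us.map Prod.fst = items ∧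
      e'.1.2.2 = e.1.2.2 + (us.map fun u => charge B u.1 u.2).sum ∧
      e'.1.2.1 + e.2.length = e.1.2.1 + e'.2.length ∧
      (∀ f, f ∈ e'.2 ↔ f ∈ e.2 ∨ (f.1, some f.2) ∈ us) ∧
      (∀ s ∈ e.1.1, s ∈ e'.1.1 ∨ ∃ q W, (q, some W) ∈ us ∧ s ∈ W) ∧
      ∀ q W, (q, some W) ∈ us → Right R q.run (slotMates B W) := by
  induction items generalizing e with
  | nil =>
    cases h
    exact ⟨[], rfl, by simp, rfl, by simp, fun s hs => Or.inl hs, by simp⟩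
  | cons q items ih =>
    obtain ⟨e₁, h₁, hp⟩ := h
    obtain ⟨us, h1, h2, h3, h4, h5, h6⟩ := ih hp
    rcases mem_assignStep.1 h₁ with rfl | ⟨W, hW, hR, rfl⟩
    · refine ⟨(q, none) :: us, by simp [h1], by simp [h2, add_assoc], h3, by simpa using h4,
        fun s hs => ?_, by simpa using h6⟩
      simpa using h5 s hs
    · refine ⟨(q, some W) :: us, by simp [h1], by simp [h2, add_assoc], ?_, ?_, fun s hs => ?_, ?_⟩
      · simp only [List.length_cons] at h3
        omega
      · intro f
        rw [h4]
        obtain ⟨f1, f2⟩ := f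
        simp only [List.mem_cons, Prod.mk.injEq, Option.some.injEq]
        tauto
      · by_cases hsW : s ∈ W
        · exact Or.inr ⟨q, W, by simp, hsW⟩
        · refine (h5 s (by simp [hs, hsW])).imp_right ?_
          rintro ⟨q', W', h, h'⟩
          exact ⟨q', W', by simp [h], h'⟩
      · intro q' W' h
        rcases List.mem_cons.1 h with h | h
        · simp only [Prod.mk.injEq, Option.some.injEq] at h
          obtain ⟨rfl, rfl⟩ := h
          exact hR
        · exact h6 q' W' h

theorem weight_none_of_dead {e : ℕ × Procedure m k} (h : ∀ s, B.run s ≠ e) :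
    weight B e e.2 none = 1 := if_pos ⟨fun s _ => h s, rfl⟩

/-- A reached slot receives a procedure assigned to one of its situations. An unreached slot keeps
its procedure if that is in use, and otherwise receives any procedure in use. Every slot that
changes has then been charged at least once; several assignments to one slot only increase the
charges, whence the inequality. -/
theorem newProc_spec {P : List (Procedure m k)} {tr : List (Procedure m k × List (Situation m))}
    {n c : ℕ} (hB : ∀ e ∈ B.bodies, e.2 ∈ P)
    (h : SearchPath (assignStep R B) P ((allSits m, (0, 0)), []) (([], (n, c)), tr)) :
    ham (B.bodies.map Prod.snd) (B.bodies.map (newProc B tr)) ≤ c ∧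
      (∀ e, newProc B tr e ∈ tr.map Prod.fst) ∧ tr.length = n ∧ (∀ q ∈ tr.map Prod.fst, q ∈ P) ∧
      Right R (SoftSystem.exec (B.mapBodies (newProc B tr))) (allSits m) := by
  classical
  obtain ⟨us, h1, h2, h3, h4, h5, h6⟩ := exists_choices h
  simp only [zero_add, List.length_nil, add_zero, List.not_mem_nil, false_or] at h2 h3 h4 h5
  have hlive : ∀ s, ∃ W, (newProc B tr (B.run s), W) ∈ tr ∧ ∃ t ∈ W, B.run t = B.run s := by
    intro s
    obtain ⟨q, W, hq, hs⟩ := h5 s (mem_allSits s)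
    have hf : (q, W) ∈ tr.filter fun f => ∃ t ∈ f.2, B.run t = B.run s :=
      List.mem_filter.2 ⟨(h4 _).2 hq, by simpa using ⟨s, hs, rfl⟩⟩
    rcases hl : tr.filter fun f => ∃ t ∈ f.2, B.run t = B.run s with _ | ⟨f, fs⟩
    · simp [hl] at hf
    · have hf' : f ∈ tr.filter fun f => ∃ t ∈ f.2, B.run t = B.run s := by simp [hl]
      have he : newProc B tr (B.run s) = f.1 := by
        rw [newProc, hl]
        rfl
      rw [List.mem_filter, decide_eq_true_eq] at hf'
      exact ⟨f.2, he ▸ hf'.1, hf'.2⟩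
  -- There is at least one situation, even without variables, so some procedure is in use.
  have htr : tr ≠ [] := by
    obtain ⟨W, hW, -⟩ := hlive fun _ => false
    exact List.ne_nil_of_mem hW
  refine ⟨?_, fun e => ?_, h3.symm, fun q hq => ?_, fun r hr _ => ?_⟩
  · rw [ham_map_map, h2]
    simp only [charge]
    rw [sum_map_sum_comm]
    refine List.sum_le_sum fun e he => ?_
    by_cases hne : e.2 = newProc B tr e
    · rw [← hne, neq_self]
      exact Nat.zero_le _
    rw [neq_of_ne hne]
    suffices ∃ u ∈ us, weight B e u.1 u.2 = 1 by
      obtain ⟨u, hu, hw⟩ := this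
      rw [← hw]
      exact List.single_le_sum (by simp) _ (List.mem_map.2 ⟨u, hu, rfl⟩)
    by_cases hl : ∃ s, B.run s = e
    · obtain ⟨s, rfl⟩ := hl
      obtain ⟨W, hW, hs⟩ := hlive s
      exact ⟨_, (h4 _).1 hW, if_pos ⟨hs, hne⟩⟩
    · push Not at hl
      have hP := hB e he
      rw [← h1, List.mem_map] at hP
      obtain ⟨⟨_, u⟩, hu, rfl⟩ := hP
      cases u with
      | none => exact ⟨_, hu, weight_none_of_dead hl⟩
      | some W =>
        refine absurd ?_ hne
        have hf : (e.2, W) ∈ tr.filter fun f => f.1 = e.2 :=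
          List.mem_filter.2 ⟨(h4 _).2 hu, by simp⟩
        have h0 : (tr.filter fun f => ∃ s ∈ f.2, B.run s = e) = [] := by
          simpa [List.filter_eq_nil_iff] using fun _ _ _ s _ => hl s
        rw [newProc, h0, List.nil_append]
        rcases hl' : tr.filter fun f => f.1 = e.2 with _ | ⟨f, fs⟩
        · simp [hl'] at hf
        · have : f ∈ tr.filter fun f => f.1 = e.2 := by simp [hl']
          rw [List.mem_filter, decide_eq_true_eq] at this
          rw [hl']
          exact this.2.symm
  · rw [newProc]
    have hsub : ∀ q ∈ ((tr.filter fun f => ∃ s ∈ f.2, B.run s = e) ++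
        ((tr.filter fun f => f.1 = e.2) ++ tr)).map Prod.fst, q ∈ tr.map Prod.fst := by
      intro q hq
      obtain ⟨f, hf, rfl⟩ := List.mem_map.1 hq
      simp only [List.mem_append, List.mem_filter] at hf
      exact List.mem_map_of_mem (by tauto)
    rcases hl : ((tr.filter fun f => ∃ s ∈ f.2, B.run s = e) ++
        ((tr.filter fun f => f.1 = e.2) ++ tr)).map Prod.fst with _ | ⟨q, qs⟩
    · simp [htr] at hl
    · rw [hl] at hsub
      exact hsub q (by simp)
  · obtain ⟨f, hf, rfl⟩ := List.mem_map.1 hq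
    rw [← h1]
    exact List.mem_map.2 ⟨_, (h4 f).1 hf, rfl⟩
  · obtain ⟨W, hW, hs⟩ := hlive r.1
    show ((B.mapBodies (newProc B tr)).run r.1).run r.1 = r.2
    rw [Block.run_mapBodies]
    exact h6 _ _ ((h4 _).1 hW) r hr (List.mem_filter.2 ⟨mem_allSits _, by simpa using hs⟩)

/-- A search path that leads to a given system `T`. -/
theorem exists_assignPath {T : SoftSystem m k} (hr : T.Satisfies R)
    (hT : ∀ s t, B.run s = B.run t → T.run s = T.run t) (w : Procedure m k → ℕ × Procedure m k → ℕ)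
    (hw : ∀ q ∈ T.bodies, ∀ W, (∀ s ∈ W, T.run s = q) → ∀ e, weight B e q (some W) ≤ w q e)
    (hw' : ∀ q ∉ T.bodies, ∀ e, weight B e q none ≤ w q e)
    (items : List (Procedure m k))
    (e : (List (Situation m) × (ℕ × ℕ)) × List (Procedure m k × List (Situation m)))
    (he : ∀ s ∈ e.1.1, T.run s ∈ items) :
    ∃ n c tr, SearchPath (assignStep R B) items e (([], (n, c)), tr) ∧
      n ≤ e.1.2.1 + (open Classical in items.filter fun q => q ∈ T.bodies).length ∧
      c ≤ e.1.2.2 + (items.map fun q => (B.bodies.map (w q)).sum).sum := by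
  classical
  induction items generalizing e with
  | nil =>
    obtain ⟨⟨W, n, c⟩, tr⟩ := e
    obtain rfl : W = [] := List.eq_nil_iff_forall_not_mem.2 fun s hs => by simpa using he s hs
    exact ⟨n, c, tr, rfl, by simp, by simp⟩
  | cons q items ih =>
    by_cases hq : q ∈ T.bodies
    -- A procedure of `T` takes all remaining situations in which `T` runs it. By `hT` the system
    -- `T` runs it in their slot mates too, where it is therefore right.
    · set W := e.1.1.filter fun s => T.run s = q with hW
      obtain ⟨n, c, tr, hp, hn, hc⟩ := ih ((e.1.1.filter fun s => s ∉ W,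
        (e.1.2.1 + 1, e.1.2.2 + charge B q (some W))), (q, W) :: e.2) fun s hs => by
          simp only [hW, List.mem_filter, decide_eq_true_eq, not_and] at hs
          exact (List.mem_cons.1 (he s hs.1)).resolve_left (hs.2 hs.1)
      have hWq : ∀ s ∈ W, T.run s = q := fun s hs => by simpa using (List.mem_filter.1 hs).2
      refine ⟨n, c, tr, ⟨_, mem_assignStep.2 (Or.inr ⟨W, List.filter_sublist, ?_, rfl⟩), hp⟩, ?_, ?_⟩
      · intro r hr' hcl
        obtain ⟨t, ht, e⟩ : ∃ t ∈ W, B.run t = B.run r.1 := by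
          simpa using (List.mem_filter.1 hcl).2
        rw [← hr r hr', SoftSystem.exec, ← hT _ _ e, hWq t ht]
      · rw [List.filter_cons_of_pos (by simpa using hq), List.length_cons]
        simp only at hn
        omega
      · have : charge B q (some W) ≤ (B.bodies.map (w q)).sum :=
          List.sum_le_sum fun e _ => hw q hq W hWq e
        simp only [List.map_cons, List.sum_cons] at hc ⊢
        omega
    · obtain ⟨n, c, tr, hp, hn, hc⟩ := ih ((e.1.1, (e.1.2.1, e.1.2.2 + charge B q none)), e.2)
        fun s hs => (List.mem_cons.1 (he s hs)).resolve_left fun h =>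
          hq (h ▸ Block.run_mem_bodies T s)
      refine ⟨n, c, tr, ⟨_, mem_assignStep.2 (Or.inl rfl), hp⟩, ?_, ?_⟩
      · rw [List.filter_cons_of_neg (by simpa using hq)]
        exact hn
      · have : charge B q none ≤ (B.bodies.map (w q)).sum :=
          List.sum_le_sum fun e _ => hw' q hq e
        simp only [List.map_cons, List.sum_cons] at hc ⊢
        omega

/-- After exchanging the sums, the charges are counted slot by slot. A reached slot can be charged
only to its procedure in `T`, and an unreached slot only to its present procedure, provided that
this does not occur in `T`. In both cases a charge means that the slot differs in `T`. -/
theorem exists_assignPath_le {T : SoftSystem m k} (hr : T.Satisfies R) (hc : B.conds = T.conds)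
    (hn : B.bodies.Nodup) {P : List (Procedure m k)} (hP : P.Nodup) (hT : ∀ p ∈ T.bodies, p ∈ P) :
    ∃ n c tr, SearchPath (assignStep R B) P ((allSits m, (0, 0)), []) (([], (n, c)), tr) ∧
      n + 1 ≤ T.numTypes ∧ c ≤ ham (B.bodies.map Prod.snd) T.bodies := by
  classical
  have hlen : B.bodies.length = T.bodies.length := by
    rw [Block.length_bodies, Block.length_bodies, hc]
  have hBT : ∀ s t, B.run s = B.run t → T.run s = T.run t := by
    intro s t h
    obtain ⟨b, hb⟩ : ∃ b, (B.run t, b) ∈ B.bodies.zip T.bodies := by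
      have h1 := B.run_mem_bodies t
      rw [← List.map_fst_zip (l₁ := B.bodies) (l₂ := T.bodies) hlen.le, List.mem_map] at h1
      obtain ⟨⟨_, b⟩, h, e⟩ := h1
      exact ⟨b, by rw [← e]; exact h⟩
    rw [Block.run_eq_of_mem_zip hc hn hb h, Block.run_eq_of_mem_zip hc hn hb rfl]
  obtain ⟨n, c, tr, hp, h1, h2⟩ := exists_assignPath hr hBT (fun q e =>
    if q ∈ T.bodies then (if (∃ s, B.run s = e ∧ T.run s = q) ∧ ¬ e.2 = q then 1 else 0) else
      (if (∀ s, B.run s ≠ e) ∧ e.2 = q then 1 else 0)) (by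
    intro q hq W hW e
    rw [if_pos hq, weight, Option.elim_some]
    by_cases h : (∃ s ∈ W, B.run s = e) ∧ ¬ e.2 = q
    · rw [if_pos h, if_pos ⟨h.1.imp fun s hs => ⟨hs.2, hW s hs.1⟩, h.2⟩]
    · rw [if_neg h]
      exact Nat.zero_le _) (by
    intro q hq e
    rw [if_neg hq, weight, Option.elim_none]
    simp [mem_allSits]) P ((allSits m, (0, 0)), []) (fun s _ => hT _ (Block.run_mem_bodies T s))
  refine ⟨n, c, tr, hp, ?_, h2.trans ?_⟩
  · rw [SoftSystem.numTypes, add_comm]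
    refine Nat.add_le_add_left (h1.trans ?_) 1
    rw [zero_add]
    exact length_le_ncard (hP.sublist List.filter_sublist) (by simp) (List.finite_toSet _)
  · rw [zero_add, sum_map_sum_comm]
    have e1 : ham (B.bodies.map Prod.snd) T.bodies =
        ((B.bodies.zip T.bodies).map fun f => neq f.1.2 f.2).sum := by
      rw [ham, List.zip_map_left, List.map_map]
      rfl
    rw [e1, ← List.map_fst_zip (l₁ := B.bodies) (l₂ := T.bodies) hlen.le, List.map_map,
      List.map_fst_zip (l₁ := B.bodies) (l₂ := T.bodies) hlen.le]
    refine List.sum_le_sum ?_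
    rintro ⟨e, t⟩ hf
    have ht := (List.of_mem_zip hf).2
    by_cases hl : ∃ s, B.run s = e
    · obtain ⟨s, hs⟩ := hl
      have hst : ∀ s, B.run s = e → T.run s = t := fun s hs => Block.run_eq_of_mem_zip hc hn hf hs
      refine (sum_map_le_of_nodup hP _ t fun q _ hq => ?_).trans ?_
      · split_ifs with h1 h2 h2
        · obtain ⟨⟨s, h3, h4⟩, -⟩ := h2
          exact absurd (h4.symm.trans (hst s h3)) hq
        · rfl
        · exact absurd hs (h2.1 s)
        · rfl
      · simp only
        rw [if_pos ht]
        split_ifs with h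
        · rw [neq_of_ne h.2]
        · exact Nat.zero_le _
    · push Not at hl
      refine (sum_map_le_of_nodup hP _ e.2 fun q _ hq => ?_).trans ?_
      · split_ifs with h1 h2 h2
        · obtain ⟨⟨s, h3, -⟩, -⟩ := h2
          exact absurd h3 (hl s)
        · rfl
        · exact absurd h2.2.symm hq
        · rfl
      · simp only
        split_ifs with h1 h2 h2
        · exact absurd trivial h2.2
        · exact Nat.zero_le _
        · rw [neq_of_ne]
          rintro rfl
          exact h1 ht
        · exact Nat.zero_le _

end

section

variable {m k : ℕ} {R : Requirements m k} {L : Libraries m k} {d : Option Bin}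
  {S T : SoftSystem m k}

/-- Systems that satisfy `R` and have at most `d` component types, with the number of component
changes that transform `S` into them. -/
noncomputable def compFixes (R : Requirements m k) (L : Libraries m k) (d : Option Bin)
    (S : SoftSystem m k) : List (ℕ × SoftSystem m k) :=
  (select (fun σ => σ.length = S.conds.length) L.sel).flatMap fun σ =>
    (select (fun e => e.1.1 = [] ∧ LeOpt (e.1.2.1 + 1) d) (search (assignStep R (slotsOf σ S))
      (dedupBy id L.prc) [((allSits m, (0, 0)), [])])).map fun e =>
        (neq S.conds σ + e.1.2.2, (slotsOf σ S).mapBodies (newProc (slotsOf σ S) e.2))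

theorem sumRel_procEdit_ham {xs ys : List (Procedure m k)} (h : xs.length = ys.length)
    (hy : ∀ p ∈ ys, p ∈ L.prc) : SumRel (ProcEdit L) xs ys (ham xs ys) 0 := by
  induction xs generalizing ys with
  | nil =>
    obtain rfl := List.length_eq_zero_iff.1 h.symm
    exact .nil
  | cons x xs ih =>
    rcases ys with _ | ⟨y, ys⟩
    · simp at h
    refine .cons (c := 0) (c' := 0) ?_ (ih (by simpa using h) fun p hp => hy p (by simp [hp]))
    by_cases hxy : x = y
    · subst hxy
      exact Or.inl ⟨neq_self _, Sim.refl _⟩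
    · exact Or.inr ⟨neq_of_ne hxy, y, hy y (by simp), Sim.refl y⟩

theorem SumRel.ham_le_of_procEdit {xs ys : List (Procedure m k)} {a c : ℕ}
    (h : SumRel (ProcEdit L) xs ys a c) (hc : c = 0) (hx : ∀ p ∈ xs, p ∈ L.prc) :
    (∀ p ∈ ys, p ∈ L.prc) ∧ ham xs ys ≤ a := by
  induction h with
  | nil => simp
  | @cons x y xs ys a c a' c' h1 _ ih =>
    obtain ⟨h2, h3⟩ := ih (by omega) fun p hp => hx p (by simp [hp])
    obtain rfl : c = 0 := by omega
    rcases h1 with ⟨rfl, h⟩ | ⟨rfl, q, hq, h⟩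
    · obtain rfl := h.eq_of_zero
      exact ⟨by simpa using ⟨hx x (by simp), h2⟩, by simpa using h3⟩
    · obtain rfl := h.eq_of_zero
      have := neq_le_one x q
      exact ⟨by simpa using ⟨hq, h2⟩, by rw [ham_cons]; omega⟩

theorem of_mem_compFixes (hS : S.DrawnFrom L) {n : ℕ} (h : (n, T) ∈ compFixes R L d S) :
    (∃ a ≤ n, SoftSystem.Derives L a 0 S T) ∧ LeOpt T.numTypes d ∧ T.Satisfies R := by
  simp only [compFixes, List.mem_flatMap, mem_select, List.mem_map] at h
  obtain ⟨σ, ⟨hσ, hl⟩, ⟨⟨U, n', c⟩, tr⟩, ⟨he, rfl, hd⟩, heq⟩ := h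
  simp only [Prod.mk.injEq] at heq
  obtain ⟨rfl, rfl⟩ := heq
  obtain ⟨e₀, he₀, hp⟩ := exists_path_of_mem_search he
  obtain rfl := List.mem_singleton.1 he₀
  have hb := map_snd_bodies_slotsOf hl
  obtain ⟨h1, h2, h3, h4, h5⟩ := newProc_spec (fun e he => by
    obtain ⟨p, hp, h⟩ := exists_mem_dedupBy id (hS.2 e.2 (hb ▸ List.mem_map_of_mem he))
    exact (show p = e.2 from h) ▸ hp) hp
  rw [hb, ← Block.bodies_mapBodies] at h1
  have hc : ((slotsOf σ S).mapBodies (newProc (slotsOf σ S) tr)).conds = σ := by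
    rw [Block.conds_mapBodies, conds_slotsOf hl]
  have hbT : ∀ p ∈ ((slotsOf σ S).mapBodies (newProc (slotsOf σ S) tr)).bodies,
      p ∈ tr.map Prod.fst := fun p hp => by
    rw [Block.bodies_mapBodies] at hp
    obtain ⟨e, -, rfl⟩ := List.mem_map.1 hp
    exact h2 e
  refine ⟨⟨_, Nat.add_le_add_left h1 _, Edit.derives ⟨neq S.conds σ, 0, _, 0, ?_,
    sumRel_procEdit_ham ?_ fun p hp => mem_of_mem_dedupBy (h4 p (hbT p hp)), rfl, rfl⟩⟩,
    fun b hb => ?_, right_allSits_iff.1 h5⟩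
  · rw [hc]
    refine ⟨hl.symm, ?_⟩
    by_cases e : S.conds = σ
    · rw [e]
      exact Or.inl ⟨neq_self _, by simp⟩
    · exact Or.inr ⟨neq_of_ne e, σ, hσ, rfl, by simp⟩
  · rw [Block.length_bodies, Block.length_bodies, hc, hl]
  · refine le_trans ?_ (hd b hb)
    rw [SoftSystem.numTypes, add_comm, ← h3, ← List.length_map (f := Prod.fst)]
    exact Nat.add_le_add_right (ncard_le_length hbT) 1

theorem assignStep_key {B : Block m (ℕ × Procedure m k)} (q : Procedure m k)
    (e₁ e₂ : (List (Situation m) × (ℕ × ℕ)) × List (Procedure m k × List (Situation m)))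
    (h : e₁.1 = e₂.1) : ∀ e' ∈ assignStep R B q e₁, ∃ e'' ∈ assignStep R B q e₂, e''.1 = e'.1 := by
  intro e' he'
  rcases mem_assignStep.1 he' with rfl | ⟨W, hW, hR, rfl⟩
  · exact ⟨_, mem_assignStep.2 (Or.inl rfl), by simp only [h]⟩
  · exact ⟨_, mem_assignStep.2 (Or.inr ⟨W, h ▸ hW, hR, rfl⟩), by simp only [h]⟩

theorem exists_mem_compFixes (hS : S.DrawnFrom L) {a : ℕ} (h : SoftSystem.Derives L a 0 S T)
    (hd : LeOpt T.numTypes d) (hr : T.Satisfies R) : ∃ n ≤ a, ∃ T', (n, T') ∈ compFixes R L d S := by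
  obtain ⟨a', ha, c', hc, a₁, c₁, a₂, c₂, ⟨hl, hs⟩, hb, rfl, rfl⟩ := h.edit
  obtain ⟨hT, hham⟩ := hb.ham_le_of_procEdit (by omega) hS.2
  -- An unchanged selector is among the selectors tried because `S` is drawn from the libraries.
  have hσ : T.conds ∈ L.sel ∧ neq S.conds T.conds ≤ a₁ := by
    rcases hs with ⟨rfl, e⟩ | ⟨rfl, q, hq, hlq, e⟩
    · rw [← eq_of_ham_eq_zero hl (by omega), neq_self]
      exact ⟨hS.1, le_rfl⟩
    · exact ⟨eq_of_ham_eq_zero hlq (by omega) ▸ hq, neq_le_one _ _⟩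
  obtain ⟨n, c, tr, hp, hn, hc'⟩ := exists_assignPath_le hr (conds_slotsOf hl.symm)
    (nodup_bodies_slotsOf hl.symm) (P := dedupBy id L.prc)
    (by simpa using nodup_map_dedupBy id L.prc) (fun p hp => by
      obtain ⟨q, hq, e⟩ := exists_mem_dedupBy id (hT p hp)
      exact (show q = p from e) ▸ hq)
  obtain ⟨e, he, hk⟩ := exists_mem_search_of_path assignStep_key (List.mem_singleton_self _) hp
  rw [map_snd_bodies_slotsOf hl.symm] at hc'
  refine ⟨neq S.conds T.conds + c, by omega, (slotsOf T.conds S).mapBodies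
    (newProc (slotsOf T.conds S) e.2), ?_⟩
  simp only [compFixes, List.mem_flatMap, mem_select, List.mem_map]
  refine ⟨T.conds, ⟨hσ.1, hl.symm⟩, e, ⟨he, ?_, fun b hb => ?_⟩, by rw [hk]⟩
  · rw [hk]
  · rw [hk]
    exact hn.trans (hd b hb)

end

/-! ### Computing the component changes. -/

section

variable {X : Type} [Scale X] {c : X → Val} {m k : X → ℕ} {R : ∀ x, Requirements (m x) (k x)}
  {B : ∀ x, Block (m x) (ℕ × Procedure (m x) (k x))} {q : ∀ x, Procedure (m x) (k x)}
  {S : ∀ x, SoftSystem (m x) (k x)}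

theorem charge_le {m k : ℕ} (B : Block m (ℕ × Procedure m k)) (q : Procedure m k)
    (u : Option (List (Situation m))) : charge B q u ≤ B.bodies.length := by
  have := List.sum_le_card_nsmul (B.bodies.map fun e => weight B e q u) 1 (by
    simp only [List.mem_map, forall_exists_index, and_imp, forall_apply_eq_imp_iff₂]
    intro e _
    cases u <;> simp only [weight, Option.elim] <;> split_ifs <;> omega)
  rw [List.length_map, smul_eq_mul, mul_one] at this
  exact this

namespace FP

theorem mapBodies {β γ : X → Type} [∀ x, Enc (β x)] [∀ x, Enc (γ x)] {b : ∀ x, Block (m x) (β x)}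
    {f : ∀ x, β x → γ x} (hb : FP c b)
    (hf : FP (ext c) (fun z : Σ x, {y // y ∈ (b x).branches} => z.2.1) →
      FP (ext c) fun z : Σ x, {y // y ∈ (b x).branches} => f z.1 z.2.1.2)
    (ho : FP c fun x => f x (b x).otherwise) : FP c fun x => (b x).mapBodies (f x) :=
  (hb.branches.map (f := fun x e => (e.1, f x e.2)) fun he => he.fst.pair (hf he)).block ho

theorem slotsOf {σ : ∀ x, Selector (m x)} (hσ : FP c σ) (hS : FP c S) :
    FP c fun x => slotsOf (σ x) (S x) :=
  (hσ.zip (hS.branches.length.range.zip (hS.branches.map fun he => he.snd))).block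
    (hS.branches.length.pair hS.otherwise)

theorem chargeNone (hm : FP c m) (hp : ∀ x, m x = Scale.par x) (hB : FP c B) (hq : FP c q) :
    FP c fun x => charge (B x) (q x) Option.none :=
  (hB.bodies.map (f := fun x e => weight (B x) e (q x) Option.none) fun he =>
    FP.ite (P := fun z : Σ x, {e // e ∈ (B x).bodies} =>
      (∀ s ∈ _root_.allSits (m z.1), (B z.1).run s ≠ z.2.1) ∧ z.2.1.2 = q z.1)
    ((FPD.ball (FP.allSits hm hp).wk fun hs => (FPD.eq (hB.wk.wk.run hs) he.wk).not).and
      (FPD.eq he.snd hq.wk)) (const 1) (const 0)).sum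

theorem chargeSome {W : ∀ x, List (Situation (m x))} (hB : FP c B) (hq : FP c q) (hW : FP c W) :
    FP c fun x => charge (B x) (q x) (Option.some (W x)) :=
  (hB.bodies.map (f := fun x e => weight (B x) e (q x) (Option.some (W x))) fun he =>
    FP.ite (P := fun z : Σ x, {e // e ∈ (B x).bodies} =>
      (∃ s ∈ W z.1, (B z.1).run s = z.2.1) ∧ ¬ z.2.1.2 = q z.1)
    ((FPD.bex hW.wk fun hs => FPD.eq (hB.wk.wk.run hs) he.wk).and (FPD.eq he.snd hq.wk).not)
    (const 1) (const 0)).sum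

theorem slotMates {W : ∀ x, List (Situation (m x))} (hm : FP c m) (hp : ∀ x, m x = Scale.par x)
    (hB : FP c B) (hW : FP c W) : FP c fun x => slotMates (B x) (W x) :=
  (FP.allSits hm hp).filter (P := fun x s => ∃ t ∈ W x, (B x).run t = (B x).run s) fun hs =>
    FPD.bex hW.wk fun ht => FPD.eq (hB.wk.wk.run ht) (hB.wk.run hs).wk

theorem newProc {tr : ∀ x, List (Procedure (m x) (k x) × List (Situation (m x)))}
    {e : ∀ x, ℕ × Procedure (m x) (k x)} (hB : FP c B) (ht : FP c tr) (he : FP c e) :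
    FP c fun x => newProc (B x) (tr x) (e x) :=
  (((ht.filter (P := fun x (f : Procedure (m x) (k x) × List (Situation (m x))) =>
    ∃ s ∈ f.2, (B x).run s = e x) fun hf =>
    FPD.bex hf.snd fun hs => FPD.eq (hB.wk.wk.run hs) he.wk.wk).append
    ((ht.filter (P := fun x (f : Procedure (m x) (k x) × List (Situation (m x))) =>
      f.1 = (e x).2) fun hf => FPD.eq hf.fst he.snd.wk).append ht)).map (f := fun _ => Prod.fst)
    fun hf => hf.fst).head?.getD he.snd

/-- No charge exceeds the number of slots, so both counters in the key are polynomially bounded; the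
remaining situations contribute the factor `2 ^ 2 ^ m`. -/
theorem assignSearch {P : ∀ x, List (Procedure (m x) (k x))} (hm : FP c m)
    (hp : ∀ x, m x = Scale.par x) (hR : FP c R) (hB : FP c B) (hP : FP c P) :
    FP c fun x => _root_.search (assignStep (R x) (B x)) (P x)
      [((_root_.allSits (m x), (0, 0)), [])] := by
  have hS := FP.allSits hm hp
  refine FP.search hP (((hS.pair ((const 0).pair (const 0))).pair nil).cons nil)
    (fun x n e => e.1.1.Sublist (_root_.allSits (m x)) ∧ e.1.2.1 ≤ n ∧
      e.1.2.2 ≤ n * (B x).bodies.length ∧ e.2.length ≤ n ∧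
      ∀ f ∈ e.2, f.1 ∈ P x ∧ f.2.Sublist (_root_.allSits (m x))) ?_ ?_
    (fun x => (enc (_root_.allSits (m x))).size + (2 * (P x).length + 1 +
      (2 * ((P x).length * (B x).bodies.length) + 1) + 1) + 1 + ((P x).length *
      ((enc (P x)).size + (enc (_root_.allSits (m x))).size + 1 + 1) + 1) + 1) ?_ ?_
    (fun x => (_root_.allSits (m x)).sublists' ×ˢ (List.range ((P x).length + 1) ×ˢ
      List.range ((P x).length * (B x).bodies.length + 1))) ?_ ?_ fun hq he => ?_
  · intro x e he
    rw [List.mem_singleton] at he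
    subst he
    simp
  · rintro x n e ⟨h1, h2, h3, h4, h5⟩ q hq e' he'
    have hc := charge_le (B x) q
    rcases mem_assignStep.1 he' with rfl | ⟨W, hW, -, rfl⟩
    · have := hc Option.none
      simp only [add_mul, one_mul]
      exact ⟨h1, by omega, by omega, by omega, h5⟩
    · have := hc (Option.some W)
      simp only [add_mul, one_mul, List.length_cons, List.forall_mem_cons]
      exact ⟨List.filter_sublist.trans h1, by omega, by omega, by omega, ⟨hq, hW.trans h1⟩, h5⟩
  · have b1 := hP.length_bdd
    have b2 := hB.bodies.length_bdd
    exact ((((hS.2.add ((((Bdd.const 2).mul b1).add (Bdd.const 1)).add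
      (((Bdd.const 2).mul (b1.mul b2)).add (Bdd.const 1)) |>.add (Bdd.const 1))).add
      (Bdd.const 1)).add ((b1.mul (((hP.2.add hS.2).add (Bdd.const 1)).add (Bdd.const 1))).add
      (Bdd.const 1))).add (Bdd.const 1))
  · rintro x n e hn ⟨h1, h2, h3, h4, h5⟩
    rw [size_enc_pair, size_enc_pair, size_enc_pair, size_enc_nat, size_enc_nat]
    have k1 := size_enc_le_of_sublist h1
    have k2 := h3.trans (Nat.mul_le_mul_right _ hn)
    have k3 := size_enc_list_le (n := (P x).length)
      (b := (enc (P x)).size + (enc (_root_.allSits (m x))).size + 1) (h4.trans hn) fun f hf => by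
        have := size_enc_le_of_mem (h5 f hf).1
        have := size_enc_le_of_sublist (h5 f hf).2
        rw [size_enc_pair]
        omega
    omega
  · refine Bdd.mono ((Bdd.par (X := X) fun n => 2 ^ 2 ^ n).mul ((hP.length_bdd.add
      (Bdd.const 1)).mul ((hP.length_bdd.mul hB.bodies.length_bdd).add (Bdd.const 1)))) fun x => ?_
    rw [List.length_product, List.length_product, List.length_sublists', length_allSits,
      List.length_range, List.length_range, ← hp]
  · rintro x n e hn ⟨h1, h2, h3, -⟩
    rw [List.mem_product, List.mem_product, List.mem_sublists', List.mem_range, List.mem_range]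
    exact ⟨h1, Nat.lt_succ_of_le (h2.trans hn),
      Nat.lt_succ_of_le (h3.trans (Nat.mul_le_mul_right _ hn))⟩
  · have hsub := he.fst.fst.sublists (Bdd.mono (Bdd.par fun n => 2 ^ 2 ^ n) fun z => by
      obtain ⟨n, -, h, -⟩ := z.2.2.2
      refine Nat.pow_le_pow_right (by norm_num) (h.length_le.trans ?_)
      rw [length_allSits, hp]
      rfl)
    refine ((he.fst.fst.pair (he.fst.snd.fst.pair (he.fst.snd.snd.add
      (FP.chargeNone hm.wk (fun _ => hp _) hB.wk hq)))).pair he.snd).cons ?_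
    refine (hsub.filter (inst := fun _ _ => Classical.propDecidable _) fun hW =>
      FPD.right hR.wk.wk (FP.slotMates hm.wk.wk (fun _ => hp _) hB.wk.wk hW) fun hs =>
        hq.wk.wk.run hs).map fun hW => ?_
    exact ((he.fst.fst.wk.filter (P := fun z s => s ∉ z.2.1) fun hs =>
      (FPD.mem hs hW.wk).not).pair ((he.fst.snd.fst.wk.add (const 1)).pair
        (he.fst.snd.snd.wk.add (FP.chargeSome hB.wk.wk hq.wk hW)))).pair
        ((hq.wk.pair hW).cons he.snd.wk)

theorem compFixes {L : ∀ x, Libraries (m x) (k x)} {d : X → Option Bin} (hm : FP c m)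
    (hp : ∀ x, m x = Scale.par x) (hR : FP c R) (hL : FP c L) (hd : FP c d) (hS : FP c S) :
    FP c fun x => compFixes (R x) (L x) (d x) (S x) :=
  (hL.librariesSel.select (P := fun x (σ : Selector (m x)) => σ.length = (S x).conds.length)
    fun hσ => FPD.eq hσ.length hS.conds.length.wk).flatMap (f := fun x σ =>
      (_root_.select (fun e => e.1.1 = [] ∧ LeOpt (e.1.2.1 + 1) (d x)) (_root_.search
        (assignStep (R x) (_root_.slotsOf σ (S x))) (_root_.dedupBy id (L x).prc)
        [((_root_.allSits (m x), (0, 0)), [])])).map fun e =>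
        (_root_.neq (S x).conds σ + e.1.2.2,
          (_root_.slotsOf σ (S x)).mapBodies (_root_.newProc (_root_.slotsOf σ (S x)) e.2)))
    fun hσ => ((FP.assignSearch hm.wk (fun _ => hp _) hR.wk (hσ.slotsOf hS.wk)
      (hL.librariesPrc.dedupBy (key := fun _ => id) fun hq => hq).wk).select
      (P := fun z e => e.1.1 = [] ∧ LeOpt (e.1.2.1 + 1) (d z.1))
      fun he => (FPD.isNil he.fst.fst).and
        (FPD.leOpt (he.fst.snd.fst.add (const 1)) hd.wk.wk)).map
      (f := fun z e => (_root_.neq (S z.1).conds z.2.1 + e.1.2.2, (_root_.slotsOf z.2.1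
        (S z.1)).mapBodies (_root_.newProc (_root_.slotsOf z.2.1 (S z.1)) e.2))) fun he =>
    ((hS.conds.wk.neq hσ).wk.add he.fst.snd.snd).pair ((hσ.slotsOf hS.wk).wk.mapBodies
      (fun hf => FP.newProc (hσ.slotsOf hS.wk).wk.wk he.snd.wk hf.snd)
      (FP.newProc (hσ.slotsOf hS.wk).wk he.snd (hσ.slotsOf hS.wk).wk.otherwise))

end FP

end

instance : Scale SRecComp.Inst where
  par := SRecCompInput.nI
  size x := (SRecComp.codeInst x).size
  size_pos _ := Val.size_pos _

instance (x : SRecComp.Inst) : Enc (SRecComp.Out x) :=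
  inferInstanceAs (Enc (SoftSystem x.nI x.nA))

theorem SRecComp.fpTractable : SRecComp.FPTractable (fun x : SRecCompInput => x.nI) := by
  refine SearchProblem.FPTractable.of_FP (fun _ => rfl) (fun _ => rfl) (fun _ _ => rfl)
    (fun x : SRecCompInput => pick (compFixes (x.R ++ x.Rnew) x.L (some ⟨x.d⟩) x.S)
      (some ⟨x.cl⟩)) ?_ ?_ ?_
  · have hm : FP (fun x : {x // SRecComp.Valid x} => SRecComp.codeInst x.1)
      (fun x => x.1.nI) := FP.entry 0 (fun _ => rfl) fun _ => le_rfl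
    have hR : FP (fun x : {x // SRecComp.Valid x} => SRecComp.codeInst x.1)
      (fun x => x.1.R) := FP.entry 2 (fun _ => rfl) fun _ => le_rfl
    have hS : FP (fun x : {x // SRecComp.Valid x} => SRecComp.codeInst x.1)
      (fun x => x.1.S) := FP.entry 3 (fun _ => rfl) fun _ => le_rfl
    have hL : FP (fun x : {x // SRecComp.Valid x} => SRecComp.codeInst x.1)
      (fun x => x.1.L) := FP.entry 4 (fun _ => rfl) fun _ => le_rfl
    have hN : FP (fun x : {x // SRecComp.Valid x} => SRecComp.codeInst x.1)
      (fun x => x.1.Rnew) := FP.entry 5 (fun _ => rfl) fun _ => le_rfl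
    have hc : FP (fun x : {x // SRecComp.Valid x} => SRecComp.codeInst x.1)
      (fun x => (⟨x.1.cl⟩ : Bin)) := FP.entry 6 (fun _ => rfl) fun _ => le_rfl
    have hd : FP (fun x : {x // SRecComp.Valid x} => SRecComp.codeInst x.1)
      (fun x => (⟨x.1.d⟩ : Bin)) := FP.entry 7 (fun _ => rfl) fun _ => le_rfl
    exact (FP.compFixes hm (fun _ => rfl) (hR.append hN) hL hd.some hS).pick hc.some
  · intro x hx y hy
    obtain ⟨n, hn, hb⟩ := mem_of_pick_eq_some hy
    obtain ⟨⟨a, ha, h⟩, hd, hr⟩ := of_mem_compFixes hx.2 hn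
    exact ⟨⟨a, ha.trans (hb _ rfl), h⟩, hd _ rfl, hr⟩
  · rintro x hx hn y ⟨⟨a, ha, h⟩, hd, hr⟩
    obtain ⟨n, hna, T, hT⟩ := exists_mem_compFixes (d := some ⟨x.d⟩) hx.2 h (fun b hb => by
      obtain rfl := Option.mem_some_iff.1 hb
      exact hd) hr
    exact not_mem_of_pick_eq_none hn _ _ hT fun b hb => by
      obtain rfl := Option.mem_some_iff.1 hb
      exact hna.trans ha

/-! ### Reconfiguration by component and code changes -/

section

variable {m k : ℕ} {α β : Type}

/-- The block with conditions `cs` and bodies `l`, if there is one more body than conditions. -/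
def Block.ofLists (cs : List (Literal m)) (l : List α) : List (Block m α) :=
  (l.drop cs.length).map fun o => ⟨cs.zip l, o⟩

theorem Block.mem_ofLists {cs : List (Literal m)} {l : List α} (h : l.length = cs.length + 1)
    {b : Block m α} : b ∈ Block.ofLists cs l ↔ b.conds = cs ∧ b.bodies = l := by
  rcases List.eq_nil_or_concat l with rfl | ⟨l, o, rfl⟩
  · simp at h
  have hl : cs.length = l.length := by simpa using h.symm
  have hz : cs.zip (l ++ [o]) = cs.zip l := by
    have := List.zip_append (l₁ := cs) (r₁ := []) (l₂ := l) (r₂ := [o]) hl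
    simpa using this
  have key : (⟨cs.zip l, o⟩ : Block m α).conds = cs ∧
      (⟨cs.zip l, o⟩ : Block m α).bodies = l ++ [o] :=
    ⟨List.map_fst_zip hl.le, by rw [Block.bodies, List.map_snd_zip hl.ge]⟩
  rw [List.concat_eq_append, Block.ofLists, hz, hl, List.drop_left, List.map_singleton,
    List.mem_singleton]
  constructor
  · rintro rfl
    exact key
  · rintro ⟨h1, h2⟩
    exact Block.ext_conds_bodies (h1.trans key.1.symm) (h2.trans key.2.symm)

theorem select_map (P : β → Prop) (f : α → β) (l : List α) :
    select P (l.map f) = (select (fun a => P (f a)) l).map f := by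
  simp [select, List.filter_map, Function.comp_def]

theorem sum_select (P : α → Prop) (f : α → ℕ) (l : List α) : ((select P l).map f).sum =
    (l.map fun a => open Classical in if P a then f a else 0).sum := by
  classical
  induction l with
  | nil => rfl
  | cons a l ih =>
    rw [select] at ih ⊢
    by_cases h : P a <;> simp [h, ih]

theorem sum_eq_sum_select {ts : List β} (hn : ts.Nodup) (key : α → β) (f : α → ℕ) (l : List α)
    (h : ∀ a ∈ l, key a ∈ ts) :
    (l.map f).sum = (ts.map fun t => ((select (fun a => key a = t) l).map f).sum).sum := by
  classical
  simp only [sum_select]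
  rw [sum_map_sum_comm]
  congr 1
  refine List.map_congr_left fun a ha => le_antisymm ?_ ?_
  · have := List.single_le_sum (l := ts.map fun t => if key a = t then f a else 0) (by simp) _
      (List.mem_map_of_mem (h a ha))
    rwa [if_pos rfl] at this
  · refine (sum_map_le_of_nodup hn _ (key a) fun b _ hb => if_neg fun e => hb e.symm).trans ?_
    rw [if_pos rfl]

theorem SumRel.map {γ : Type} {e : α → β → ℕ → ℕ → Prop} {f : γ → α} {g : γ → β} {a c : γ → ℕ} :
    ∀ l : List γ, (∀ x ∈ l, e (f x) (g x) (a x) (c x)) →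
      SumRel e (l.map f) (l.map g) (l.map a).sum (l.map c).sum
  | [], _ => .nil
  | x :: l, h => .cons (h x (by simp)) (SumRel.map l fun y hy => h y (by simp [hy]))

/-- An entry of minimal cost. -/
noncomputable def best (l : List (ℕ × α)) : Option (ℕ × α) :=
  (select (fun e => ∀ f ∈ l, e.1 ≤ f.1) l).head?

theorem exists_best {l : List (ℕ × α)} (h : l ≠ []) :
    ∃ e ∈ l, best l = some e ∧ ∀ f ∈ l, e.1 ≤ f.1 := by
  obtain ⟨e, he, hmin⟩ : ∃ e ∈ l, ∀ f ∈ l, e.1 ≤ f.1 := by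
    induction l with
    | nil => exact absurd rfl h
    | cons e l ih =>
      rcases l with _ | ⟨e', l⟩
      · exact ⟨e, by simp, by simp⟩
      · obtain ⟨f, hf, hmin⟩ := ih (by simp)
        rcases le_total e.1 f.1 with h | h
        · exact ⟨e, by simp, List.forall_mem_cons.2 ⟨le_rfl, fun g hg => h.trans (hmin g hg)⟩⟩
        · exact ⟨f, List.mem_cons_of_mem _ hf, List.forall_mem_cons.2 ⟨h, hmin⟩⟩
  have he' : e ∈ select (fun e => ∀ f ∈ l, e.1 ≤ f.1) l := mem_select.2 ⟨he, hmin⟩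
  rcases hl : select (fun e => ∀ f ∈ l, e.1 ≤ f.1) l with _ | ⟨g, gs⟩
  · rw [hl] at he'
    simp at he'
  · have hg : g ∈ select (fun e => ∀ f ∈ l, e.1 ≤ f.1) l := by
      rw [hl]
      exact List.mem_cons_self
    exact ⟨g, (mem_select.1 hg).1, by rw [best, hl]; rfl, (mem_select.1 hg).2⟩

variable {R : Requirements m k} {L : Libraries m k} {S T : SoftSystem m k} {d cl : Option Bin}

/-- Procedures that are right in `V`, with the total distance from the procedures in `srcs`. -/
noncomputable def fixAll (R : Requirements m k) (srcs : List (Procedure m k))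
    (V : List (Situation m)) : List (ℕ × Procedure m k) :=
  srcs.flatMap fun p => fixMulti R p.branches.length srcs V

theorem of_mem_fixAll {srcs : List (Procedure m k)} {V : List (Situation m)} {n : ℕ}
    {p' : Procedure m k} (h : (n, p') ∈ fixAll R srcs V) :
    (∀ p ∈ srcs, p.conds.length = p'.conds.length) ∧ Right R p'.run V ∧
      n = (srcs.map fun p => p.dist p').sum := by
  obtain ⟨q, hq, h⟩ := List.mem_flatMap.1 h
  obtain ⟨h1, h2, h3, h4⟩ := of_mem_fixMulti h
  exact ⟨fun p hp => by rw [Block.length_conds, Block.length_conds, h1 p hp, h2], h3, h4⟩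

theorem exists_mem_fixAll {srcs : List (Procedure m k)} {V : List (Situation m)}
    {p' : Procedure m k} (h0 : srcs ≠ []) (hs : ∀ p ∈ srcs, p.conds.length = p'.conds.length)
    (hr : Right R p'.run V) : ∃ q, ((srcs.map fun p => p.dist p').sum, q) ∈ fixAll R srcs V := by
  simp only [Block.length_conds] at hs
  obtain ⟨p, hp⟩ := List.exists_mem_of_ne_nil _ h0
  obtain ⟨q, hq⟩ := exists_mem_fixMulti (J := p.branches.length)
    (fun p' hp' => (hs p' hp').trans (hs p hp).symm) (hs p hp).symm hr
  exact ⟨q, List.mem_flatMap.2 ⟨p, hp, hq⟩⟩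

/-- Systems with as many slots as `S`, where each slot contains the present procedure, a label, and
a flag that says whether the procedure is replaced by one from the library. Slots with the same
label receive the same new procedure. -/
noncomputable def skeletons (S : SoftSystem m k) : List (Block m (Procedure m k × (ℕ × Bool))) :=
  (words (allLits m) S.conds.length).flatMap fun σ =>
    (words ((List.range (m + 2)).flatMap fun t => [(t, false), (t, true)])
      S.bodies.length).flatMap fun τ => Block.ofLists σ (S.bodies.zip τ)

theorem mem_skeletons {B : Block m (Procedure m k × (ℕ × Bool))} : B ∈ skeletons S ↔
    B.conds.length = S.conds.length ∧ B.bodies.map Prod.fst = S.bodies ∧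
      ∀ e ∈ B.bodies, e.2.1 < m + 2 := by
  simp only [skeletons, List.mem_flatMap, mem_words]
  constructor
  · rintro ⟨σ, ⟨hσ, -⟩, τ, ⟨hτ, hmem⟩, h⟩
    obtain ⟨rfl, hb⟩ := (Block.mem_ofLists (by
      rw [List.length_zip, hτ, min_self, hσ, Block.length_bodies])).1 h
    rw [hb]
    refine ⟨hσ, List.map_fst_zip hτ.ge, fun e he => ?_⟩
    obtain ⟨t, ht, h⟩ := hmem _ (List.of_mem_zip he).2
    simp only [List.mem_range] at ht
    rcases List.mem_cons.1 h with h | h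
    · rw [h]; exact ht
    · rw [List.mem_singleton.1 h]; exact ht
  · rintro ⟨hc, hb, hm⟩
    refine ⟨B.conds, ⟨hc, fun l _ => mem_allLits l⟩, B.bodies.map Prod.snd, ⟨?_, ?_⟩, ?_⟩
    · rw [← hb, List.length_map, List.length_map]
    · intro t ht
      obtain ⟨⟨p, t, b⟩, he, rfl⟩ := List.mem_map.1 ht
      refine ⟨t, List.mem_range.2 (hm _ he), ?_⟩
      cases b <;> simp
    · rw [← hb, ← List.unzip_fst, ← List.unzip_snd, List.zip_unzip]
      exact (Block.mem_ofLists (Block.length_bodies B)).2 ⟨rfl, rfl⟩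

variable {B : Block m (Procedure m k × (ℕ × Bool))}

/-- The slots with label `t`. -/
noncomputable def group (B : Block m (Procedure m k × (ℕ × Bool))) (t : ℕ) :
    List (Procedure m k × (ℕ × Bool)) :=
  select (fun e => e.2.1 = t) B.bodies

/-- The situations in which a slot with label `t` is executed. -/
noncomputable def area (B : Block m (Procedure m k × (ℕ × Bool))) (t : ℕ) : List (Situation m) :=
  select (fun s => (B.run s).2.1 = t) (allSits m)

/-- The procedure from which the new procedure in the slot `e` arises by code changes. -/
def source (q : Procedure m k) (e : Procedure m k × (ℕ × Bool)) : Procedure m k :=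
  if e.2.2 = true then q else e.1

/-- A single library procedure `q` serves all replaced slots of the group: they end in the same
procedure, so a source nearest to it is best for all of them. -/
noncomputable def options (R : Requirements m k) (L : Libraries m k)
    (B : Block m (Procedure m k × (ℕ × Bool))) (t : ℕ) : List (ℕ × Procedure m k) :=
  L.prc.flatMap fun q => fixAll R ((group B t).map (source q)) (area B t)

noncomputable def labels (B : Block m (Procedure m k × (ℕ × Bool))) : List ℕ :=
  dedupBy id (B.bodies.map fun e => e.2.1)

theorem mem_labels {t : ℕ} : t ∈ labels B ↔ ∃ e ∈ B.bodies, e.2.1 = t := by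
  rw [← List.mem_map]
  refine ⟨mem_of_mem_dedupBy, fun h => ?_⟩
  obtain ⟨t', ht, e⟩ := exists_mem_dedupBy id h
  exact (show t' = t from e) ▸ ht

theorem nodup_labels : (labels B).Nodup := by
  have := nodup_map_dedupBy id (B.bodies.map fun e => e.2.1)
  rwa [List.map_id] at this

def flags (B : Block m (Procedure m k × (ℕ × Bool))) : ℕ :=
  (B.bodies.map fun e => if e.2.2 = true then 1 else 0).sum

/-- The default value is immaterial, since skeletons with a label without options are discarded. -/
noncomputable def labelCost (R : Requirements m k) (L : Libraries m k)
    (B : Block m (Procedure m k × (ℕ × Bool))) (t : ℕ) : ℕ :=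
  (best (options R L B t)).elim 0 Prod.fst

noncomputable def fixedProc (R : Requirements m k) (L : Libraries m k)
    (B : Block m (Procedure m k × (ℕ × Bool))) (e : Procedure m k × (ℕ × Bool)) : Procedure m k :=
  (best (options R L B e.2.1)).elim e.1 Prod.snd

/-- The ways to replace the selector of `S`, before the code changes that transform it to `σ`. -/
noncomputable def selOptions (L : Libraries m k) (S : SoftSystem m k) (σ : Selector m) :
    List (ℕ × ℕ) :=
  (0, ham S.conds σ) :: (select (fun q => q.length = σ.length) L.sel).map fun q => (1, ham q σ)

theorem mem_selOptions {σ : Selector m} (h : S.conds.length = σ.length) {z : ℕ × ℕ} :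
    z ∈ selOptions L S σ ↔ SelEdit L S.conds σ z.1 z.2 := by
  obtain ⟨a, c⟩ := z
  simp only [selOptions, List.mem_cons, List.mem_map, mem_select, SelEdit, h, true_and,
    Prod.mk.injEq]
  refine or_congr_right ⟨?_, ?_⟩
  · rintro ⟨q, ⟨hq, hl⟩, rfl, rfl⟩
    exact ⟨rfl, q, hq, hl, rfl⟩
  · rintro ⟨rfl, q, hq, hl, rfl⟩
    exact ⟨q, ⟨hq, hl⟩, rfl, rfl⟩

/-- Systems that satisfy `R`, have at most `d` component types and arise from `S` by at most `cl`
component changes and some code changes, with the number of code changes. -/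
noncomputable def mixedFixes (R : Requirements m k) (L : Libraries m k) (d cl : Option Bin)
    (S : SoftSystem m k) : List (ℕ × SoftSystem m k) :=
  (skeletons S).flatMap fun B => (select (fun z => (∀ t ∈ labels B, ¬ options R L B t = []) ∧
    LeOpt ((labels B).length + 1) d ∧ LeOpt (z.1 + flags B) cl) (selOptions L S B.conds)).map
      fun z => (z.2 + ((labels B).map (labelCost R L B)).sum, B.mapBodies (fixedProc R L B))

theorem fixedProc_spec {t : ℕ} (ht : ¬ options R L B t = []) : ∃ q ∈ L.prc,
    labelCost R L B t = ((group B t).map fun e => (source q e).dist (fixedProc R L B e)).sum ∧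
    ∀ e ∈ group B t, (source q e).conds.length = (fixedProc R L B e).conds.length ∧
      Right R (fixedProc R L B e).run (area B t) := by
  obtain ⟨⟨n, p⟩, he, hbest, -⟩ := exists_best ht
  obtain ⟨q, hq, h⟩ := List.mem_flatMap.1 he
  obtain ⟨h1, h2, h3⟩ := of_mem_fixAll h
  have hp : ∀ e ∈ group B t, fixedProc R L B e = p := fun e he => by
    rw [fixedProc, (mem_select.1 he).2, hbest]
    rfl
  refine ⟨q, hq, ?_, fun e he => ?_⟩
  · simp only [labelCost, hbest, Option.elim_some, h3, List.map_map]
    exact congrArg List.sum <| List.map_congr_left fun e he => by rw [hp e he]; rfl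
  · rw [hp e he]
    exact ⟨h1 _ (List.mem_map_of_mem he), h2⟩

theorem of_mem_mixedFixes {n : ℕ} (h : (n, T) ∈ mixedFixes R L d cl S) :
    (∃ a, LeOpt a cl ∧ SoftSystem.Derives L a n S T) ∧ LeOpt T.numTypes d ∧ T.Satisfies R := by
  classical
  simp only [mixedFixes, List.mem_flatMap, mem_select, List.mem_map] at h
  obtain ⟨B, hB, ⟨a, c⟩, ⟨hz, hopt, hd, hcl⟩, heq⟩ := h
  simp only [Prod.mk.injEq] at heq
  obtain ⟨rfl, rfl⟩ := heq
  obtain ⟨hl, hb, -⟩ := mem_skeletons.1 hB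
  have hlab : ∀ e ∈ B.bodies, e.2.1 ∈ labels B := fun e he => mem_labels.2 ⟨e, he, rfl⟩
  have hgrp : ∀ e ∈ B.bodies, e ∈ group B e.2.1 := fun e he => mem_select.2 ⟨he, rfl⟩
  have : Nonempty (Procedure m k) := ⟨S.otherwise⟩
  choose! q hq hcost hfix using fun t (ht : t ∈ labels B) => fixedProc_spec (hopt t ht)
  refine ⟨⟨_, hcl, Edit.derives ⟨a, c, flags B, _, ?_, ?_, rfl, rfl⟩⟩, fun b hb => ?_,
    fun r hr => ?_⟩
  · rw [Block.conds_mapBodies]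
    exact (mem_selOptions hl.symm).1 hz
  -- The cost is computed label by label, and has to be regrouped slot by slot for the normal form.
  · have e1 : ((labels B).map (labelCost R L B)).sum = (B.bodies.map fun e =>
        (source (q e.2.1) e).dist (fixedProc R L B e)).sum := by
      rw [sum_eq_sum_select nodup_labels (fun e => e.2.1) _ B.bodies hlab]
      congr 1
      refine List.map_congr_left fun t ht => ?_
      rw [hcost t ht, group]
      congr 1
      exact List.map_congr_left fun e he => by rw [(mem_select.1 he).2]
    rw [Block.bodies_mapBodies, ← hb, e1]
    refine SumRel.map B.bodies fun e he => ?_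
    have h1 := (hfix _ (hlab e he) e (hgrp e he)).1
    by_cases hf : e.2.2 = true
    · rw [if_pos hf]
      rw [source, if_pos hf] at h1 ⊢
      exact Or.inr ⟨rfl, _, hq _ (hlab e he), h1, rfl⟩
    · rw [if_neg hf]
      rw [source, if_neg hf] at h1 ⊢
      exact Or.inl ⟨rfl, h1, rfl⟩
  · refine le_trans ?_ (hd b hb)
    rw [SoftSystem.numTypes, add_comm, ← List.length_map (f := fun t =>
      (best (options R L B t)).elim S.otherwise Prod.snd)]
    refine Nat.add_le_add_right (ncard_le_length fun p hp => ?_) 1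
    rw [Set.mem_ofPred_eq, Block.bodies_mapBodies] at hp
    obtain ⟨e, he, rfl⟩ := List.mem_map.1 hp
    refine List.mem_map.2 ⟨_, hlab e he, ?_⟩
    obtain ⟨f, -, hbest, -⟩ := exists_best (hopt _ (hlab e he))
    rw [fixedProc, hbest]
    rfl
  · have he := B.run_mem_bodies r.1
    show ((B.mapBodies (fixedProc R L B)).run r.1).run r.1 = r.2
    rw [Block.run_mapBodies]
    exact (hfix _ (hlab _ he) _ (hgrp _ he)).2 r hr (mem_select.2 ⟨mem_allSits _, rfl⟩)

/-- The data of the slots, where `x.2.1` tells whether the procedure `x.1` is replaced by one from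
the library, and `x.2.2` contains the procedure before and after the code changes. -/
theorem SumRel.exists_data {xs ys : List (Procedure m k)} {a c : ℕ}
    (h : SumRel (ProcEdit L) xs ys a c) :
    ∃ D : List (Procedure m k × (Bool × (Procedure m k × Procedure m k))),
      D.map Prod.fst = xs ∧ D.map (fun x => x.2.2.2) = ys ∧
      (∀ x ∈ D, x.2.2.1.conds.length = x.2.2.2.conds.length ∧ (¬ x.2.1 = true → x.2.2.1 = x.1) ∧
        (x.2.1 = true → x.2.2.1 ∈ L.prc)) ∧
      a = (D.map fun x => if x.2.1 = true then 1 else 0).sum ∧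
      c = (D.map fun x => x.2.2.1.dist x.2.2.2).sum := by
  induction h with
  | nil => exact ⟨[], rfl, rfl, by simp, rfl, rfl⟩
  | @cons x y xs ys a c a' c' h _ ih =>
    obtain ⟨D, rfl, rfl, h3, rfl, rfl⟩ := ih
    rcases h with ⟨rfl, hl, rfl⟩ | ⟨rfl, q, hq, hl, rfl⟩
    · exact ⟨(x, (false, (x, y))) :: D, rfl, rfl, List.forall_mem_cons.2 ⟨⟨hl, fun _ => rfl,
        fun h => absurd h (by simp)⟩, h3⟩, by simp, by simp [Block.dist]⟩
    · exact ⟨(x, (true, (q, y))) :: D, rfl, rfl, List.forall_mem_cons.2 ⟨⟨hl,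
        fun h => absurd rfl h, fun _ => hq⟩, h3⟩, by simp, by simp [Block.dist]⟩

/-- A slot is labelled by the first position at which its new procedure occurs in `T`. Equal labels
then mean equal new procedures, there are no more labels than different procedures, and by `hlen`
all labels are below `m + 2`. -/
theorem exists_mem_mixedFixes (hS : S.DrawnFrom L) (hlen : S.conds.length ≤ m + 1) {a c : ℕ}
    (h : SoftSystem.Derives L a c S T) (hd : LeOpt T.numTypes d) (hcl : LeOpt a cl)
    (hr : T.Satisfies R) : ∃ n ≤ c, ∃ T', (n, T') ∈ mixedFixes R L d cl S := by
  classical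
  obtain ⟨_, ha, _, hc, a₁, c₁, a₂, c₂, hs, hb, rfl, rfl⟩ := h.edit
  obtain ⟨Dl, hD1, hD2, hD, rfl, rfl⟩ := hb.exists_data
  have hDl : Dl.length = T.conds.length + 1 := by
    rw [← Block.length_bodies, ← hD2, List.length_map]
  obtain ⟨D, hDc, rfl⟩ : ∃ D : Block m (Procedure m k × (Bool × (Procedure m k × Procedure m k))),
      D.conds = T.conds ∧ D.bodies = Dl := by
    obtain ⟨b, hb⟩ : ∃ b, b ∈ Block.ofLists T.conds Dl := by
      refine List.exists_mem_of_ne_nil _ fun h => ?_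
      have := congrArg List.length h
      simp [Block.ofLists, hDl] at this
    exact ⟨b, (Block.mem_ofLists hDl).1 hb⟩
  have hTD : T = D.mapBodies fun x => x.2.2.2 := Block.ext_conds_bodies
    (by rw [Block.conds_mapBodies, hDc]) (by rw [Block.bodies_mapBodies, hD2])
  have hTb : ∀ x ∈ D.bodies, x.2.2.2 ∈ T.bodies := fun x hx => hD2 ▸ List.mem_map_of_mem hx
  set B : Block m (Procedure m k × (ℕ × Bool)) :=
    D.mapBodies fun x => (x.1, (T.bodies.idxOf x.2.2.2, x.2.1)) with hB
  have hBb : B.bodies = D.bodies.map fun x => (x.1, (T.bodies.idxOf x.2.2.2, x.2.1)) := by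
    rw [hB, Block.bodies_mapBodies]
  have hBc : B.conds = T.conds := by rw [hB, Block.conds_mapBodies, hDc]
  have hkey : ∀ t ∈ labels B, ∃ e ∈ options R L B t, e.1 ≤
      ((select (fun x => T.bodies.idxOf x.2.2.2 = t) D.bodies).map fun x =>
        x.2.2.1.dist x.2.2.2).sum := by
    intro t ht
    obtain ⟨e, he, het⟩ := mem_labels.1 ht
    rw [hBb] at he
    obtain ⟨x, hx, rfl⟩ := List.mem_map.1 he
    simp only at het
    have hsame : ∀ y ∈ D.bodies, T.bodies.idxOf y.2.2.2 = t → y.2.2.2 = x.2.2.2 :=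
      fun y hy e => (List.idxOf_inj (hTb y hy)).1 (e.trans het.symm)
    -- Among the library procedures used in this group, `q` is one nearest to the common new
    -- procedure.
    obtain ⟨q, hq, hq1, hq2⟩ : ∃ q ∈ L.prc, (∀ y ∈ D.bodies, T.bodies.idxOf y.2.2.2 = t →
        y.2.1 = true → q.conds.length = x.2.2.2.conds.length) ∧ ∀ y ∈ D.bodies,
        T.bodies.idxOf y.2.2.2 = t → y.2.1 = true → q.dist x.2.2.2 ≤ y.2.2.1.dist x.2.2.2 := by
      by_cases h0 : ((select (fun y => T.bodies.idxOf y.2.2.2 = t ∧ y.2.1 = true) D.bodies).map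
          fun y => (y.2.2.1.dist x.2.2.2, y.2.2.1)) = []
      · have h0 : ∀ y ∈ D.bodies, T.bodies.idxOf y.2.2.2 = t → ¬ y.2.1 = true := fun y hy e h => by
          have : y ∈ select (fun y => T.bodies.idxOf y.2.2.2 = t ∧ y.2.1 = true) D.bodies :=
            mem_select.2 ⟨hy, e, h⟩
          simp [List.map_eq_nil_iff.1 h0] at this
        -- If no slot of the group is replaced, any library procedure will do, and the library has
        -- one because it contains those of `S`.
        exact ⟨S.otherwise, hS.2 _ (List.mem_append_right _ (List.mem_singleton_self _)),
          fun y hy e h => absurd h (h0 y hy e), fun y hy e h => absurd h (h0 y hy e)⟩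
      · obtain ⟨e, he, -, hmin⟩ := exists_best h0
        obtain ⟨y, hy, rfl⟩ := List.mem_map.1 he
        obtain ⟨hy, hyt, hyf⟩ := mem_select.1 hy
        obtain ⟨h1, -, h3⟩ := hD y hy
        refine ⟨y.2.2.1, h3 hyf, fun _ _ _ _ => by rw [h1, hsame y hy hyt], fun z hz hzt hzf => ?_⟩
        exact hmin _ (List.mem_map.2 ⟨z, mem_select.2 ⟨hz, hzt, hzf⟩, rfl⟩)
    have hg : (group B t).map (source q) = (select (fun y => T.bodies.idxOf y.2.2.2 = t)
        D.bodies).map fun y => if y.2.1 = true then q else y.1 := by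
      rw [group, hBb, select_map, List.map_map]
      rfl
    obtain ⟨p, hp⟩ := exists_mem_fixAll (R := R) (srcs := (group B t).map (source q))
      (V := area B t) (p' := x.2.2.2) (by
        rw [hg]
        refine fun h => ?_
        have : x ∈ select (fun y => T.bodies.idxOf y.2.2.2 = t) D.bodies := mem_select.2 ⟨hx, het⟩
        simp [List.map_eq_nil_iff.1 h] at this) (by
        rw [hg]
        intro p hp
        obtain ⟨y, hy, rfl⟩ := List.mem_map.1 hp
        obtain ⟨hy, hyt⟩ := mem_select.1 hy
        obtain ⟨h1, h2, -⟩ := hD y hy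
        split_ifs with hf
        · exact hq1 y hy hyt hf
        · rw [← h2 hf, h1, hsame y hy hyt]) (by
        intro r hr' hV
        have h1 := (mem_select.1 hV).2
        rw [hB, Block.run_mapBodies] at h1
        rw [← hr r hr', ← hsame _ (D.run_mem_bodies r.1) h1]
        show _ = (T.run r.1).run r.1
        rw [hTD, Block.run_mapBodies])
    refine ⟨_, List.mem_flatMap.2 ⟨q, hq, hp⟩, ?_⟩
    rw [hg, List.map_map]
    refine List.sum_le_sum fun y hy => ?_
    obtain ⟨hy, hyt⟩ := mem_select.1 hy
    rw [hsame y hy hyt, Function.comp_apply]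
    split_ifs with hf
    · exact hq2 y hy hyt hf
    · rw [(hD y hy).2.1 hf]
  have hopt : ∀ t ∈ labels B, ¬ options R L B t = [] := fun t ht => by
    obtain ⟨e, he, -⟩ := hkey t ht
    exact List.ne_nil_of_mem he
  have hcost : ((labels B).map (labelCost R L B)).sum ≤
      (D.bodies.map fun x => x.2.2.1.dist x.2.2.2).sum := by
    rw [sum_eq_sum_select nodup_labels (fun x => T.bodies.idxOf x.2.2.2) _ D.bodies fun x hx =>
      mem_labels.2 ⟨_, hBb ▸ List.mem_map_of_mem hx, rfl⟩]
    refine List.sum_le_sum fun t ht => ?_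
    obtain ⟨e, he, hle⟩ := hkey t ht
    obtain ⟨f, -, hbest, hmin⟩ := exists_best (hopt t ht)
    rw [labelCost, hbest]
    exact (hmin e he).trans hle
  have hflags : flags B = (D.bodies.map fun x => if x.2.1 = true then 1 else 0).sum := by
    rw [flags, hBb, List.map_map]
    rfl
  have hlab : (labels B).length + 1 ≤ T.numTypes := by
    have hfin : {p | p ∈ T.bodies}.Finite := List.finite_toSet _
    rw [SoftSystem.numTypes, add_comm]
    refine Nat.add_le_add_left (le_trans ?_ (Set.ncard_image_le (f := T.bodies.idxOf) hfin)) 1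
    refine length_le_ncard nodup_labels (fun t ht => ?_) (hfin.image _)
    obtain ⟨e, he, rfl⟩ := mem_labels.1 ht
    rw [hBb] at he
    obtain ⟨x, hx, rfl⟩ := List.mem_map.1 he
    exact ⟨_, hTb x hx, rfl⟩
  refine ⟨c₁ + ((labels B).map (labelCost R L B)).sum, by omega, B.mapBodies (fixedProc R L B), ?_⟩
  simp only [mixedFixes, List.mem_flatMap, mem_select, List.mem_map]
  refine ⟨B, mem_skeletons.2 ⟨by rw [hBc, hs.1], ?_, fun e he => ?_⟩, (a₁, c₁), ⟨?_, hopt,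
    fun b hb => hlab.trans (hd b hb), fun b hb => ?_⟩, rfl⟩
  · rw [hBb, List.map_map, ← hD1]
    rfl
  · rw [hBb] at he
    obtain ⟨x, hx, rfl⟩ := List.mem_map.1 he
    refine (List.idxOf_lt_length_iff.2 (hTb x hx)).trans_le ?_
    rw [Block.length_bodies, ← hs.1]
    omega
  · rw [hBc]
    exact (mem_selOptions hs.1).2 hs
  · rw [hflags]
    exact ha.trans (hcl b hb)

end

/-! ### Computing mixed changes. -/

section

variable {X : Type} [Scale X] {β : X → Type} [∀ x, Enc (β x)] {c : X → Val} {m k : X → ℕ}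
  {R : ∀ x, Requirements (m x) (k x)} {L : ∀ x, Libraries (m x) (k x)}
  {S : ∀ x, SoftSystem (m x) (k x)}
  {B : ∀ x, Block (m x) (Procedure (m x) (k x) × (ℕ × Bool))}

namespace FP

theorem ham [∀ x, LawfulEnc (β x)] {l l' : ∀ x, List (β x)} (h : FP c l) (h' : FP c l') :
    FP c fun x => ham (l x) (l' x) :=
  ((h.zip h').map fun he => he.fst.neq he.snd).sum

theorem best {l : ∀ x, List (ℕ × β x)} (h : FP c l) : FP c fun x => best (l x) :=
  (h.select fun he => FPD.ball h.wk fun hf => FPD.le he.fst.wk hf.fst).head?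

theorem ofLists {cs : ∀ x, List (Literal (m x))} {l : ∀ x, List (β x)} (hc : FP c cs)
    (hl : FP c l) : FP c fun x => Block.ofLists (cs x) (l x) :=
  (hc.length.drop hl).map fun ho => (hc.zip hl).wk.block ho

/-- The bound `hl` on the selector is essential: literals and labels are chosen freely in each
position, and the numbers of choices have exponents at most `m + 1` and `m + 2`. -/
theorem skeletons (hm : FP c m) (hp : ∀ x, m x = Scale.par x) (hS : FP c S)
    (hl : ∀ x, (S x).conds.length ≤ m x + 1) : FP c fun x => skeletons (S x) := by
  refine (FP.words hm.allLits hS.conds.length ?_).flatMap fun hσ => (FP.words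
    (A := fun z => (List.range (m z.1 + 2)).flatMap fun t => [(t, false), (t, true)])
    ((hm.add (const 2)).range.wk.flatMap fun ht => (ht.pair (const false)).cons
      ((ht.pair (const true)).cons nil)) hS.bodies.length.wk ?_).flatMap fun hτ =>
    FP.ofLists hσ.wk (hS.bodies.wk.wk.zip hτ)
  · refine Bdd.mono (Bdd.par fun n => (2 * n + 1) ^ (n + 1)) fun x => ?_
    rw [length_allLits, ← hp]
    exact Nat.pow_le_pow_right (Nat.succ_pos _) (hl x)
  · refine Bdd.mono (Bdd.par fun n => ((n + 2) * 2 + 1) ^ (n + 2)) fun z => ?_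
    have e : Scale.par z = m z.1 := (hp z.1).symm
    have := hl z.1
    rw [e, Block.length_bodies]
    simp only [List.length_flatMap, List.length_cons, List.length_nil, List.map_const',
      List.length_range, List.sum_replicate, smul_eq_mul]
    exact Nat.pow_le_pow_right (Nat.succ_pos _) (by omega)

theorem options {t : X → ℕ} (hm : FP c m) (hp : ∀ x, m x = Scale.par x) (hk : FP c k)
    (hR : FP c R) (hL : FP c L) (hB : FP c B) (ht : FP c t) :
    FP c fun x => options (R x) (L x) (B x) (t x) := by
  have hg : FP c fun x => group (B x) (t x) := hB.bodies.select fun he => FPD.eq he.snd.fst ht.wk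
  have ha : FP c fun x => area (B x) (t x) := (FP.allSits hm hp).select
    (P := fun x s => ((B x).run s).2.1 = t x) fun hs => FPD.eq (hB.wk.run hs).snd.fst ht.wk
  refine hL.librariesPrc.flatMap fun hq => ?_
  have hs := hg.wk.map
    (f := fun (z : Σ x, {q // q ∈ (L x).prc})
      (e : Procedure (m z.1) (k z.1) × (ℕ × Bool)) => source z.2.1 e) fun he =>
    FP.ite (FPD.ofBool he.snd.snd) hq.wk he.fst
  exact hs.flatMap fun hp' => FP.fixMulti hm.wk.wk (fun _ => hp _) hk.wk.wk hR.wk.wk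
    hp'.branches.length hs.wk ha.wk.wk fun _ => List.filter_sublist

theorem labels (hB : FP c B) : FP c fun x => labels (B x) :=
  (hB.bodies.map (f := fun x (e : Procedure (m x) (k x) × (ℕ × Bool)) => e.2.1) fun he =>
    he.snd.fst).dedupBy (key := fun _ => id) fun ht => ht

theorem flags (hB : FP c B) : FP c fun x => flags (B x) :=
  (hB.bodies.map (f := fun x (e : Procedure (m x) (k x) × (ℕ × Bool)) =>
    if e.2.2 = true then 1 else 0) fun he => FP.ite (FPD.ofBool he.snd.snd) (const 1) (const 0)).sum

theorem selOptions {σ : ∀ x, Selector (m x)} (hL : FP c L) (hS : FP c S) (hσ : FP c σ) :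
    FP c fun x => selOptions (L x) (S x) (σ x) :=
  ((const 0).pair (hS.conds.ham hσ)).cons ((hL.librariesSel.select
    (P := fun x q => q.length = (σ x).length) fun hq => FPD.eq hq.length hσ.length.wk).map
    (f := fun x q => (1, _root_.ham q (σ x))) fun hq => (const 1).pair (hq.ham hσ.wk))

theorem labelCost {t : X → ℕ} (hm : FP c m) (hp : ∀ x, m x = Scale.par x) (hk : FP c k)
    (hR : FP c R) (hL : FP c L) (hB : FP c B) (ht : FP c t) :
    FP c fun x => labelCost (R x) (L x) (B x) (t x) :=
  (FP.options hm hp hk hR hL hB ht).best.elim (f := fun x (e : ℕ × Procedure (m x) (k x)) => e.1)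
    (const 0) fun he => he.fst

theorem fixedProc {e : ∀ x, Procedure (m x) (k x) × (ℕ × Bool)} (hm : FP c m)
    (hp : ∀ x, m x = Scale.par x) (hk : FP c k) (hR : FP c R) (hL : FP c L) (hB : FP c B)
    (he : FP c e) : FP c fun x => fixedProc (R x) (L x) (B x) (e x) :=
  (FP.options hm hp hk hR hL hB he.snd.fst).best.elim
    (f := fun x (f : ℕ × Procedure (m x) (k x)) => f.2) he.fst fun hf => hf.snd

theorem mixedFixes {d cl : X → Option Bin} (hm : FP c m) (hp : ∀ x, m x = Scale.par x)
    (hk : FP c k) (hR : FP c R) (hL : FP c L) (hd : FP c d) (hcl : FP c cl) (hS : FP c S)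
    (hl : ∀ x, (S x).conds.length ≤ m x + 1) :
    FP c fun x => mixedFixes (R x) (L x) (d x) (cl x) (S x) := by
  refine (FP.skeletons hm hp hS hl).flatMap fun hB => ?_
  have hcost := (hB.labels.map
    (f := fun (z : Σ x, {y // y ∈ _root_.skeletons (S x)}) t =>
      _root_.labelCost (R z.1) (L z.1) z.2.1 t)
    fun ht => FP.labelCost hm.wk.wk (fun _ => hp _) hk.wk.wk hR.wk.wk hL.wk.wk hB.wk ht).sum
  have hT := hB.mapBodies (f := fun (z : Σ x, {y // y ∈ _root_.skeletons (S x)})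
      (e : Procedure (m z.1) (k z.1) × (ℕ × Bool)) => _root_.fixedProc (R z.1) (L z.1) z.2.1 e)
    (fun he => FP.fixedProc hm.wk.wk (fun _ => hp _) hk.wk.wk hR.wk.wk hL.wk.wk hB.wk he.snd)
    (FP.fixedProc hm.wk (fun _ => hp _) hk.wk hR.wk hL.wk hB hB.otherwise)
  refine ((FP.selOptions hL.wk hS.wk hB.conds).select
    (P := fun (z : Σ x, {y // y ∈ _root_.skeletons (S x)}) (y : ℕ × ℕ) => (∀ t ∈ _root_.labels z.2.1,
      ¬ _root_.options (R z.1) (L z.1) z.2.1 t = []) ∧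
      LeOpt ((_root_.labels z.2.1).length + 1) (d z.1) ∧
      LeOpt (y.1 + _root_.flags z.2.1) (cl z.1)) fun hz => ?_).map
    (f := fun (z : Σ x, {y // y ∈ _root_.skeletons (S x)}) (y : ℕ × ℕ) =>
      (y.2 + ((_root_.labels z.2.1).map (_root_.labelCost (R z.1) (L z.1) z.2.1)).sum,
        z.2.1.mapBodies (_root_.fixedProc (R z.1) (L z.1) z.2.1))) fun hz =>
    (hz.snd.add hcost.wk).pair hT.wk
  have h1 := FPD.ball hB.labels 
    (P := fun (z : Σ x, {y // y ∈ _root_.skeletons (S x)}) t =>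
      ¬ _root_.options (R z.1) (L z.1) z.2.1 t = [])
    fun ht => (FPD.isNil (FP.options hm.wk.wk (fun _ => hp _) hk.wk.wk hR.wk.wk hL.wk.wk
      hB.wk ht)).not
  have h2 := FPD.leOpt (hB.labels.length.add (const 1)) hd.wk
  have h3 := FPD.leOpt (hz.fst.add hB.flags.wk) hcl.wk.wk
  exact h1.wk.and (h2.wk.and h3)

end FP

end

instance : Scale SRecCompA.Inst where
  par := SRecCompAInput.nI
  size x := (SRecCompA.codeInst x).size
  size_pos _ := Val.size_pos _

instance (x : SRecCompA.Inst) : Enc (SRecCompA.Out x) :=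
  inferInstanceAs (Enc (SoftSystem x.nI x.nA))

theorem SRecCompA.fpTractable : SRecCompA.FPTractable (fun x : SRecCompAInput => x.nI) := by
  refine SearchProblem.FPTractable.of_FP (fun _ => rfl) (fun _ => rfl) (fun _ _ => rfl)
    (fun x : SRecCompAInput => pick (mixedFixes (x.R ++ x.Rnew) x.L (some ⟨x.d⟩) (some ⟨x.cl⟩) x.S)
      (some ⟨x.cc⟩)) ?_ ?_ ?_
  · have hm : FP (fun x : {x // SRecCompA.Valid x} => SRecCompA.codeInst x.1)
      (fun x => x.1.nI) := FP.entry 0 (fun _ => rfl) fun _ => le_rfl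
    have hk : FP (fun x : {x // SRecCompA.Valid x} => SRecCompA.codeInst x.1)
      (fun x => x.1.nA) := FP.entry 1 (fun _ => rfl) fun _ => le_rfl
    have hR : FP (fun x : {x // SRecCompA.Valid x} => SRecCompA.codeInst x.1)
      (fun x => x.1.R) := FP.entry 2 (fun _ => rfl) fun _ => le_rfl
    have hS : FP (fun x : {x // SRecCompA.Valid x} => SRecCompA.codeInst x.1)
      (fun x => x.1.S) := FP.entry 3 (fun _ => rfl) fun _ => le_rfl
    have hL : FP (fun x : {x // SRecCompA.Valid x} => SRecCompA.codeInst x.1)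
      (fun x => x.1.L) := FP.entry 4 (fun _ => rfl) fun _ => le_rfl
    have hN : FP (fun x : {x // SRecCompA.Valid x} => SRecCompA.codeInst x.1)
      (fun x => x.1.Rnew) := FP.entry 5 (fun _ => rfl) fun _ => le_rfl
    have hcl : FP (fun x : {x // SRecCompA.Valid x} => SRecCompA.codeInst x.1)
      (fun x => (⟨x.1.cl⟩ : Bin)) := FP.entry 6 (fun _ => rfl) fun _ => le_rfl
    have hc : FP (fun x : {x // SRecCompA.Valid x} => SRecCompA.codeInst x.1)
      (fun x => (⟨x.1.cc⟩ : Bin)) := FP.entry 7 (fun _ => rfl) fun _ => le_rfl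
    have hd : FP (fun x : {x // SRecCompA.Valid x} => SRecCompA.codeInst x.1)
      (fun x => (⟨x.1.d⟩ : Bin)) := FP.entry 8 (fun _ => rfl) fun _ => le_rfl
    exact (FP.mixedFixes hm (fun _ => rfl) hk (hR.append hN) hL hd.some hcl.some hS
      fun x => x.2.2.2).pick hc.some
  · intro x hx y hy
    obtain ⟨n, hn, hb⟩ := mem_of_pick_eq_some hy
    obtain ⟨⟨a, ha, h⟩, hd, hr⟩ := of_mem_mixedFixes hn
    exact ⟨⟨a, ha _ rfl, n, hb _ rfl, h⟩, hd _ rfl, hr⟩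
  · rintro x hx hn y ⟨⟨a, ha, c, hc, h⟩, hd, hr⟩
    obtain ⟨n, hnc, T, hT⟩ := exists_mem_mixedFixes (d := some ⟨x.d⟩) (cl := some ⟨x.cl⟩) hx.2.1
      hx.2.2 h (fun b hb => by
        obtain rfl := Option.mem_some_iff.1 hb
        exact hd) (fun b hb => by
        obtain rfl := Option.mem_some_iff.1 hb
        exact ha) hr
    exact not_mem_of_pick_eq_none hn _ _ hT fun b hb => by
      obtain rfl := Option.mem_some_iff.1 hb
      exact hnc.trans hc

theorem mainTheorem9 :
    SCreSpec.FPTractable (fun x : SCreSpecInput => x.nI) ∧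
    SCreComp.FPTractable (fun x : SCreCompInput => x.nI) ∧
    SCreCompA.FPTractable (fun x : SCreCompAInput => x.nI) ∧
    SRecSpec.FPTractable (fun x : SRecSpecInput => x.nI) ∧
    SRecComp.FPTractable (fun x : SRecCompInput => x.nI) ∧
    SRecCompA.FPTractable (fun x : SRecCompAInput => x.nI) :=
  ⟨SCreSpec.fpTractable, SCreComp.fpTractable, SCreCompA.fpTractable, SRecSpec.fpTractable,
    SRecComp.fpTractable, SRecCompA.fpTractable⟩
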